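/- Work over $\mathbb{C}$. For an arrangement (finite set of lines) $\mathcal{A}$ in a projective plane and $k\ge 2$, a $k$-point of $\mathcal{A}$ is a point at which exactly $k$ lines of $\mathcal{A}$ meet, and $t_k(\mathcal{A})$ is the number of $k$-points. Let $\Lambda_{\{2\},\{3\}}(\mathcal{A})$ be the set of all lines of the plane that contain exactly three of the $2$-points of $\mathcal{A}$. For a set $\mathcal{C}$ of six lines in $\mathbb{P}^2$, let $\check{\mathcal{C}}$ be the set of lines of the dual plane that contain at least two of the six points dual to the lines of $\mathcal{C}$. The arrangement $\mathcal{C}$ is called unassuming if its only singularities are $15$ double points ($t_2(\mathcal{C})=15$ and $t_k(\mathcal{C})=0$ for $k\ge3$), the singularities of $\check{\mathcal{C}}$ are given by $t_2(\check{\mathcal{C}})=27$, $t_3(\check{\mathcal{C}})=6$, $t_5(\check{\mathcal{C}})=6$ (and $t_k(\check{\mathcal{C}})=0$ for all other $k\ge2$), and the $5$-points of $\check{\mathcal{C}}$ do not lie on a conic. Let $\mathcal{M}$ be the moduli space of unassuming arrangements: the set of (unmarked) unassuming arrangements up to projective equivalence, with the Zariski topology and the regular functions that it has as the quotient of the variety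 of $3\times 6$ matrices whose columns are normals of the six lines of an unassuming arrangement. **Theorem.** (1) If $\mathcal{C}_0$ is a generic unassuming arrangement, then $\Lambda_{\{2\},\{3\}}(\mathcal{C}_0)$ is again an unassuming arrangement. Here generic means: there is a dense open subset $U\subset\mathcal{M}$ with finite complement such that the assertion holds for every unassuming $\mathcal{C}_0$ whose class lies in $U$. (2) $\mathcal{M}$ has exactly two irreducible components, and its closure (completion) also has exactly two irreducible components, their closures, one of which is isomorphic to $\mathbb{P}^1$, while the other is a single point. Precisely: there is an isomorphism of $\mathcal{M}$ onto a dense open subvariety of the disjoint union $\mathbb{P}^1\sqcup\{\mathrm{pt}\}$, and under it the closure of the image of one component of $\mathcal{M}$ is $\mathbb{P}^1$ and the closure of the image of the other is $\{\mathrm{pt}\}$. -/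

import Mathlib

open scoped LinearAlgebra.Projectivization

namespace SixLines

/-! ### Points, lines and the operators on arrangements -/

/-- The complex projective plane. -/
abbrev Plane : Type := ℙ ℂ (Fin 3 → ℂ)

/-- The lines of the complex projective plane, given by their normals: the line with normal
`(a : b : c)` is `a x + b y + c z = 0`, so that `p` lies on `l` iff `p.orthogonal l`.  The normals
are the points of the dual plane, whose own lines are the points of the original plane. -/
abbrev Line : Type := ℙ ℂ (Fin 3 → ℂ)

/-- The point operator: the points at which exactly `k` lines of `A` meet (used for `k ≥ 2`). -/
def pointOp (k : ℕ) (A : Set Line) : Set Plane :=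
  {p | {l | l ∈ A ∧ p.orthogonal l}.encard = k}

/-- The line operator: the lines that contain exactly `n` points of `P`. -/
def lineOp (n : ℕ) (P : Set Plane) : Set Line :=
  {l | {p | p ∈ P ∧ p.orthogonal l}.encard = n}

/-- The lines that contain at least `n` points of `P`. -/
def lineOpGE (n : ℕ) (P : Set Plane) : Set Line :=
  {l | (n : ℕ∞) ≤ {p | p ∈ P ∧ p.orthogonal l}.encard}

/-- The operator `Λ_{{m},{n}}`: the lines that contain exactly `n` of the `m`-points of `A`. -/
def lambdaOp (m n : ℕ) (A : Set Line) : Set Line := lineOp n (pointOp m A)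

/-- The points of the dual plane that correspond to the lines of `A`, in the coordinates of the
dual plane: they are the normals of these lines. -/
def dualPoints (A : Set Line) : Set Plane := A

/-- The lines (of the dual plane) through at least two of the points dual to the lines of `A`. -/
def dualArrangement (A : Set Line) : Set Line := lineOpGE 2 (dualPoints A)

/-- The points of `P` lie on a common conic (the zero set of a nonzero quadratic form). -/
def OnConic (P : Set Plane) : Prop :=
  ∃ q : QuadraticForm ℂ (Fin 3 → ℂ), q ≠ 0 ∧ ∀ p ∈ P, q p.rep = 0

/-- Unassuming arrangements of six lines. -/
structure IsUnassuming (A : Set Line) : Prop where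
  card : A.encard = 6
  double : (pointOp 2 A).encard = 15
  only_double : ∀ k, 2 ≤ k → k ≠ 2 → pointOp k A = ∅
  dual_two : (pointOp 2 (dualArrangement A)).encard = 27
  dual_three : (pointOp 3 (dualArrangement A)).encard = 6
  dual_five : (pointOp 5 (dualArrangement A)).encard = 6
  dual_only : ∀ k, 2 ≤ k → k ≠ 2 → k ≠ 3 → k ≠ 5 → pointOp k (dualArrangement A) = ∅
  not_onConic : ¬ OnConic (pointOp 5 (dualArrangement A))

/-! ### Spaces with functions: varieties as topological spaces with regular functions -/

/-- A topological space with a sheaf of algebras of `ℂ`-valued functions, called regular.  A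
function on an open set `U` is given by any extension of it to the whole space. -/
class SpaceWithFunctions (X : Type*) extends TopologicalSpace X where
  RegularOn : Set X → (X → ℂ) → Prop
  congr : ∀ {U f g}, Set.EqOn f g U → RegularOn U f → RegularOn U g
  const : ∀ U c, RegularOn U fun _ => c
  add : ∀ {U f g}, RegularOn U f → RegularOn U g → RegularOn U (f + g)
  mul : ∀ {U f g}, RegularOn U f → RegularOn U g → RegularOn U (f * g)
  mono : ∀ {U V f}, V ⊆ U → RegularOn U f → RegularOn V f
  glue : ∀ {U f}, (∀ x ∈ U, ∃ V, IsOpen V ∧ x ∈ V ∧ RegularOn (V ∩ U) f) → RegularOn U f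

open SpaceWithFunctions

/-- A subset `L` of affine space, to be given its Zariski topology and its regular functions. -/
def ZariskiSet {σ : Type} (L : Set (σ → ℂ)) : Type := L

/-- The Zariski topology has the sets `p ≠ 0`, `p` a polynomial, as a basis. -/
instance {σ : Type} (L : Set (σ → ℂ)) : TopologicalSpace (ZariskiSet L) :=
  .generateFrom {U | ∃ p : MvPolynomial σ ℂ, U = {x | MvPolynomial.eval x.1 p ≠ 0}}

/-- A function is regular if it is locally a quotient of two polynomials. -/
instance {σ : Type} (L : Set (σ → ℂ)) : SpaceWithFunctions (ZariskiSet L) where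
  toTopologicalSpace := inferInstance
  RegularOn U f := ∀ x ∈ U, ∃ V : Set (ZariskiSet L), IsOpen V ∧ x ∈ V ∧
    ∃ p q : MvPolynomial σ ℂ, ∀ y ∈ V ∩ U,
      MvPolynomial.eval y.1 q ≠ 0 ∧ f y = MvPolynomial.eval y.1 p / MvPolynomial.eval y.1 q
  congr h hf x hx := by
    obtain ⟨V, hV, hxV, p, q, hpq⟩ := hf x hx
    exact ⟨V, hV, hxV, p, q, fun y hy => ⟨(hpq y hy).1, (h hy.2) ▸ (hpq y hy).2⟩⟩
  const U c x hx := ⟨Set.univ, isOpen_univ, trivial, MvPolynomial.C c, 1, fun y _ => by simp⟩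
  add hf hg x hx := by
    obtain ⟨V, hV, hxV, p, q, hpq⟩ := hf x hx
    obtain ⟨W, hW, hxW, r, s, hrs⟩ := hg x hx
    refine ⟨V ∩ W, hV.inter hW, ⟨hxV, hxW⟩, p * s + q * r, q * s, fun y hy => ?_⟩
    obtain ⟨h1, h2⟩ := hpq y ⟨hy.1.1, hy.2⟩
    obtain ⟨h3, h4⟩ := hrs y ⟨hy.1.2, hy.2⟩
    refine ⟨by simp [h1, h3], ?_⟩
    simp [h2, h4, div_add_div _ _ h1 h3]
  mul hf hg x hx := by
    obtain ⟨V, hV, hxV, p, q, hpq⟩ := hf x hx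
    obtain ⟨W, hW, hxW, r, s, hrs⟩ := hg x hx
    refine ⟨V ∩ W, hV.inter hW, ⟨hxV, hxW⟩, p * r, q * s, fun y hy => ?_⟩
    obtain ⟨h1, h2⟩ := hpq y ⟨hy.1.1, hy.2⟩
    obtain ⟨h3, h4⟩ := hrs y ⟨hy.1.2, hy.2⟩
    refine ⟨by simp [h1, h3], ?_⟩
    simp [h2, h4, div_mul_div_comm]
  mono hVU hf x hx := by
    obtain ⟨V, hV, hxV, p, q, hpq⟩ := hf x (hVU hx)
    exact ⟨V, hV, hxV, p, q, fun y hy => hpq y ⟨hy.1, hVU hy.2⟩⟩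
  glue h x hx := by
    obtain ⟨W, hW, hxW, hf⟩ := h x hx
    obtain ⟨V, hV, hxV, p, q, hpq⟩ := hf x ⟨hxW, hx⟩
    exact ⟨V ∩ W, hV.inter hW, ⟨hxV, hxW⟩, p, q,
      fun y hy => hpq y ⟨hy.1.1, hy.1.2, hy.2⟩⟩

/-- The quotient structure along `π : X → Q`: a set is open, or a function on it is regular, iff
its pull-back to `X` is. -/
@[reducible] def quotientStructure {X Q : Type*} [SpaceWithFunctions X] (π : X → Q) :
    SpaceWithFunctions Q where
  toTopologicalSpace := TopologicalSpace.coinduced π inferInstance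
  RegularOn U f := RegularOn (π ⁻¹' U) (f ∘ π)
  congr h hf := SpaceWithFunctions.congr (fun _ hx => h hx) hf
  const _ c := SpaceWithFunctions.const _ c
  add hf hg := SpaceWithFunctions.add hf hg
  mul hf hg := SpaceWithFunctions.mul hf hg
  mono h hf := SpaceWithFunctions.mono (Set.preimage_mono h) hf
  glue h := SpaceWithFunctions.glue fun x hx => by
    obtain ⟨V, hV, hxV, hf⟩ := h (π x) hx
    exact ⟨π ⁻¹' V, hV, hxV, hf⟩

/-- A point as a variety: every function is regular. -/
instance : SpaceWithFunctions Unit where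
  toTopologicalSpace := inferInstance
  RegularOn _ _ := True
  congr _ _ := trivial
  const _ _ := trivial
  add _ _ := trivial
  mul _ _ := trivial
  mono _ _ := trivial
  glue _ := trivial

/-- The disjoint union of two spaces with functions. -/
instance {X Y : Type*} [SpaceWithFunctions X] [SpaceWithFunctions Y] :
    SpaceWithFunctions (X ⊕ Y) where
  toTopologicalSpace := inferInstance
  RegularOn U f :=
    RegularOn (Sum.inl ⁻¹' U) (f ∘ Sum.inl) ∧ RegularOn (Sum.inr ⁻¹' U) (f ∘ Sum.inr)
  congr h hf := ⟨SpaceWithFunctions.congr (fun _ hx => h hx) hf.1,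
    SpaceWithFunctions.congr (fun _ hx => h hx) hf.2⟩
  const _ c := ⟨SpaceWithFunctions.const _ c, SpaceWithFunctions.const _ c⟩
  add hf hg := ⟨SpaceWithFunctions.add hf.1 hg.1, SpaceWithFunctions.add hf.2 hg.2⟩
  mul hf hg := ⟨SpaceWithFunctions.mul hf.1 hg.1, SpaceWithFunctions.mul hf.2 hg.2⟩
  mono h hf := ⟨SpaceWithFunctions.mono (Set.preimage_mono h) hf.1,
    SpaceWithFunctions.mono (Set.preimage_mono h) hf.2⟩
  glue h := ⟨SpaceWithFunctions.glue fun x hx => by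
      obtain ⟨V, hV, hxV, hf⟩ := h (Sum.inl x) hx
      exact ⟨Sum.inl ⁻¹' V, hV.1, hxV, hf.1⟩,
    SpaceWithFunctions.glue fun x hx => by
      obtain ⟨V, hV, hxV, hf⟩ := h (Sum.inr x) hx
      exact ⟨Sum.inr ⁻¹' V, hV.2, hxV, hf.2⟩⟩

/-- An isomorphism of spaces with functions from `X` onto an open subspace of `Y`. -/
structure IsOpenImmersion {X Y : Type*} [SpaceWithFunctions X] [SpaceWithFunctions Y]
    (f : X → Y) : Prop where
  isOpenEmbedding : Topology.IsOpenEmbedding f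
  regular_iff : ∀ V : Set Y, IsOpen V → V ⊆ Set.range f → ∀ φ : Y → ℂ,
    RegularOn V φ ↔ RegularOn (f ⁻¹' V) (φ ∘ f)

/-! ### The projective line -/

/-- The complex projective line. -/
def ProjLine : Type := ℙ ℂ (Fin 2 → ℂ)

/-- The projection `ℂ² ∖ {0} → ℙ¹`. -/
noncomputable def ProjLine.proj (v : ZariskiSet {v : Fin 2 → ℂ | v ≠ 0}) : ProjLine :=
  Projectivization.mk ℂ v.1 v.2

/-- The projective line as a variety, the quotient of `ℂ² ∖ {0}` by scaling. -/
noncomputable instance : SpaceWithFunctions ProjLine := quotientStructure ProjLine.proj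

/-! ### The moduli space of unassuming arrangements -/

/-- Projective equivalence of line arrangements.  A projective transformation of the plane acts on
normals by the inverse transpose matrix, and all invertible linear maps arise in this way. -/
def ProjEquiv (A B : Set Line) : Prop :=
  ∃ g : (Fin 3 → ℂ) ≃ₗ[ℂ] (Fin 3 → ℂ), Projectivization.map g.toLinearMap g.injective '' A = B

theorem map_map_symm (g : (Fin 3 → ℂ) ≃ₗ[ℂ] (Fin 3 → ℂ)) (l : Line) :
    Projectivization.map g.symm.toLinearMap g.symm.injective
      (Projectivization.map g.toLinearMap g.injective l) = l := by
  induction l using Projectivization.ind with | h v hv => simp [Projectivization.map_mk]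

theorem map_trans (g h : (Fin 3 → ℂ) ≃ₗ[ℂ] (Fin 3 → ℂ)) (l : Line) :
    Projectivization.map (g.trans h).toLinearMap (g.trans h).injective l =
      Projectivization.map h.toLinearMap h.injective
        (Projectivization.map g.toLinearMap g.injective l) := by
  induction l using Projectivization.ind with | h v hv => simp [Projectivization.map_mk]

/-- Projective equivalence as an equivalence relation on unassuming arrangements. -/
def unassumingSetoid : Setoid {A : Set Line // IsUnassuming A} where
  r A B := ProjEquiv A.1 B.1
  iseqv :=
    { refl := fun A => ⟨LinearEquiv.refl ℂ _, by
        have : Projectivization.map (LinearEquiv.refl ℂ (Fin 3 → ℂ)).toLinearMap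
            (LinearEquiv.refl ℂ (Fin 3 → ℂ)).injective = id := Projectivization.map_id
        rw [this, Set.image_id]⟩
      symm := by
        rintro ⟨A, _⟩ ⟨B, _⟩ ⟨g, rfl⟩
        exact ⟨g.symm, by simp [Set.image_image, map_map_symm]⟩
      trans := by
        rintro ⟨A, _⟩ ⟨B, _⟩ ⟨C, _⟩ ⟨g, rfl⟩ ⟨h, rfl⟩
        exact ⟨g.trans h, by simp only [Set.image_image, map_trans]⟩ }

/-- The moduli space of (unmarked) unassuming arrangements: unassuming arrangements up to
projective equivalence. -/
def Moduli : Type := Quotient unassumingSetoid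

/-- The point of the moduli space given by an unassuming arrangement. -/
def Moduli.mk (A : Set Line) (hA : IsUnassuming A) : Moduli :=
  Quotient.mk unassumingSetoid ⟨A, hA⟩

/-- The `3 × 6` matrices whose columns are nonzero and are the normals of the six lines of an
unassuming arrangement, as a subset of affine space. -/
def normalMatrices : Set (Fin 3 × Fin 6 → ℂ) :=
  {M | ∃ h : ∀ i, (fun j => M (j, i)) ≠ 0,
    IsUnassuming (Set.range fun i => Projectivization.mk ℂ (fun j => M (j, i)) (h i))}

/-- The class of the arrangement given by a matrix of normals. -/
noncomputable def Moduli.proj (M : ZariskiSet normalMatrices) : Moduli :=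
  Moduli.mk (Set.range fun i => Projectivization.mk ℂ (fun j => M.1 (j, i)) (M.2.choose i))
    M.2.choose_spec

/-- The moduli space as a variety: the quotient of the space of matrices of normals by changes of
coordinates, scaling of the normals and permutations of the lines. -/
noncomputable instance : SpaceWithFunctions Moduli := quotientStructure Moduli.proj

end SixLines

/-!
An arrangement of six lines is six points `v 0, …, v 5` of the dual plane, and for no three of
them collinear its dual arrangement consists of the fifteen chords joining two of them. Three
chords meet outside the six points only if they form a *syntheme*, a partition of the six points
into pairs, and the six points are the `5`-points of the dual arrangement. So `v` is unassuming
iff exactly six of the fifteen synthemes are concurrent and the six points are not on a conic.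

The concurrency of a syntheme is an equation `chordDet v k = 0`. The fifteen synthemes correspond
to the pairs of the six *totals* (Sylvester), and Joubert's invariants `joubert v` of the six
totals satisfy `chordDet v k = ±(joubert v i - joubert v j)` for the syntheme of the totals `i`
and `j` (`conc_iff_joubert`). Hence the concurrent synthemes are the pairs inside the parts of a
partition of the six totals, and exactly six pairs means a partition of type `4+1+1` or `3+3`
(`partition_type`). After relabelling, `concSet v` is therefore `fourSet` or `threeSet`
(`IsUnassuming.exists_concSet_eq`).

Each type has a normal form up to projective equivalence: `stdFour r`, with `r` outside a finite
set (`exists_scaled_stdFour`), and `stdThree ω`, with `ω` a primitive cube root of unity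
(`exists_scaled_stdThree`); the latter is a single class. A square of a ratio of products of
brackets is a projective invariant of the labelled arrangements of the first type; it does not
change under the relabellings that keep the type (`inv_eq_of_scaled`), and it takes the value
`(r ^ 2 - 1) ^ 2 / (16 * r ^ 2)` on `stdFour r`. Since `r`, `-r` and `1 / r` give equivalent
arrangements, this value determines the class. So `period`, the invariant on the first type and a
point on the second, is an injection of the moduli space into `ℙ¹ ⊔ pt`.

`period` is continuous and pulls regular functions back to regular functions because near any
matrix of normals the set of concurrent synthemes is constant (`exists_isOpen_concSet`), so that
one labelling serves for the whole neighbourhood. Conversely `r ↦ stdFour r` is a polynomial curve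
in the space of matrices, which makes `period` open, and along it a function on `ℙ¹` that is
regular on the moduli space becomes a rational function of `r` without poles. It descends to a
rational function of the invariant `m` by two quadratic extensions, `r ^ 2 = 4 * k * r + 1` and
`k ^ 2 = m` (`exists_quotient_of_quadratic`).

The lines of an unassuming arrangement meet in the points dual to the chords, and a line contains
exactly three of these points iff, in the dual plane, it is the meeting point of a concurrent
syntheme (`GenPos.lambdaOp_eq`). So the operator `Λ` sends `v` to six such points. On the normal
forms this gives `stdFour (r ^ 2)⁻¹` and `stdThree ω` again (`lambdaOp_stdFour`,
`lambdaOp_stdThree`), and `(r ^ 2)⁻¹` is an admissible parameter for all but finitely many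
classes.
-/

namespace SixLines
open scoped Matrix

/-! ### Brackets of vectors in `ℂ³` -/

/-- The bracket `[a b c]`, the determinant of three vectors of `ℂ³`. -/
def bracket (a b c : Fin 3 → ℂ) : ℂ := a ⬝ᵥ (b ⨯₃ c)

theorem bracket_apply (a b c : Fin 3 → ℂ) : bracket a b c =
    a 0 * (b 1 * c 2 - b 2 * c 1) + a 1 * (b 2 * c 0 - b 0 * c 2) +
      a 2 * (b 0 * c 1 - b 1 * c 0) := by
  simp [bracket, cross_apply, dotProduct, Fin.sum_univ_three]

theorem bracket_self_left (a b : Fin 3 → ℂ) : bracket a a b = 0 := by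
  rw [bracket_apply]; ring

theorem bracket_self_outer (a b : Fin 3 → ℂ) : bracket a b a = 0 := by
  rw [bracket_apply]; ring

theorem bracket_swap (a b c : Fin 3 → ℂ) : bracket a c b = -bracket a b c := by
  simp only [bracket_apply]; ring

theorem bracket_rotate (a b c : Fin 3 → ℂ) : bracket b c a = bracket a b c := by
  simp only [bracket_apply]; ring

theorem bracket_smul (x y z : ℂ) (a b c : Fin 3 → ℂ) :
    bracket (x • a) (y • b) (z • c) = x * y * z * bracket a b c := by
  simp only [bracket_apply, Pi.smul_apply, smul_eq_mul]; ring

/-- Three vectors have a common nonzero orthogonal vector iff their bracket vanishes. -/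
theorem exists_dotProduct_eq_zero_iff (a b c : Fin 3 → ℂ) :
    (∃ p ≠ 0, p ⬝ᵥ a = 0 ∧ p ⬝ᵥ b = 0 ∧ p ⬝ᵥ c = 0) ↔ bracket a b c = 0 := by
  rw [bracket, triple_product_eq_det]
  change _ ↔ (Matrix.of ![a, b, c]).det = 0
  rw [← Matrix.exists_mulVec_eq_zero_iff]
  refine exists_congr fun p => and_congr_right fun _ => ?_
  rw [dotProduct_comm p a, dotProduct_comm p b, dotProduct_comm p c]
  constructor
  · rintro ⟨h1, h2, h3⟩
    ext i; fin_cases i <;> simpa [Matrix.mulVec]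
  · intro h
    exact ⟨congrFun h 0, congrFun h 1, congrFun h 2⟩

/-- A vector orthogonal to two vectors is a multiple of their cross product. -/
theorem cross_eq_zero_of_dotProduct {p a b : Fin 3 → ℂ}
    (ha : p ⬝ᵥ a = 0) (hb : p ⬝ᵥ b = 0) : p ⨯₃ (a ⨯₃ b) = 0 := by
  rw [cross_apply, cross_apply]
  simp only [dotProduct, Fin.sum_univ_three] at ha hb
  ext i
  fin_cases i <;> simp <;> [linear_combination a 0 * hb - b 0 * ha;
    linear_combination a 1 * hb - b 1 * ha; linear_combination a 2 * hb - b 2 * ha]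

theorem mk_eq_of_dotProduct {p q a b : Fin 3 → ℂ} (hp : p ≠ 0) (hq : q ≠ 0) (hab : a ⨯₃ b ≠ 0)
    (h1 : p ⬝ᵥ a = 0) (h2 : p ⬝ᵥ b = 0) (h3 : q ⬝ᵥ a = 0) (h4 : q ⬝ᵥ b = 0) :
    Projectivization.mk ℂ p hp = Projectivization.mk ℂ q hq := by
  have e1 := (Projectivization.mk_eq_mk_iff_crossProduct_eq_zero hp hab).2
    (cross_eq_zero_of_dotProduct h1 h2)
  have e2 := (Projectivization.mk_eq_mk_iff_crossProduct_eq_zero hq hab).2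
    (cross_eq_zero_of_dotProduct h3 h4)
  rw [e1, e2]

theorem bracket_map (g : (Fin 3 → ℂ) →ₗ[ℂ] (Fin 3 → ℂ)) (a b c : Fin 3 → ℂ) :
    bracket (g a) (g b) (g c) = LinearMap.det g * bracket a b c := by
  simp only [bracket, triple_product_eq_det]
  change (Matrix.of ![g a, g b, g c]).det = _ * (Matrix.of ![a, b, c]).det
  rw [← LinearMap.det_toMatrix', mul_comm, ← Matrix.det_transpose (LinearMap.toMatrix' g),
    ← Matrix.det_mul]
  congr 1
  ext i j
  have h : ∀ x : Fin 3 → ℂ, (x ᵥ* (LinearMap.toMatrix' g)ᵀ) = g x := fun x => by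
    rw [Matrix.vecMul_transpose, LinearMap.toMatrix'_mulVec]
  have h2 := congrFun (h (![a, b, c] i)) j
  have h3 : ![g a, g b, g c] i = g (![a, b, c] i) := by fin_cases i <;> rfl
  exact (congrFun h3 j).trans h2.symm

theorem cross_cross_common (a b c : Fin 3 → ℂ) : (a ⨯₃ b) ⨯₃ (a ⨯₃ c) = bracket a b c • a := by
  ext i
  fin_cases i <;> simp [cross_apply, bracket_apply] <;> ring

/-! ### Synthemes and totals -/

/-- The fifteen partitions of six labels into three pairs (synthemes), listed in the order of the
pairs of totals of `totalLeft` and `totalRight`. -/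
def edge : Fin 15 → Fin 3 → Fin 6 × Fin 6 :=
  ![![(0,5),(1,4),(2,3)], ![(0,3),(1,2),(4,5)], ![(0,1),(2,4),(3,5)], ![(0,4),(1,3),(2,5)],
    ![(0,2),(1,5),(3,4)], ![(0,1),(2,5),(3,4)], ![(0,2),(1,3),(4,5)], ![(0,3),(1,5),(2,4)],
    ![(0,4),(1,2),(3,5)], ![(0,4),(1,5),(2,3)], ![(0,2),(1,4),(3,5)], ![(0,5),(1,3),(2,4)],
    ![(0,5),(1,2),(3,4)], ![(0,3),(1,4),(2,5)], ![(0,1),(2,3),(4,5)]]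

/-- The synthemes as involutions of the labels. -/
def swapMap (k : Fin 15) (i : Fin 6) : Fin 6 :=
  if i = (edge k 0).1 then (edge k 0).2 else if i = (edge k 0).2 then (edge k 0).1 else
  if i = (edge k 1).1 then (edge k 1).2 else if i = (edge k 1).2 then (edge k 1).1 else
  if i = (edge k 2).1 then (edge k 2).2 else (edge k 2).1

/-- Each syntheme lies in exactly two of the six totals (the sets of five disjoint synthemes), and
is the only syntheme in both: the first of these totals. -/
def totalLeft : Fin 15 → Fin 6 := ![0, 0, 0, 0, 0, 1, 1, 1, 1, 2, 2, 2, 3, 3, 4]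

/-- The second of the two totals of a syntheme. -/
def totalRight : Fin 15 → Fin 6 := ![1, 2, 3, 4, 5, 2, 3, 4, 5, 3, 4, 5, 4, 5, 5]

theorem swapMap_edge : ∀ k s, swapMap k (edge k s).1 = (edge k s).2 := by decide

theorem exists_edge : ∀ k i, ∃ s, (i = (edge k s).1 ∧ swapMap k i = (edge k s).2) ∨
    (i = (edge k s).2 ∧ swapMap k i = (edge k s).1) := by decide

theorem swapMap_injective : Function.Injective swapMap := by
  have h : ∀ k l, (∀ i, swapMap k i = swapMap l i) → k = l := by decide
  exact fun k l e => h k l (congrFun e)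

theorem swapMap_swapMap : ∀ k i, swapMap k (swapMap k i) = i := by decide

theorem swapMap_ne : ∀ k i, swapMap k i ≠ i := by decide

/-- For six labelled points, the chords joining each point `i` to the point `f i` have a common
point. -/
def Conc (v : Fin 6 → Fin 3 → ℂ) (f : Fin 6 → Fin 6) : Prop :=
  ∃ p ≠ 0, ∀ i, bracket p (v i) (v (f i)) = 0

theorem forall_swapMap_iff (v : Fin 6 → Fin 3 → ℂ) (k : Fin 15) (p : Fin 3 → ℂ) :
    (∀ i, bracket p (v i) (v (swapMap k i)) = 0) ↔
      ∀ s, bracket p (v (edge k s).1) (v (edge k s).2) = 0 := by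
  constructor
  · intro h s
    rw [← swapMap_edge]; exact h _
  · intro h i
    obtain ⟨s, ⟨h1, h2⟩ | ⟨h1, h2⟩⟩ := exists_edge k i
    · rw [h2, h1]; exact h s
    · rw [h2, h1, bracket_swap, h s, neg_zero]

/-- The determinant of the three chords of a syntheme. -/
def chordDet (v : Fin 6 → Fin 3 → ℂ) (k : Fin 15) : ℂ :=
  bracket (v (edge k 0).1 ⨯₃ v (edge k 0).2) (v (edge k 1).1 ⨯₃ v (edge k 1).2)
    (v (edge k 2).1 ⨯₃ v (edge k 2).2)

theorem conc_iff_chordDet (v : Fin 6 → Fin 3 → ℂ) (k : Fin 15) :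
    Conc v (swapMap k) ↔ chordDet v k = 0 := by
  rw [chordDet, ← exists_dotProduct_eq_zero_iff]
  refine exists_congr fun p => and_congr_right fun _ => ?_
  rw [forall_swapMap_iff]
  exact ⟨fun h => ⟨h 0, h 1, h 2⟩, fun ⟨h0, h1, h2⟩ s => by fin_cases s <;> assumption⟩

/-- Joubert's invariants of the six totals, normalised to vanish at the first total. -/
def joubert (v : Fin 6 → Fin 3 → ℂ) : Fin 6 → ℂ :=
  ![0, -chordDet v 0, -chordDet v 1, -chordDet v 2, chordDet v 3, -chordDet v 4]

theorem bracket_cross_cross_cross (a b c d e f : Fin 3 → ℂ) :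
    bracket (a ⨯₃ b) (c ⨯₃ d) (e ⨯₃ f) =
      bracket a c d * bracket b e f - bracket b c d * bracket a e f := by
  simp only [bracket_apply, cross_apply]
  simp
  ring

theorem chordDet_eq_joubert (v : Fin 6 → Fin 3 → ℂ) (k : Fin 15) :
    chordDet v k = joubert v (totalLeft k) - joubert v (totalRight k) ∨
    chordDet v k = joubert v (totalRight k) - joubert v (totalLeft k) := by
  have e := bracket_cross_cross_cross
  fin_cases k <;>
    simp only [joubert, totalLeft, totalRight, chordDet, edge, e, bracket_apply, Fin.mk_zero,
      Fin.mk_one, Fin.reduceFinMk, Matrix.cons_val, Matrix.cons_val_zero, Matrix.cons_val_one] <;>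
    first
    | (left; ring1)
    | (right; ring1)

/-- Coble: a syntheme is concurrent iff the Joubert invariants of its two totals agree. -/
theorem conc_iff_joubert (v : Fin 6 → Fin 3 → ℂ) (k : Fin 15) :
    Conc v (swapMap k) ↔ joubert v (totalLeft k) = joubert v (totalRight k) := by
  rw [conc_iff_chordDet]
  rcases chordDet_eq_joubert v k with h | h <;> rw [h, sub_eq_zero]
  exact eq_comm

/-! ### Six points in general position and the chords through a point -/

/-- Six vectors of `ℂ³`, no three of which are dependent. -/
def GenPos (v : Fin 6 → Fin 3 → ℂ) : Prop :=
  ∀ i j k, i ≠ j → j ≠ k → i ≠ k → bracket (v i) (v j) (v k) ≠ 0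

theorem exists_two_others : ∀ i : Fin 6, ∃ j k, i ≠ j ∧ j ≠ k ∧ i ≠ k := by decide

theorem exists_third : ∀ i j : Fin 6, i ≠ j → ∃ k, j ≠ k ∧ i ≠ k := by decide

theorem GenPos.ne_zero {v : Fin 6 → Fin 3 → ℂ} (hv : GenPos v) (i : Fin 6) : v i ≠ 0 := by
  obtain ⟨j, k, h1, h2, h3⟩ := exists_two_others i
  intro h
  exact hv i j k h1 h2 h3 (by rw [h, bracket_apply]; simp)

theorem GenPos.cross_ne_zero {v : Fin 6 → Fin 3 → ℂ} (hv : GenPos v) {i j : Fin 6} (h : i ≠ j) :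
    v i ⨯₃ v j ≠ 0 := by
  obtain ⟨k, h2, h3⟩ := exists_third i j h
  intro h0
  exact hv i j k h h2 h3 (by rw [← bracket_rotate, ← bracket_rotate, bracket, h0]; simp)

/-- The arrangement of the lines with given normals. -/
def arr (v : Fin 6 → Fin 3 → ℂ) (h : ∀ i, v i ≠ 0) : Set Line :=
  Set.range fun i => Projectivization.mk ℂ (v i) (h i)

theorem GenPos.mk_injective {v : Fin 6 → Fin 3 → ℂ} (hv : GenPos v) :
    Function.Injective fun i => Projectivization.mk ℂ (v i) (hv.ne_zero i) := by
  intro i j h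
  by_contra hij
  exact hv.cross_ne_zero hij
    ((Projectivization.mk_eq_mk_iff_crossProduct_eq_zero _ _).1 h)

/-- The pairs of labels, each written in increasing order. -/
def edges : Finset (Fin 6 × Fin 6) := {e | e.1 < e.2}

theorem GenPos.dotProduct_eq_zero_iff {v : Fin 6 → Fin 3 → ℂ} (hv : GenPos v) {i j : Fin 6}
    (hij : i ≠ j) (k : Fin 6) : bracket (v k) (v i) (v j) = 0 ↔ k = i ∨ k = j := by
  constructor
  · intro h
    by_contra! hk
    exact hv k i j hk.1 hij hk.2 h
  · rintro (rfl | rfl)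
    · exact bracket_self_left _ _
    · exact bracket_self_outer _ _

/-- The line joining two of six labelled points. -/
noncomputable def chord (v : Fin 6 → Fin 3 → ℂ) (h : ∀ i, v i ≠ 0) (e : Fin 6 × Fin 6) : Line :=
  Projectivization.cross (Projectivization.mk ℂ (v e.1) (h e.1))
    (Projectivization.mk ℂ (v e.2) (h e.2))

theorem GenPos.chord_eq {v : Fin 6 → Fin 3 → ℂ} (hv : GenPos v) {e : Fin 6 × Fin 6}
    (he : e.1 ≠ e.2) :
    chord v hv.ne_zero e = Projectivization.mk ℂ (v e.1 ⨯₃ v e.2) (hv.cross_ne_zero he) :=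
  Projectivization.cross_mk_of_cross_ne_zero _ _ _

theorem GenPos.mk_orthogonal_chord {v : Fin 6 → Fin 3 → ℂ} (hv : GenPos v) {e : Fin 6 × Fin 6}
    (he : e.1 ≠ e.2) {x : Fin 3 → ℂ} (hx : x ≠ 0) :
    (Projectivization.mk ℂ x hx).orthogonal (chord v hv.ne_zero e) ↔
      bracket x (v e.1) (v e.2) = 0 := by
  rw [hv.chord_eq he, Projectivization.orthogonal_mk]; rfl

theorem edges_ne {e : Fin 6 × Fin 6} (he : e ∈ edges) : e.1 ≠ e.2 := by
  simp only [edges, Finset.mem_filter] at he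
  exact he.2.ne

theorem edge_subset_eq : ∀ e ∈ edges, ∀ e' ∈ edges, (e'.1 = e.1 ∨ e'.1 = e.2) →
    (e'.2 = e.1 ∨ e'.2 = e.2) → e' = e := by decide

theorem GenPos.chord_injOn {v : Fin 6 → Fin 3 → ℂ} (hv : GenPos v) :
    Set.InjOn (chord v hv.ne_zero) edges := by
  intro e he e' he' h
  have key : ∀ k, (k = e.1 ∨ k = e.2) ↔ (k = e'.1 ∨ k = e'.2) := fun k => by
    rw [← hv.dotProduct_eq_zero_iff (edges_ne he), ← hv.dotProduct_eq_zero_iff (edges_ne he'),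
      ← hv.mk_orthogonal_chord (edges_ne he) (hv.ne_zero k),
      ← hv.mk_orthogonal_chord (edges_ne he') (hv.ne_zero k), h]
  exact edge_subset_eq e' he' e he ((key _).1 (Or.inl rfl)) ((key _).1 (Or.inr rfl))

theorem two_le_encard_iff {α : Type*} {s : Set α} :
    ((2 : ℕ) : ℕ∞) ≤ s.encard ↔ ∃ a b, a ∈ s ∧ b ∈ s ∧ a ≠ b := by
  rw [← Set.one_lt_encard_iff, ← Order.add_one_le_iff_of_not_isMax (by simp)]
  norm_num

theorem exists_edge_of_ne : ∀ i j : Fin 6, i ≠ j →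
    ∃ e ∈ edges, (i = e.1 ∧ j = e.2) ∨ (i = e.2 ∧ j = e.1) := by decide

/-- The dual arrangement consists of the fifteen chords. -/
theorem GenPos.dualArrangement_eq {v : Fin 6 → Fin 3 → ℂ} (hv : GenPos v) :
    dualArrangement (arr v hv.ne_zero) = chord v hv.ne_zero '' edges := by
  ext l
  rw [dualArrangement, lineOpGE, Set.mem_ofPred_eq, two_le_encard_iff]
  constructor
  · rintro ⟨_, _, ⟨⟨i, rfl⟩, hi⟩, ⟨⟨j, rfl⟩, hj⟩, hij⟩
    have hij' : i ≠ j := fun h => hij (by subst h; rfl)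
    induction l using Projectivization.ind with | h w hw => ?_
    obtain ⟨e, he, hh⟩ := exists_edge_of_ne i j hij'
    refine ⟨e, he, ?_⟩
    simp only [Projectivization.orthogonal_mk] at hi hj
    rw [hv.chord_eq (edges_ne he), eq_comm, Projectivization.mk_eq_mk_iff_crossProduct_eq_zero]
    rw [dotProduct_comm] at hi hj
    rcases hh with ⟨h1, h2⟩ | ⟨h1, h2⟩ <;> subst h1 <;> subst h2
    · exact cross_eq_zero_of_dotProduct hi hj
    · exact cross_eq_zero_of_dotProduct hj hi
  · rintro ⟨e, he, rfl⟩
    refine ⟨_, _, ⟨⟨e.1, rfl⟩, ?_⟩, ⟨⟨e.2, rfl⟩, ?_⟩, hv.mk_injective.ne (edges_ne he)⟩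
    · exact (hv.mk_orthogonal_chord (edges_ne he) _).2 (bracket_self_left _ _)
    · exact (hv.mk_orthogonal_chord (edges_ne he) _).2 (bracket_self_outer _ _)

open Classical in
/-- The chords through a point, as pairs of labels. -/
noncomputable def thru (v : Fin 6 → Fin 3 → ℂ) (p : Plane) : Finset (Fin 6 × Fin 6) :=
  {e ∈ edges | bracket p.rep (v e.1) (v e.2) = 0}

theorem mem_thru_mk {v : Fin 6 → Fin 3 → ℂ} {x : Fin 3 → ℂ} (hx : x ≠ 0) {e : Fin 6 × Fin 6} :
    e ∈ thru v (Projectivization.mk ℂ x hx) ↔ e ∈ edges ∧ bracket x (v e.1) (v e.2) = 0 := by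
  classical
  obtain ⟨a, ha⟩ := Projectivization.exists_smul_eq_mk_rep ℂ x hx
  rw [thru, Finset.mem_filter, ← ha, Units.smul_def]
  have := bracket_smul a 1 1 x (v e.1) (v e.2)
  simp only [one_smul] at this
  rw [this]
  simp

theorem GenPos.mem_thru {v : Fin 6 → Fin 3 → ℂ} (hv : GenPos v) (p : Plane) {e : Fin 6 × Fin 6} :
    e ∈ thru v p ↔ e ∈ edges ∧ p.orthogonal (chord v hv.ne_zero e) := by
  induction p using Projectivization.ind with | h x hx => ?_
  rw [mem_thru_mk]
  exact and_congr_right fun he => (hv.mk_orthogonal_chord (edges_ne he) hx).symm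

theorem GenPos.mem_pointOp_dual {v : Fin 6 → Fin 3 → ℂ} (hv : GenPos v) (k : ℕ) (p : Plane) :
    p ∈ pointOp k (dualArrangement (arr v hv.ne_zero)) ↔ (thru v p).card = k := by
  have h : {l | l ∈ dualArrangement (arr v hv.ne_zero) ∧ p.orthogonal l} =
      chord v hv.ne_zero '' (thru v p) := by
    rw [hv.dualArrangement_eq]
    ext l
    constructor
    · rintro ⟨⟨e, he, rfl⟩, h⟩
      exact ⟨e, (hv.mem_thru p).2 ⟨he, h⟩, rfl⟩
    · rintro ⟨e, he, rfl⟩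
      have := (hv.mem_thru p).1 he
      exact ⟨⟨e, this.1, rfl⟩, this.2⟩
  rw [pointOp, Set.mem_ofPred_eq, h, Set.InjOn.encard_image, Set.encard_coe_eq_coe_finsetCard]
  · norm_cast
  · exact hv.chord_injOn.mono fun e he => ((hv.mem_thru p).1 he).1

theorem GenPos.thru_point {v : Fin 6 → Fin 3 → ℂ} (hv : GenPos v) (i : Fin 6) :
    thru v (Projectivization.mk ℂ (v i) (hv.ne_zero i)) = {e ∈ edges | i = e.1 ∨ i = e.2} := by
  ext e
  rw [mem_thru_mk, Finset.mem_filter]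
  exact and_congr_right fun he => hv.dotProduct_eq_zero_iff (edges_ne he) i

theorem card_edges_at : ∀ i : Fin 6, ({e ∈ edges | i = e.1 ∨ i = e.2}).card = 5 := by decide

/-- Two pairs of labels have no label in common. -/
def Apart (e e' : Fin 6 × Fin 6) : Prop :=
  e.1 ≠ e'.1 ∧ e.1 ≠ e'.2 ∧ e.2 ≠ e'.1 ∧ e.2 ≠ e'.2

instance : DecidableRel Apart := fun _ _ => inferInstanceAs (Decidable (_ ∧ _))

theorem exists_common : ∀ e ∈ edges, ∀ e' ∈ edges, e ≠ e' → ¬ Apart e e' → ∃ i j k, i ≠ j ∧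
    j ≠ k ∧ i ≠ k ∧ ((i = e.1 ∧ j = e.2) ∨ (i = e.2 ∧ j = e.1)) ∧
      ((i = e'.1 ∧ k = e'.2) ∨ (i = e'.2 ∧ k = e'.1)) := by decide

theorem bracket_eq_zero_of_edge {v : Fin 6 → Fin 3 → ℂ} {x : Fin 3 → ℂ} {e : Fin 6 × Fin 6}
    {i j : Fin 6} (h : bracket x (v e.1) (v e.2) = 0)
    (hij : (i = e.1 ∧ j = e.2) ∨ (i = e.2 ∧ j = e.1)) : bracket x (v i) (v j) = 0 := by
  rcases hij with ⟨rfl, rfl⟩ | ⟨rfl, rfl⟩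
  · exact h
  · rw [bracket_swap, h, neg_zero]

/-- Outside the six points, different chords through the same point have disjoint labels. -/
theorem GenPos.apart_of_mem_thru {v : Fin 6 → Fin 3 → ℂ} (hv : GenPos v) {p : Plane}
    (hp : p ∉ arr v hv.ne_zero) {e e' : Fin 6 × Fin 6} (he : e ∈ thru v p) (he' : e' ∈ thru v p)
    (hne : e ≠ e') : Apart e e' := by
  induction p using Projectivization.ind with | h x hx => ?_
  by_contra hA
  rw [mem_thru_mk] at he he'
  obtain ⟨i, j, k, hij, hjk, hik, h1, h2⟩ := exists_common e he.1 e' he'.1 hne hA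
  have hj := bracket_eq_zero_of_edge he.2 h1
  have hk := bracket_eq_zero_of_edge he'.2 h2
  refine hp ⟨i, ?_⟩
  refine mk_eq_of_dotProduct (hv.ne_zero i) hx (a := v i ⨯₃ v j) (b := v i ⨯₃ v k) ?_
    (bracket_self_left _ _) (bracket_self_left _ _) hj hk
  rw [cross_cross_common]
  exact smul_ne_zero (hv i j k hij hjk hik) (hv.ne_zero i)

/-- The set of the three pairs of a syntheme. -/
def edgeSet (k : Fin 15) : Finset (Fin 6 × Fin 6) := {edge k 0, edge k 1, edge k 2}

theorem edgeSet_of_apart : ∀ a ∈ edges, ∀ b ∈ edges, Apart a b → ∀ c ∈ edges, Apart a c →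
    Apart b c → ∃ k, ({a, b, c} : Finset _) = edgeSet k := by decide +kernel

theorem erase_edgeSet_of_apart : ∀ a ∈ edges, ∀ b ∈ edges, Apart a b →
    ∃ k s, ({a, b} : Finset _) = (edgeSet k).erase (edge k s) := by decide +kernel

theorem edgeSet_injective : Function.Injective edgeSet := by
  have : ∀ k l, edgeSet k = edgeSet l → k = l := by decide +kernel
  exact fun k l h => this k l h

theorem erase_edgeSet_injective :
    Function.Injective fun x : Fin 15 × Fin 3 => (edgeSet x.1).erase (edge x.1 x.2) := by
  have : ∀ k s l t, (edgeSet k).erase (edge k s) = (edgeSet l).erase (edge l t) →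
      k = l ∧ s = t := by decide +kernel
  exact fun x y h => Prod.ext (this _ _ _ _ h).1 (this _ _ _ _ h).2

theorem edge_mem_edges : ∀ k s, edge k s ∈ edges := by decide

theorem card_edgeSet : ∀ k, (edgeSet k).card = 3 := by decide

theorem card_erase_edgeSet : ∀ k s, ((edgeSet k).erase (edge k s)).card = 2 := by decide

theorem edgeSet_apart : ∀ k, ∀ e ∈ edgeSet k, ∀ e' ∈ edgeSet k, e ≠ e' → Apart e e' := by decide

theorem eq_of_erase_subset : ∀ k s l, (edgeSet k).erase (edge k s) ⊆ edgeSet l → l = k := by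
  decide +kernel

theorem exists_pair_erase : ∀ k s, ∃ a ∈ edgeSet k, ∃ b ∈ edgeSet k, a ≠ b ∧
    (edgeSet k).erase (edge k s) = {a, b} := by decide +kernel

theorem edgeSet_subset : ∀ k, edgeSet k ⊆ edges := by decide

theorem GenPos.card_thru_le {v : Fin 6 → Fin 3 → ℂ} (hv : GenPos v) {p : Plane}
    (hp : p ∉ arr v hv.ne_zero) : (thru v p).card ≤ 3 := by
  have h1 : ((thru v p).biUnion fun e => {e.1, e.2}).card = ∑ e ∈ thru v p, 2 := by
    rw [Finset.card_biUnion]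
    · refine Finset.sum_congr rfl fun e he => Finset.card_pair ?_
      exact edges_ne ((hv.mem_thru p).1 he).1
    · intro e he e' he' hne
      have := hv.apart_of_mem_thru hp he he' hne
      simp only [Apart] at this
      simp only [Finset.disjoint_left, Finset.mem_insert, Finset.mem_singleton]
      rintro a (rfl | rfl) <;> simp [this]
  have h2 := Finset.card_le_univ ((thru v p).biUnion fun e => {e.1, e.2})
  rw [h1, Finset.sum_const, Fintype.card_fin] at h2
  simp at h2
  omega

theorem GenPos.thru_eq_edgeSet {v : Fin 6 → Fin 3 → ℂ} (hv : GenPos v) {p : Plane}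
    (hp : p ∉ arr v hv.ne_zero) (h : (thru v p).card = 3) : ∃ k, thru v p = edgeSet k := by
  obtain ⟨a, b, c, hab, hac, hbc, he⟩ := Finset.card_eq_three.1 h
  have ha : a ∈ thru v p := by simp [he]
  have hb : b ∈ thru v p := by simp [he]
  have hc : c ∈ thru v p := by simp [he]
  rw [he]
  exact edgeSet_of_apart a ((hv.mem_thru p).1 ha).1 b ((hv.mem_thru p).1 hb).1
    (hv.apart_of_mem_thru hp ha hb hab) c ((hv.mem_thru p).1 hc).1
    (hv.apart_of_mem_thru hp ha hc hac) (hv.apart_of_mem_thru hp hb hc hbc)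

theorem GenPos.thru_eq_erase {v : Fin 6 → Fin 3 → ℂ} (hv : GenPos v) {p : Plane}
    (hp : p ∉ arr v hv.ne_zero) (h : (thru v p).card = 2) :
    ∃ k s, thru v p = (edgeSet k).erase (edge k s) := by
  obtain ⟨a, b, hab, he⟩ := Finset.card_eq_two.1 h
  have ha : a ∈ thru v p := by simp [he]
  have hb : b ∈ thru v p := by simp [he]
  rw [he]
  exact erase_edgeSet_of_apart a ((hv.mem_thru p).1 ha).1 b ((hv.mem_thru p).1 hb).1
    (hv.apart_of_mem_thru hp ha hb hab)

/-- A point is determined by two of the chords through it. -/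
theorem GenPos.eq_of_mem_thru {v : Fin 6 → Fin 3 → ℂ} (hv : GenPos v) {p q : Plane}
    {a b : Fin 6 × Fin 6} (hab : a ≠ b) (hpa : a ∈ thru v p) (hpb : b ∈ thru v p)
    (hqa : a ∈ thru v q) (hqb : b ∈ thru v q) : p = q := by
  induction p using Projectivization.ind with | h x hx => ?_
  induction q using Projectivization.ind with | h y hy => ?_
  rw [mem_thru_mk] at *
  refine mk_eq_of_dotProduct hx hy (a := v a.1 ⨯₃ v a.2) (b := v b.1 ⨯₃ v b.2) ?_ hpa.2 hpb.2
    hqa.2 hqb.2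
  intro h0
  refine hab (hv.chord_injOn hpa.1 hpb.1 ?_)
  rw [hv.chord_eq (edges_ne hpa.1), hv.chord_eq (edges_ne hpb.1)]
  exact (Projectivization.mk_eq_mk_iff_crossProduct_eq_zero _ _).2 h0

theorem GenPos.thru_injOn {v : Fin 6 → Fin 3 → ℂ} (hv : GenPos v) :
    Set.InjOn (thru v) {p | 2 ≤ (thru v p).card} := by
  intro p hp q _ h
  obtain ⟨a, ha, b, hb, hab⟩ := Finset.one_lt_card.1 (show 1 < (thru v p).card from hp)
  exact hv.eq_of_mem_thru hab ha hb (h ▸ ha) (h ▸ hb)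

theorem GenPos.not_mem_arr {v : Fin 6 → Fin 3 → ℂ} (hv : GenPos v) {p : Plane}
    {a b : Fin 6 × Fin 6} (hab : Apart a b) (ha : a ∈ thru v p) (hb : b ∈ thru v p) :
    p ∉ arr v hv.ne_zero := by
  rintro ⟨i, rfl⟩
  rw [hv.thru_point, Finset.mem_filter] at ha hb
  obtain ⟨h1, h2, h3, h4⟩ := hab
  rcases ha.2 with h | h <;> rcases hb.2 with h' | h' <;> subst h <;> contradiction

theorem conc_iff_exists_subset {v : Fin 6 → Fin 3 → ℂ} (k : Fin 15) :
    Conc v (swapMap k) ↔ ∃ p : Plane, edgeSet k ⊆ thru v p := by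
  have key : ∀ x (hx : x ≠ 0), (∀ i, bracket x (v i) (v (swapMap k i)) = 0) ↔
      edgeSet k ⊆ thru v (Projectivization.mk ℂ x hx) := by
    intro x hx
    rw [forall_swapMap_iff]
    simp only [Finset.subset_iff, mem_thru_mk, edgeSet, Finset.mem_insert, Finset.mem_singleton]
    constructor
    · rintro h e (rfl | rfl | rfl) <;> exact ⟨edge_mem_edges _ _, h _⟩
    · intro h s
      fin_cases s <;> refine (h ?_).2 <;> simp
  constructor
  · rintro ⟨x, hx, h⟩
    exact ⟨_, (key x hx).1 h⟩
  · rintro ⟨p, h⟩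
    induction p using Projectivization.ind with | h x hx => ?_
    exact ⟨x, hx, (key x hx).2 h⟩

theorem GenPos.thru_eq_of_edgeSet_subset {v : Fin 6 → Fin 3 → ℂ} (hv : GenPos v) {p : Plane}
    {k : Fin 15} (h : edgeSet k ⊆ thru v p) : p ∉ arr v hv.ne_zero ∧ thru v p = edgeSet k := by
  have hp : p ∉ arr v hv.ne_zero := by
    have h0 : edge k 0 ∈ edgeSet k := by simp [edgeSet]
    have h1 : edge k 1 ∈ edgeSet k := by simp [edgeSet]
    have hne : ∀ k, edge k 0 ≠ edge k 1 := by decide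
    exact hv.not_mem_arr (edgeSet_apart k _ h0 _ h1 (hne k)) (h h0) (h h1)
  exact ⟨hp, (Finset.eq_of_subset_of_card_le h
    (by rw [card_edgeSet]; exact hv.card_thru_le hp)).symm⟩

open Classical in
/-- The concurrent synthemes. -/
noncomputable def concSet (v : Fin 6 → Fin 3 → ℂ) : Finset (Fin 15) := {k | Conc v (swapMap k)}

theorem mem_concSet {v : Fin 6 → Fin 3 → ℂ} {k : Fin 15} :
    k ∈ concSet v ↔ Conc v (swapMap k) := by simp [concSet]

/-- The triple points of the chords correspond to the concurrent synthemes. -/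
theorem GenPos.thru_image_three {v : Fin 6 → Fin 3 → ℂ} (hv : GenPos v) :
    thru v '' (pointOp 3 (dualArrangement (arr v hv.ne_zero))) =
      ((concSet v).image edgeSet : Finset _) := by
  ext E
  simp only [Set.mem_image, hv.mem_pointOp_dual, Finset.coe_image, Finset.mem_coe, mem_concSet,
    conc_iff_exists_subset]
  constructor
  · rintro ⟨p, h3, rfl⟩
    have hp : p ∉ arr v hv.ne_zero := by
      rintro ⟨i, rfl⟩
      rw [hv.thru_point, card_edges_at] at h3
      omega
    obtain ⟨k, hk⟩ := hv.thru_eq_edgeSet hp h3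
    exact ⟨k, ⟨p, hk.ge⟩, hk.symm⟩
  · rintro ⟨k, ⟨p, hp⟩, rfl⟩
    have := (hv.thru_eq_of_edgeSet_subset hp).2
    exact ⟨p, by rw [this, card_edgeSet], this⟩

/-- The double points of the chords correspond to the synthemes that are not concurrent, with one
of their pairs left out. -/
theorem GenPos.thru_image_two {v : Fin 6 → Fin 3 → ℂ} (hv : GenPos v) :
    thru v '' (pointOp 2 (dualArrangement (arr v hv.ne_zero))) =
      (((concSet v)ᶜ ×ˢ Finset.univ).image
        (fun x : Fin 15 × Fin 3 => (edgeSet x.1).erase (edge x.1 x.2)) : Finset _) := by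
  ext E
  simp only [Set.mem_image, hv.mem_pointOp_dual, Finset.coe_image, Finset.mem_coe,
    Finset.mem_product, Finset.mem_compl, Finset.mem_univ, and_true, Prod.exists, mem_concSet,
    conc_iff_exists_subset]
  constructor
  · rintro ⟨p, h2, rfl⟩
    have hp : p ∉ arr v hv.ne_zero := by
      rintro ⟨i, rfl⟩
      rw [hv.thru_point, card_edges_at] at h2
      omega
    obtain ⟨k, s, hk⟩ := hv.thru_eq_erase hp h2
    refine ⟨k, s, ?_, hk.symm⟩
    rintro ⟨q, hq⟩
    have hpq : p = q := by
      obtain ⟨a, ha, b, hb, hab⟩ := Finset.one_lt_card.1 (show 1 < (thru v p).card by omega)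
      have hs : thru v p ⊆ thru v q := hk.le.trans ((Finset.erase_subset _ _).trans hq)
      exact hv.eq_of_mem_thru hab ha hb (hs ha) (hs hb)
    have := Finset.card_le_card hq
    rw [← hpq, h2, card_edgeSet] at this
    omega
  · rintro ⟨k, s, hk, rfl⟩
    obtain ⟨a, ha, b, hb, hab, he⟩ := exists_pair_erase k s
    have hA := edgeSet_apart k a ha b hb hab
    have hae := edgeSet_subset k ha
    have hbe := edgeSet_subset k hb
    have hx : (v a.1 ⨯₃ v a.2) ⨯₃ (v b.1 ⨯₃ v b.2) ≠ 0 := by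
      intro h0
      refine hab (hv.chord_injOn hae hbe ?_)
      rw [hv.chord_eq (edges_ne hae), hv.chord_eq (edges_ne hbe)]
      exact (Projectivization.mk_eq_mk_iff_crossProduct_eq_zero _ _).2 h0
    set p : Plane := Projectivization.mk ℂ _ hx with hp
    have hpa : a ∈ thru v p := (mem_thru_mk hx).2 ⟨hae, by
      rw [bracket, dotProduct_comm, dot_self_cross]⟩
    have hpb : b ∈ thru v p := (mem_thru_mk hx).2 ⟨hbe, by
      rw [bracket, dotProduct_comm, dot_cross_self]⟩
    have hp' := hv.not_mem_arr hA hpa hpb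
    have hsub : (edgeSet k).erase (edge k s) ⊆ thru v p := by
      rw [he]; intro e; simp only [Finset.mem_insert, Finset.mem_singleton]
      rintro (rfl | rfl) <;> assumption
    have h2 : (thru v p).card = 2 := by
      have h1 := Finset.card_le_card hsub
      rw [card_erase_edgeSet] at h1
      have h3 := hv.card_thru_le hp'
      by_contra hne
      obtain ⟨l, hl⟩ := hv.thru_eq_edgeSet hp' (by omega)
      have := eq_of_erase_subset k s l (hl ▸ hsub)
      subst this
      exact hk ⟨p, hl.ge⟩
    exact ⟨p, h2, (Finset.eq_of_subset_of_card_le hsub (by rw [h2, card_erase_edgeSet])).symm⟩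

theorem GenPos.encard_three {v : Fin 6 → Fin 3 → ℂ} (hv : GenPos v) :
    (pointOp 3 (dualArrangement (arr v hv.ne_zero))).encard = (concSet v).card := by
  rw [← Set.InjOn.encard_image (hv.thru_injOn.mono _), hv.thru_image_three,
    Set.encard_coe_eq_coe_finsetCard, Finset.card_image_of_injective _ edgeSet_injective]
  intro p hp
  rw [hv.mem_pointOp_dual] at hp
  simp [hp]

theorem GenPos.encard_two {v : Fin 6 → Fin 3 → ℂ} (hv : GenPos v) :
    (pointOp 2 (dualArrangement (arr v hv.ne_zero))).encard =
      ((15 - (concSet v).card) * 3 : ℕ) := by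
  rw [← Set.InjOn.encard_image (hv.thru_injOn.mono _), hv.thru_image_two,
    Set.encard_coe_eq_coe_finsetCard, Finset.card_image_of_injective _ erase_edgeSet_injective,
    Finset.card_product, Finset.card_compl]
  · simp
  · intro p hp
    rw [hv.mem_pointOp_dual] at hp
    simp [hp]

theorem GenPos.pointOp_five {v : Fin 6 → Fin 3 → ℂ} (hv : GenPos v) :
    pointOp 5 (dualArrangement (arr v hv.ne_zero)) = arr v hv.ne_zero := by
  ext p
  rw [hv.mem_pointOp_dual]
  constructor
  · intro h
    by_contra hp
    have := hv.card_thru_le hp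
    omega
  · rintro ⟨i, rfl⟩
    rw [hv.thru_point, card_edges_at]

theorem GenPos.pointOp_other {v : Fin 6 → Fin 3 → ℂ} (hv : GenPos v) (k : ℕ) (h1 : 2 ≤ k)
    (h2 : k ≠ 2) (h3 : k ≠ 3) (h5 : k ≠ 5) :
    pointOp k (dualArrangement (arr v hv.ne_zero)) = ∅ := by
  ext p
  rw [hv.mem_pointOp_dual]
  simp only [Set.mem_empty_iff_false, iff_false]
  intro h
  by_cases hp : p ∈ arr v hv.ne_zero
  · obtain ⟨i, rfl⟩ := hp
    rw [hv.thru_point, card_edges_at] at h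
    omega
  · have := hv.card_thru_le hp
    omega

theorem GenPos.encard_le_two {v : Fin 6 → Fin 3 → ℂ} (hv : GenPos v) (p : Plane) :
    {l | l ∈ arr v hv.ne_zero ∧ p.orthogonal l}.encard ≤ 2 := by
  by_contra! h
  obtain ⟨t, ht, h3⟩ := Set.exists_subset_encard_eq (k := 3) (Order.add_one_le_of_lt h)
  obtain ⟨a, b, c, hab, hac, hbc, rfl⟩ := Set.encard_eq_three.1 h3
  obtain ⟨⟨i, rfl⟩, hi⟩ := ht (show a ∈ _ by simp)
  obtain ⟨⟨j, rfl⟩, hj⟩ := ht (show b ∈ _ by simp)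
  obtain ⟨⟨k, rfl⟩, hk⟩ := ht (show c ∈ _ by simp)
  induction p using Projectivization.ind with | h x hx => ?_
  simp only [Projectivization.orthogonal_mk] at hi hj hk
  refine hv i j k (fun e => hab (by subst e; rfl)) (fun e => hbc (by subst e; rfl))
    (fun e => hac (by subst e; rfl)) ((exists_dotProduct_eq_zero_iff _ _ _).1 ⟨x, hx, hi, hj, hk⟩)

/-- The double points of six lines in general position are the lines of the dual arrangement. -/
theorem GenPos.pointOp_two {v : Fin 6 → Fin 3 → ℂ} (hv : GenPos v) :
    pointOp 2 (arr v hv.ne_zero) = dualArrangement (arr v hv.ne_zero) := by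
  ext p
  have : {l | l ∈ arr v hv.ne_zero ∧ p.orthogonal l} =
      {l | l ∈ dualPoints (arr v hv.ne_zero) ∧ l.orthogonal p} := by
    ext l; rw [Set.mem_ofPred_eq, Projectivization.orthogonal_comm]; rfl
  have h2 := hv.encard_le_two p
  rw [pointOp, dualArrangement, lineOpGE, Set.mem_ofPred_eq, Set.mem_ofPred_eq, ← this]
  exact ⟨fun h => h.ge, fun h => le_antisymm h2 h⟩

/-- Passing to the dual plane, `Λ_{{2},{3}}` of six lines in general position consists of the triple
points of the chords. -/
theorem GenPos.lambdaOp_eq {v : Fin 6 → Fin 3 → ℂ} (hv : GenPos v) :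
    lambdaOp 2 3 (arr v hv.ne_zero) = pointOp 3 (dualArrangement (arr v hv.ne_zero)) := by
  ext l
  rw [lambdaOp, hv.pointOp_two, lineOp, pointOp, Set.mem_ofPred_eq, Set.mem_ofPred_eq]
  simp only [Projectivization.orthogonal_comm (v := l)]

/-- The criterion for being unassuming in terms of a labelling of the lines. -/
theorem GenPos.isUnassuming {v : Fin 6 → Fin 3 → ℂ} (hv : GenPos v)
    (hc : (concSet v).card = 6) (hconic : ¬ OnConic (arr v hv.ne_zero)) :
    IsUnassuming (arr v hv.ne_zero) where
  card := by
    rw [arr, ← Set.image_univ, hv.mk_injective.encard_image]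
    simp
  double := by
    rw [hv.pointOp_two, hv.dualArrangement_eq, hv.chord_injOn.encard_image,
      Set.encard_coe_eq_coe_finsetCard]
    rfl
  only_double k hk hk2 := by
    ext p
    have := hv.encard_le_two p
    simp only [pointOp, Set.mem_ofPred_eq, Set.mem_empty_iff_false, iff_false]
    intro h
    rw [h] at this
    have : k ≤ 2 := by exact_mod_cast this
    omega
  dual_two := by rw [hv.encard_two, hc]; rfl
  dual_three := by rw [hv.encard_three, hc]; rfl
  dual_five := by
    rw [hv.pointOp_five, arr, ← Set.image_univ, hv.mk_injective.encard_image]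
    simp
  dual_only k := hv.pointOp_other k
  not_onConic := by rwa [hv.pointOp_five]

theorem IsUnassuming.genPos {v : Fin 6 → Fin 3 → ℂ} {h : ∀ i, v i ≠ 0}
    (hu : IsUnassuming (arr v h)) : GenPos v := by
  have hinj : Function.Injective fun i => Projectivization.mk ℂ (v i) (h i) := by
    have := hu.card
    rw [arr, ← Set.image_univ] at this
    rw [← Set.injOn_univ]
    refine Set.Finite.injOn_of_encard_image_eq Set.finite_univ ?_
    rw [this]; simp
  intro i j k hij hjk hik h0
  obtain ⟨p, hp, h1, h2, h3⟩ := (exists_dotProduct_eq_zero_iff _ _ _).2 h0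
  set s := {l | l ∈ arr v h ∧ (Projectivization.mk ℂ p hp).orthogonal l} with hs
  have hfin : s.Finite := (Set.finite_range _).subset fun l hl => hl.1
  have h3 : 3 ≤ s.encard := by
    have hsub : {Projectivization.mk ℂ (v i) (h i), Projectivization.mk ℂ (v j) (h j),
        Projectivization.mk ℂ (v k) (h k)} ⊆ s := by
      rintro l (rfl | rfl | rfl)
      · exact ⟨⟨i, rfl⟩, h1⟩
      · exact ⟨⟨j, rfl⟩, h2⟩
      · exact ⟨⟨k, rfl⟩, h3⟩
    refine le_trans (le_of_eq ?_) (Set.encard_le_encard hsub)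
    exact (Set.encard_eq_three.2 ⟨_, _, _, hinj.ne hij, hinj.ne hik, hinj.ne hjk, rfl⟩).symm
  rw [hfin.encard_eq_coe_toFinset_card] at h3
  have h3' : 3 ≤ hfin.toFinset.card := by exact_mod_cast h3
  have := hu.only_double hfin.toFinset.card (by omega) (by omega)
  have hm : Projectivization.mk ℂ p hp ∈ pointOp hfin.toFinset.card (arr v h) := by
    rw [pointOp, Set.mem_ofPred_eq, ← hs, hfin.encard_eq_coe_toFinset_card]
  rw [this] at hm
  exact hm

theorem IsUnassuming.card_concSet {v : Fin 6 → Fin 3 → ℂ} {h : ∀ i, v i ≠ 0}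
    (hu : IsUnassuming (arr v h)) : (concSet v).card = 6 := by
  have := hu.dual_three
  rw [hu.genPos.encard_three] at this
  exact_mod_cast this

theorem IsUnassuming.exists_arr {A : Set Line} (hu : IsUnassuming A) :
    ∃ v, ∃ h : ∀ i, v i ≠ 0, A = arr v h := by
  have hfin : A.Finite := Set.finite_of_encard_eq_coe (k := 6) hu.card
  have := hfin.fintype
  have hc : Fintype.card A = 6 := by
    have := hu.card
    rw [Set.encard_eq_coe_toFinset_card, Set.toFinset_card] at this
    exact_mod_cast this
  let e := (Fintype.equivFinOfCardEq hc).symm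
  refine ⟨fun i => (e i).1.rep, fun i => Projectivization.rep_nonzero _, ?_⟩
  ext l
  simp only [arr, Projectivization.mk_rep]
  constructor
  · intro hl
    exact ⟨e.symm ⟨l, hl⟩, by simp⟩
  · rintro ⟨i, rfl⟩
    exact (e i).2

/-! ### The two types of six concurrent synthemes -/

/-- The synthemes of two totals among the first four: those that share exactly one pair with
`01|23|45`. -/
def fourSet : Finset (Fin 15) := {0, 1, 2, 5, 6, 9}

/-- The synthemes of two totals among the first three or among the last three: those that pair the
even labels with the odd ones. -/
def threeSet : Finset (Fin 15) := {0, 1, 5, 12, 13, 14}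

theorem mem_concSet_iff {v : Fin 6 → Fin 3 → ℂ} {k : Fin 15} :
    k ∈ concSet v ↔ joubert v (totalLeft k) = joubert v (totalRight k) := by
  rw [mem_concSet, conc_iff_joubert]

/-- A relabelling that moves `01|23|45` to the `k`-th syntheme. -/
def relabelFour (k : Fin 15) : Fin 6 → Fin 6 :=
  ![(edge k 0).1, (edge k 0).2, (edge k 1).1, (edge k 1).2, (edge k 2).1, (edge k 2).2]

/-- For `5 ≤ k`, the `k`-th syntheme, of the totals `i` and `j`, and that of the totals `0` and `i`
form a hexagon; this is the relabelling by a walk around the hexagon. -/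
def relabelThree (k : Fin 15) : Fin 6 → Fin 6 :=
  let f := swapMap (⟨totalLeft k - 1, by omega⟩)
  let g := swapMap k
  ![0, f 0, g (f 0), f (g (f 0)), g (f (g (f 0))), f (g (f (g (f 0))))]

/-- The synthemes `k` and `l` belong to four different totals. -/
def TotalsApart (k l : Fin 15) : Prop :=
  totalLeft k ≠ totalLeft l ∧ totalLeft k ≠ totalRight l ∧ totalRight k ≠ totalLeft l ∧
    totalRight k ≠ totalRight l

instance : DecidableRel TotalsApart := fun _ _ => inferInstanceAs (Decidable (_ ∧ _))

/-- The two totals of `l` lie on the same side of the partition of the totals whose first part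
consists of the total `0` and the two totals of `k`. -/
def SameSide (k l : Fin 15) : Prop :=
  (totalLeft l = 0 ∨ totalLeft l = totalLeft k ∨ totalLeft l = totalRight k) ↔
    (totalRight l = 0 ∨ totalRight l = totalLeft k ∨ totalRight l = totalRight k)

instance : DecidableRel SameSide := fun _ _ => inferInstanceAs (Decidable (_ ↔ _))

theorem relabelFour_injective : ∀ k, Function.Injective (relabelFour k) := by
  have : ∀ k i j, relabelFour k i = relabelFour k j → i = j := by decide +kernel
  exact fun k i j => this k i j

theorem relabelThree_injective : ∀ k, 5 ≤ k → Function.Injective (relabelThree k) := by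
  have : ∀ k, 5 ≤ k → ∀ i j, relabelThree k i = relabelThree k j → i = j := by decide +kernel
  exact fun k hk i j => this k hk i j

theorem relabelFour_swapMap : ∀ k, ∀ m ∈ fourSet, ∃ l, TotalsApart k l ∧
    ∀ i, relabelFour k (swapMap m i) = swapMap l (relabelFour k i) := by decide +kernel

theorem relabelThree_swapMap : ∀ k, 5 ≤ k → ∀ m ∈ threeSet, ∃ l, SameSide k l ∧
    ∀ i, relabelThree k (swapMap m i) = swapMap l (relabelThree k i) := by decide +kernel

/-- A partition of six objects with exactly six pairs in a common part has type `4+1+1` or `3+3`.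
The partition is given by the function that sends each object to the least one of its part. -/
theorem partition_type : ∀ b₁ : Fin 6, b₁ ≤ 1 → ∀ b₂ : Fin 6, b₂ ≤ 2 → ∀ b₃ : Fin 6, b₃ ≤ 3 →
    ∀ b₄ : Fin 6, b₄ ≤ 4 → ∀ b₅ : Fin 6,
    ({k | (![0, b₁, b₂, b₃, b₄, b₅] : Fin 6 → Fin 6) (totalLeft k) =
      (![0, b₁, b₂, b₃, b₄, b₅] : Fin 6 → Fin 6) (totalRight k)} : Finset (Fin 15)).card = 6 →
    (∃ k, ∀ l, TotalsApart k l → (![0, b₁, b₂, b₃, b₄, b₅] : Fin 6 → Fin 6) (totalLeft l) =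
      (![0, b₁, b₂, b₃, b₄, b₅] : Fin 6 → Fin 6) (totalRight l)) ∨
    (∃ k, 5 ≤ k ∧ ∀ l, SameSide k l → (![0, b₁, b₂, b₃, b₄, b₅] : Fin 6 → Fin 6) (totalLeft l) =
      (![0, b₁, b₂, b₃, b₄, b₅] : Fin 6 → Fin 6) (totalRight l)) := by
  decide +kernel

theorem concSet_type {v : Fin 6 → Fin 3 → ℂ} (h : (concSet v).card = 6) :
    (∃ k, ∀ l, TotalsApart k l → l ∈ concSet v) ∨
      (∃ k, 5 ≤ k ∧ ∀ l, SameSide k l → l ∈ concSet v) := by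
  classical
  have hne : ∀ i : Fin 6, ({j | joubert v j = joubert v i} : Finset (Fin 6)).Nonempty :=
    fun i => ⟨i, by simp⟩
  set b : Fin 6 → Fin 6 := fun i => Finset.min' _ (hne i) with hb
  have hle : ∀ i, b i ≤ i := fun i => Finset.min'_le _ _ (by simp)
  have hmem : ∀ i, joubert v (b i) = joubert v i := fun i => by
    have := Finset.min'_mem _ (hne i)
    simpa using this
  have hiff : ∀ i j, joubert v i = joubert v j ↔ b i = b j := by
    intro i j
    constructor
    · intro e; simp only [hb, e]
    · intro e; rw [← hmem i, e, hmem j]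
  have h0 : b 0 = 0 := le_antisymm (hle 0) (Fin.zero_le _)
  have hbv : ![0, b 1, b 2, b 3, b 4, b 5] = b := by
    ext i; fin_cases i <;> simp [h0]
  have key := partition_type (b 1) (hle 1) (b 2) (hle 2) (b 3) (hle 3) (b 4) (hle 4) (b 5)
  rw [hbv] at key
  simp only [mem_concSet_iff, hiff]
  refine key (Eq.trans ?_ h)
  congr 1
  ext k
  simp [mem_concSet_iff, hiff]

theorem arr_comp {v : Fin 6 → Fin 3 → ℂ} (h : ∀ i, v i ≠ 0) {π : Fin 6 → Fin 6}
    (hπ : Function.Injective π) : arr (v ∘ π) (fun i => h (π i)) = arr v h :=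
  (Finite.surjective_of_injective hπ).range_comp
    (fun i => Projectivization.mk ℂ (v i) (h i))

theorem Conc.comp {v : Fin 6 → Fin 3 → ℂ} {π f g : Fin 6 → Fin 6} (h : Conc v g)
    (e : ∀ i, π (f i) = g (π i)) : Conc (v ∘ π) f := by
  obtain ⟨p, hp, h⟩ := h
  exact ⟨p, hp, fun i => by simp only [Function.comp_apply, e]; exact h _⟩

/-- The lines of an unassuming arrangement can be labelled such that the concurrent synthemes are
those of `fourSet` or those of `threeSet`. -/
theorem IsUnassuming.exists_concSet_eq {A : Set Line} (hu : IsUnassuming A) :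
    ∃ v, ∃ h : ∀ i, v i ≠ 0, A = arr v h ∧ (concSet v = fourSet ∨ concSet v = threeSet) := by
  obtain ⟨v, h, rfl⟩ := hu.exists_arr
  have hcard : ∀ π : Fin 6 → Fin 6, Function.Injective π → (concSet (v ∘ π)).card = 6 := by
    intro π hπ
    exact IsUnassuming.card_concSet (h := fun i => h (π i)) (by rwa [arr_comp h hπ])
  rcases concSet_type hu.card_concSet with ⟨k, hk⟩ | ⟨k, h5, hk⟩
  · have hπ := relabelFour_injective k
    refine ⟨v ∘ relabelFour k, fun i => h _, (arr_comp h hπ).symm, Or.inl ?_⟩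
    refine (Finset.eq_of_subset_of_card_le (fun m hm => ?_) ?_).symm
    · obtain ⟨l, hl, e⟩ := relabelFour_swapMap k m hm
      exact mem_concSet.2 ((mem_concSet.1 (hk l hl)).comp e)
    · rw [hcard _ hπ]; rfl
  · have hπ := relabelThree_injective k h5
    refine ⟨v ∘ relabelThree k, fun i => h _, (arr_comp h hπ).symm, Or.inr ?_⟩
    refine (Finset.eq_of_subset_of_card_le (fun m hm => ?_) ?_).symm
    · obtain ⟨l, hl, e⟩ := relabelThree_swapMap k h5 m hm
      exact mem_concSet.2 ((mem_concSet.1 (hk l hl)).comp e)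
    · rw [hcard _ hπ]; rfl

/-! ### Projective equivalence of labelled configurations -/

/-- Two labelled configurations agree up to a linear change of coordinates and scaling of the
vectors. -/
def Scaled (v w : Fin 6 → Fin 3 → ℂ) : Prop :=
  ∃ g : (Fin 3 → ℂ) ≃ₗ[ℂ] (Fin 3 → ℂ), ∃ c : Fin 6 → ℂ, (∀ i, c i ≠ 0) ∧ ∀ i, g (v i) = c i • w i

theorem Scaled.symm {v w : Fin 6 → Fin 3 → ℂ} (h : Scaled v w) : Scaled w v := by
  obtain ⟨g, c, hc, h⟩ := h
  refine ⟨g.symm, fun i => (c i)⁻¹, fun i => inv_ne_zero (hc i), fun i => ?_⟩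
  rw [LinearEquiv.symm_apply_eq, map_smul, h, smul_smul, inv_mul_cancel₀ (hc i), one_smul]

theorem Scaled.trans {u v w : Fin 6 → Fin 3 → ℂ} (h : Scaled u v) (h' : Scaled v w) :
    Scaled u w := by
  obtain ⟨g, c, hc, h⟩ := h
  obtain ⟨g', c', hc', h'⟩ := h'
  refine ⟨g.trans g', fun i => c i * c' i, fun i => mul_ne_zero (hc i) (hc' i), fun i => ?_⟩
  rw [LinearEquiv.trans_apply, h, map_smul, h', smul_smul]

theorem Scaled.comp {v w : Fin 6 → Fin 3 → ℂ} (h : Scaled v w) (π : Fin 6 → Fin 6) :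
    Scaled (v ∘ π) (w ∘ π) := by
  obtain ⟨g, c, hc, h⟩ := h
  exact ⟨g, c ∘ π, fun i => hc _, fun i => h _⟩

/-- Brackets scale by the determinant and the factors of the vectors. -/
theorem Scaled.exists_bracket {v w : Fin 6 → Fin 3 → ℂ} (h : Scaled v w) :
    ∃ (d : ℂ) (c : Fin 6 → ℂ), d ≠ 0 ∧ (∀ i, c i ≠ 0) ∧ ∀ i j k,
      d * bracket (v i) (v j) (v k) = c i * c j * c k * bracket (w i) (w j) (w k) := by
  obtain ⟨g, c, hc, h⟩ := h
  refine ⟨LinearMap.det (g : (Fin 3 → ℂ) →ₗ[ℂ] (Fin 3 → ℂ)), c, (LinearEquiv.isUnit_det' g).ne_zero,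
    hc, fun i j k => ?_⟩
  rw [← bracket_map, ← bracket_smul]
  simp only [LinearEquiv.coe_coe, h]

theorem Scaled.genPos {v w : Fin 6 → Fin 3 → ℂ} (h : Scaled v w) (hv : GenPos v) : GenPos w := by
  obtain ⟨d, c, hd, hc, h⟩ := h.exists_bracket
  intro i j k hij hjk hik h0
  have := h i j k
  rw [h0, mul_zero] at this
  exact mul_ne_zero hd (hv i j k hij hjk hik) this

theorem Scaled.conc {v w : Fin 6 → Fin 3 → ℂ} (h : Scaled v w) {f : Fin 6 → Fin 6}
    (hf : Conc v f) : Conc w f := by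
  obtain ⟨g, c, hc, h⟩ := h
  obtain ⟨p, hp, hf⟩ := hf
  refine ⟨g p, by simpa using hp, fun i => ?_⟩
  have h1 := bracket_map (g : (Fin 3 → ℂ) →ₗ[ℂ] (Fin 3 → ℂ)) p (v i) (v (f i))
  have h2 := bracket_smul 1 (c i) (c (f i)) (g p) (w i) (w (f i))
  rw [hf i, mul_zero] at h1
  simp only [LinearEquiv.coe_coe, h] at h1
  rw [one_smul, h1, one_mul] at h2
  exact (mul_eq_zero.1 h2.symm).resolve_left (mul_ne_zero (hc _) (hc _))

theorem Scaled.concSet_eq {v w : Fin 6 → Fin 3 → ℂ} (h : Scaled v w) : concSet v = concSet w := by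
  ext k
  rw [mem_concSet, mem_concSet]
  exact ⟨h.conc, h.symm.conc⟩

theorem Scaled.projEquiv {v w : Fin 6 → Fin 3 → ℂ} (h : Scaled v w) (hv : ∀ i, v i ≠ 0)
    (hw : ∀ i, w i ≠ 0) : ProjEquiv (arr v hv) (arr w hw) := by
  obtain ⟨g, c, hc, h⟩ := h
  refine ⟨g, ?_⟩
  rw [arr, arr, ← Set.range_comp]
  congr 1
  ext1 i
  simp only [Function.comp_apply, Projectivization.map_mk]
  refine (Projectivization.mk_eq_mk_iff' _ _ _ _ _).2 ⟨c i, ?_⟩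
  exact (h i).symm

/-- Projectively equivalent arrangements have equivalent labelled normals, after a relabelling. -/
theorem exists_scaled_of_projEquiv {v w : Fin 6 → Fin 3 → ℂ} (hv : GenPos v) (hw : ∀ i, w i ≠ 0)
    (h : ProjEquiv (arr v hv.ne_zero) (arr w hw)) :
    ∃ π : Fin 6 → Fin 6, Function.Injective π ∧ Scaled v (w ∘ π) := by
  obtain ⟨g, hg⟩ := h
  have h1 : ∀ i, ∃ j, ∃ c : ℂ, c ≠ 0 ∧ g (v i) = c • w j := by
    intro i
    have : Projectivization.map g.toLinearMap g.injective
        (Projectivization.mk ℂ (v i) (hv.ne_zero i)) ∈ arr w hw := hg ▸ ⟨_, ⟨i, rfl⟩, rfl⟩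
    obtain ⟨j, hj⟩ := this
    simp only [Projectivization.map_mk] at hj
    obtain ⟨c, hc⟩ := (Projectivization.mk_eq_mk_iff' _ _ _ _ _).1 hj.symm
    refine ⟨j, c, ?_, hc.symm⟩
    rintro rfl
    rw [zero_smul] at hc
    exact hv.ne_zero i (g.map_eq_zero_iff.1 hc.symm)
  choose π c hc h2 using h1
  refine ⟨π, ?_, g, c, hc, h2⟩
  intro i j hij
  refine hv.mk_injective ?_
  refine (Projectivization.mk_eq_mk_iff' _ _ _ _ _).2 ⟨c i * (c j)⁻¹, g.injective ?_⟩
  rw [map_smul, h2, h2, hij, smul_smul, mul_assoc, inv_mul_cancel₀ (hc j), mul_one]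

theorem forall_lt_of_ne {P : Fin 6 → Fin 6 → Fin 6 → Prop}
    (h1 : ∀ i j k, P i j k → P i k j) (h2 : ∀ i j k, P i j k → P j k i)
    (h : ∀ i j k, i < j → j < k → P i j k) (i j k : Fin 6) (hij : i ≠ j) (hjk : j ≠ k)
    (hik : i ≠ k) : P i j k := by
  rcases lt_or_gt_of_ne hij with a | a <;> rcases lt_or_gt_of_ne hjk with b | b <;>
    rcases lt_or_gt_of_ne hik with c | c
  · exact h _ _ _ a b
  · exact h _ _ _ a b
  · exact h1 _ _ _ (h _ _ _ c b)
  · exact h2 _ _ _ (h _ _ _ c a)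
  · exact h2 _ _ _ (h2 _ _ _ (h1 _ _ _ (h _ _ _ a c)))
  · exact h2 _ _ _ (h2 _ _ _ (h _ _ _ b c))
  · exact absurd (b.trans a) (not_lt.2 c.le)
  · exact h2 _ _ _ (h1 _ _ _ (h _ _ _ b a))

theorem genPos_of_lt {v : Fin 6 → Fin 3 → ℂ}
    (h : ∀ i j k, i < j → j < k → bracket (v i) (v j) (v k) ≠ 0) : GenPos v := by
  refine forall_lt_of_ne ?_ ?_ h
  · intro i j k h; rw [bracket_swap]; exact neg_ne_zero.2 h
  · intro i j k h; rwa [bracket_rotate]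

/-! ### Conics through six labelled points -/

theorem quadraticForm_rep_eq_zero_iff (q : QuadraticForm ℂ (Fin 3 → ℂ)) {x : Fin 3 → ℂ}
    (hx : x ≠ 0) : q (Projectivization.mk ℂ x hx).rep = 0 ↔ q x = 0 := by
  obtain ⟨a, ha⟩ := Projectivization.exists_smul_eq_mk_rep ℂ x hx
  rw [← ha, Units.smul_def, QuadraticMap.map_smul]
  simp

theorem onConic_arr_iff {v : Fin 6 → Fin 3 → ℂ} (h : ∀ i, v i ≠ 0) :
    OnConic (arr v h) ↔ ∃ q : QuadraticForm ℂ (Fin 3 → ℂ), q ≠ 0 ∧ ∀ i, q (v i) = 0 := by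
  refine exists_congr fun q => and_congr_right fun _ => ?_
  rw [arr, Set.forall_mem_range]
  exact forall_congr' fun i => quadraticForm_rep_eq_zero_iff q (h i)

theorem exists_coeff_quadraticForm (q : QuadraticForm ℂ (Fin 3 → ℂ)) :
    ∃ a b c d e f : ℂ, ∀ x, q x = a * x 0 ^ 2 + b * x 1 ^ 2 + c * x 2 ^ 2 + d * (x 0 * x 1) +
      e * (x 1 * x 2) + f * (x 0 * x 2) := by
  set e0 : Fin 3 → ℂ := ![1, 0, 0]
  set e1 : Fin 3 → ℂ := ![0, 1, 0]
  set e2 : Fin 3 → ℂ := ![0, 0, 1]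
  refine ⟨q e0, q e1, q e2, QuadraticMap.polar q e0 e1, QuadraticMap.polar q e1 e2,
    QuadraticMap.polar q e0 e2, fun x => ?_⟩
  have hx : x = x 0 • e0 + x 1 • e1 + x 2 • e2 := by
    ext i; fin_cases i <;> simp [e0, e1, e2]
  conv_lhs => rw [hx]
  rw [QuadraticMap.map_add q, QuadraticMap.map_add q, QuadraticMap.polar_add_left]
  simp only [QuadraticMap.map_smul, QuadraticMap.polar_smul_left, QuadraticMap.polar_smul_right,
    smul_eq_mul]
  ring

/-! ### Invariance of the incidence operators under projective equivalence -/

/-- The action on points that goes with the action of `g` on normals: the inverse transpose, written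
as the transformation of the dual plane that preserves incidence. -/
theorem exists_contragredient (g : (Fin 3 → ℂ) ≃ₗ[ℂ] (Fin 3 → ℂ)) :
    ∃ h : (Fin 3 → ℂ) ≃ₗ[ℂ] (Fin 3 → ℂ), ∀ x y, h x ⬝ᵥ g y = x ⬝ᵥ y := by
  have key : ∀ (f : (Fin 3 → ℂ) →ₗ[ℂ] (Fin 3 → ℂ)) x y,
      Matrix.toLin' (LinearMap.toMatrix' f)ᵀ x ⬝ᵥ y = x ⬝ᵥ f y := by
    intro f x y
    rw [Matrix.toLin'_apply, Matrix.mulVec_transpose, ← Matrix.dotProduct_mulVec,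
      LinearMap.toMatrix'_mulVec]
  set h := Matrix.toLin' (LinearMap.toMatrix' (g.symm : (Fin 3 → ℂ) →ₗ[ℂ] (Fin 3 → ℂ)))ᵀ
  have hh : ∀ x y, h x ⬝ᵥ g y = x ⬝ᵥ y := fun x y => by
    rw [key]; simp
  have hinj : Function.Injective h := by
    rw [← LinearMap.ker_eq_bot, LinearMap.ker_eq_bot']
    intro x hx
    refine dotProduct_eq_zero _ fun y => ?_
    rw [← hh, hx, zero_dotProduct]
  exact ⟨LinearEquiv.ofInjectiveEndo h hinj, hh⟩

/-- `G` and `H` are compatible transformations of lines and points. -/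
def PreservesIncidence (G H : Plane → Plane) : Prop :=
  Function.Bijective G ∧ Function.Bijective H ∧
    ∀ p l, (H p).orthogonal (G l) ↔ p.orthogonal l

theorem PreservesIncidence.swap {G H : Plane → Plane} (h : PreservesIncidence G H) :
    PreservesIncidence H G :=
  ⟨h.2.1, h.1, fun p l => by
    rw [Projectivization.orthogonal_comm, h.2.2, Projectivization.orthogonal_comm]⟩

theorem PreservesIncidence.encard_eq {G H : Plane → Plane} (h : PreservesIncidence G H)
    (A : Set Line) (p : Plane) :
    {l | l ∈ G '' A ∧ (H p).orthogonal l}.encard = {l | l ∈ A ∧ p.orthogonal l}.encard := by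
  have : {l | l ∈ G '' A ∧ (H p).orthogonal l} = G '' {l | l ∈ A ∧ p.orthogonal l} := by
    ext l
    constructor
    · rintro ⟨⟨l, hl, rfl⟩, h1⟩
      exact ⟨l, ⟨hl, (h.2.2 _ _).1 h1⟩, rfl⟩
    · rintro ⟨l, ⟨hl, h1⟩, rfl⟩
      exact ⟨⟨l, hl, rfl⟩, (h.2.2 _ _).2 h1⟩
  rw [this, h.1.1.encard_image]

theorem setOf_eq_image {G : Plane → Plane} (hG : Function.Bijective G) {P Q : Plane → Prop}
    (h : ∀ p, P (G p) ↔ Q p) : {p | P p} = G '' {p | Q p} := by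
  ext p
  obtain ⟨p, rfl⟩ := hG.2 p
  rw [hG.1.mem_set_image]
  exact h p

theorem PreservesIncidence.pointOp_image {G H : Plane → Plane} (h : PreservesIncidence G H)
    (k : ℕ) (A : Set Line) : pointOp k (G '' A) = H '' pointOp k A :=
  setOf_eq_image h.2.1 fun p => by rw [h.encard_eq]

theorem PreservesIncidence.lineOp_image {G H : Plane → Plane} (h : PreservesIncidence G H)
    (n : ℕ) (P : Set Plane) : lineOp n (H '' P) = G '' lineOp n P :=
  setOf_eq_image h.1 fun l => by
    have := h.swap.encard_eq P l
    simp only [Projectivization.orthogonal_comm (w := G l),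
      Projectivization.orthogonal_comm (w := l)]
    rw [this]

theorem PreservesIncidence.dualArrangement_image {G H : Plane → Plane}
    (h : PreservesIncidence G H) (A : Set Line) :
    dualArrangement (G '' A) = H '' dualArrangement A :=
  setOf_eq_image h.2.1 fun l => by
    have := h.encard_eq A l
    change ((2 : ℕ) : ℕ∞) ≤ {p | p ∈ G '' A ∧ p.orthogonal (H l)}.encard ↔
      ((2 : ℕ) : ℕ∞) ≤ {p | p ∈ A ∧ p.orthogonal l}.encard
    simp only [Projectivization.orthogonal_comm (w := H l),
      Projectivization.orthogonal_comm (w := l)]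
    rw [← this]

theorem preservesIncidence_map (g : (Fin 3 → ℂ) ≃ₗ[ℂ] (Fin 3 → ℂ)) :
    ∃ H, PreservesIncidence (Projectivization.map g.toLinearMap g.injective) H := by
  have hbij : ∀ g : (Fin 3 → ℂ) ≃ₗ[ℂ] (Fin 3 → ℂ),
      Function.Bijective (Projectivization.map g.toLinearMap g.injective) := fun g =>
    ⟨Projectivization.map_injective _ _, fun l =>
      ⟨Projectivization.map g.symm.toLinearMap g.symm.injective l, map_map_symm g.symm l⟩⟩
  obtain ⟨h, hh⟩ := exists_contragredient g
  refine ⟨Projectivization.map h.toLinearMap h.injective, hbij g, hbij h, fun p l => ?_⟩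
  induction p using Projectivization.ind with | h x hx => ?_
  induction l using Projectivization.ind with | h y hy => ?_
  simp only [Projectivization.map_mk, Projectivization.orthogonal_mk]
  exact Eq.congr (hh x y) rfl

theorem OnConic.of_image_map {g : (Fin 3 → ℂ) ≃ₗ[ℂ] (Fin 3 → ℂ)} {P : Set Plane}
    (h : OnConic (Projectivization.map g.toLinearMap g.injective '' P)) : OnConic P := by
  obtain ⟨q, hq, h⟩ := h
  refine ⟨q.comp g.toLinearMap, ?_, fun p hp => ?_⟩
  · intro h0
    refine hq (QuadraticMap.ext fun x => ?_)
    have := congrArg (fun q : QuadraticForm ℂ (Fin 3 → ℂ) => q (g.symm x)) h0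
    simpa using this
  · have h1 := h _ ⟨p, hp, rfl⟩
    induction p using Projectivization.ind with | h x hx => ?_
    rw [quadraticForm_rep_eq_zero_iff]
    rw [Projectivization.map_mk, quadraticForm_rep_eq_zero_iff] at h1
    exact h1

theorem lambdaOp_image (g : (Fin 3 → ℂ) ≃ₗ[ℂ] (Fin 3 → ℂ)) (m n : ℕ) (A : Set Line) :
    lambdaOp m n (Projectivization.map g.toLinearMap g.injective '' A) =
      Projectivization.map g.toLinearMap g.injective '' lambdaOp m n A := by
  obtain ⟨H, hH⟩ := preservesIncidence_map g
  rw [lambdaOp, hH.pointOp_image, hH.lineOp_image]; rfl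

theorem IsUnassuming.image {A : Set Line} (h : IsUnassuming A)
    (g : (Fin 3 → ℂ) ≃ₗ[ℂ] (Fin 3 → ℂ)) :
    IsUnassuming (Projectivization.map g.toLinearMap g.injective '' A) := by
  obtain ⟨H, hH⟩ := preservesIncidence_map g
  have hd : ∀ k, pointOp k (dualArrangement
      (Projectivization.map g.toLinearMap g.injective '' A)) =
      Projectivization.map g.toLinearMap g.injective '' pointOp k (dualArrangement A) := fun k => by
    rw [hH.dualArrangement_image, hH.swap.pointOp_image]
  refine ⟨?_, ?_, ?_, ?_, ?_, ?_, ?_, ?_⟩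
  · rw [hH.1.1.encard_image, h.card]
  · rw [hH.pointOp_image, hH.2.1.1.encard_image, h.double]
  · intro k h1 h2
    rw [hH.pointOp_image, h.only_double k h1 h2, Set.image_empty]
  · rw [hd, hH.1.1.encard_image, h.dual_two]
  · rw [hd, hH.1.1.encard_image, h.dual_three]
  · rw [hd, hH.1.1.encard_image, h.dual_five]
  · intro k h1 h2 h3 h5
    rw [hd, h.dual_only k h1 h2 h3 h5, Set.image_empty]
  · rw [hd]
    exact fun hc => h.not_onConic hc.of_image_map

theorem IsUnassuming.of_projEquiv {A B : Set Line} (h : IsUnassuming A) (hAB : ProjEquiv A B) :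
    IsUnassuming B := by
  obtain ⟨g, rfl⟩ := hAB
  exact h.image g

theorem ProjEquiv.lambdaOp {A B : Set Line} (h : ProjEquiv A B) (m n : ℕ) :
    ProjEquiv (lambdaOp m n A) (lambdaOp m n B) := by
  obtain ⟨g, rfl⟩ := h
  exact ⟨g, (lambdaOp_image g m n A).symm⟩

/-! ### The one-parameter family and its normal form -/

/-- The one-parameter family of configurations: two points on each side of the coordinate triangle,
the sides being the chords of the syntheme `01|23|45`. -/
def stdFour (r : ℂ) : Fin 6 → Fin 3 → ℂ :=
  ![![1, 1, 0], ![-1, 1, 0], ![0, 1, 1], ![0, -1, 1], ![r, 0, 1], ![r, 0, -1]]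

/-- The parameters for which the configuration is unassuming: no three points are collinear (`r ≠ 0`
and `r² ≠ 1`), the six points are not on a conic (`r² ≠ -1`), and no seventh syntheme is
concurrent (the last condition). -/
def IsGood (r : ℂ) : Prop := r ≠ 0 ∧ r ^ 4 ≠ 1 ∧ (r ^ 2 - 1) ^ 2 ≠ 16 * r ^ 2

theorem genPos_stdFour {r : ℂ} (h0 : r ≠ 0) (h1 : r ^ 2 ≠ 1) : GenPos (stdFour r) := by
  have hm : r - 1 ≠ 0 := fun h => h1 (by rw [sub_eq_zero.1 h]; norm_num)
  have hp : r + 1 ≠ 0 := fun h => h1 (by rw [eq_neg_of_add_eq_zero_left h]; norm_num)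
  have hm' : -r + 1 ≠ 0 := fun h => hm (by linear_combination -h)
  have hp' : -r - 1 ≠ 0 := fun h => hp (by linear_combination -h)
  have h2 : r + r ≠ 0 := fun h => h0 (by linear_combination h / 2)
  have hp'' : 1 + r ≠ 0 := fun h => hp (by linear_combination h)
  have hm'' : -1 + r ≠ 0 := fun h => hm (by linear_combination h)
  refine genPos_of_lt fun i j k hij hjk => ?_
  fin_cases i <;> fin_cases j <;> first | (exact absurd hij (by decide)) | skip
  all_goals fin_cases k <;> first | (exact absurd hjk (by decide)) | skip
  all_goals
    simp [bracket_apply, stdFour]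
    try first
      | assumption
      | norm_num

theorem joubert_stdFour (r : ℂ) : joubert (stdFour r) =
    ![0, 0, 0, 0, -(r ^ 2 + 4 * r - 1), -(r ^ 2 - 4 * r - 1)] := by
  simp only [joubert, chordDet, edge, stdFour, cross_apply, bracket_apply,
    Matrix.cons_val, Matrix.cons_val_zero, Matrix.cons_val_one]
  ext i
  fin_cases i <;> simp <;> ring

theorem concSet_stdFour {r : ℂ} (h : IsGood r) : concSet (stdFour r) = fourSet := by
  obtain ⟨h0, -, h2⟩ := h
  have ha : -(r ^ 2 + 4 * r - 1) ≠ 0 := fun h => h2 (by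
    linear_combination -(r ^ 2 - 4 * r - 1) * h)
  have hb : -(r ^ 2 - 4 * r - 1) ≠ 0 := fun h => h2 (by
    linear_combination -(r ^ 2 + 4 * r - 1) * h)
  have hab : -(r ^ 2 + 4 * r - 1) ≠ -(r ^ 2 - 4 * r - 1) := fun h => h0 (by
    linear_combination -h / 8)
  ext k
  rw [mem_concSet_iff, joubert_stdFour]
  generalize -(r ^ 2 + 4 * r - 1) = a at *
  generalize -(r ^ 2 - 4 * r - 1) = b at *
  fin_cases k <;> simp [totalLeft, totalRight, fourSet, hab, ha.symm, hb.symm]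

theorem isUnassuming_stdFour {r : ℂ} (h : IsGood r) (h0 : ∀ i, stdFour r i ≠ 0) :
    IsUnassuming (arr (stdFour r) h0) := by
  have h2 : r ^ 2 ≠ 1 := fun e => h.2.1 (by linear_combination (r ^ 2 + 1) * e)
  refine (genPos_stdFour h.1 h2).isUnassuming (by rw [concSet_stdFour h]; rfl) ?_
  rw [onConic_arr_iff]
  rintro ⟨q, hq, hv⟩
  obtain ⟨a, b, c, d, e, f, hf⟩ := exists_coeff_quadraticForm q
  have e0 := hv 0
  have e1 := hv 1
  have e2 := hv 2
  have e3 := hv 3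
  have e4 := hv 4
  have e5 := hv 5
  simp only [hf, stdFour, Matrix.cons_val, Matrix.cons_val_zero, Matrix.cons_val_one]
    at e0 e1 e2 e3 e4 e5
  have hd : d = 0 := by linear_combination (e0 - e1) / 2
  have he : e = 0 := by linear_combination (e2 - e3) / 2
  have hf0 : f = 0 := by
    have : f * r = 0 := by linear_combination (e4 - e5) / 2
    exact (mul_eq_zero.1 this).resolve_right h.1
  have hab : b = -a := by linear_combination (e0 + e1) / 2
  have hbc : c = a := by linear_combination (e2 + e3) / 2 - hab
  have ha : a = 0 := by
    have : a * (r ^ 2 + 1) = 0 := by linear_combination (e4 + e5) / 2 - hbc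
    refine (mul_eq_zero.1 this).resolve_right fun h' => h.2.1 ?_
    linear_combination (r ^ 2 - 1) * h'
  refine hq (QuadraticMap.ext fun x => ?_)
  rw [hf, hbc, hab, ha, hd, he, hf0]
  simp

theorem isGood_of_isUnassuming {r : ℂ} {h0 : ∀ i, stdFour r i ≠ 0}
    (hu : IsUnassuming (arr (stdFour r) h0)) (hc : concSet (stdFour r) = fourSet) : IsGood r := by
  have hg := hu.genPos
  refine ⟨?_, ?_, ?_⟩
  · rintro rfl
    refine hg 0 4 5 (by decide) (by decide) (by decide) ?_
    simp [bracket_apply, stdFour]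
  · intro h4
    have : (r - 1) * (r + 1) * (r ^ 2 + 1) = 0 := by linear_combination h4
    rcases mul_eq_zero.1 this with h | h
    · rcases mul_eq_zero.1 h with h | h
      · refine hg 0 2 5 (by decide) (by decide) (by decide) ?_
        simp [bracket_apply, stdFour]; linear_combination h
      · refine hg 0 2 4 (by decide) (by decide) (by decide) ?_
        simp [bracket_apply, stdFour]; linear_combination h
    · refine hu.not_onConic ?_
      rw [hg.pointOp_five, onConic_arr_iff]
      -- for `r ^ 2 = -1` the conic is `x ^ 2 - y ^ 2 + z ^ 2 = 0`
      refine ⟨QuadraticMap.weightedSumSquares ℂ ![(1 : ℂ), -1, 1], fun hq => ?_, fun i => ?_⟩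
      · have := congrArg (fun q : QuadraticForm ℂ (Fin 3 → ℂ) => q ![1, 0, 0]) hq
        simp [QuadraticMap.weightedSumSquares_apply, Fin.sum_univ_three] at this
      · fin_cases i <;>
          simp [QuadraticMap.weightedSumSquares_apply, Fin.sum_univ_three, stdFour] <;>
          linear_combination h
  · intro h
    have h1 : (-(r ^ 2 + 4 * r - 1)) * (-(r ^ 2 - 4 * r - 1)) = 0 := by linear_combination h
    rcases mul_eq_zero.1 h1 with h | h
    · have : (3 : Fin 15) ∈ concSet (stdFour r) := by
        rw [mem_concSet_iff, joubert_stdFour, h]; simp [totalLeft, totalRight]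
      rw [hc] at this
      exact absurd this (by decide)
    · have : (4 : Fin 15) ∈ concSet (stdFour r) := by
        rw [mem_concSet_iff, joubert_stdFour, h]; simp [totalLeft, totalRight]
      rw [hc] at this
      exact absurd this (by decide)

/-- Coordinates in which three given linear forms become the coordinate functions. -/
theorem scaled_coordinates {a b c : Fin 3 → ℂ} (h : bracket a b c ≠ 0)
    (v : Fin 6 → Fin 3 → ℂ) : Scaled v fun i => ![a ⬝ᵥ v i, b ⬝ᵥ v i, c ⬝ᵥ v i] := by
  have hinj : Function.Injective (Matrix.toLin' (Matrix.of ![a, b, c])) := by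
    rw [← LinearMap.ker_eq_bot, LinearMap.ker_eq_bot']
    intro x hx
    by_contra hx0
    refine h ((exists_dotProduct_eq_zero_iff a b c).1 ⟨x, hx0, ?_⟩)
    rw [dotProduct_comm x a, dotProduct_comm x b, dotProduct_comm x c]
    exact ⟨congrFun hx 0, congrFun hx 1, congrFun hx 2⟩
  refine ⟨LinearEquiv.ofInjectiveEndo _ hinj, fun _ => 1, fun _ => one_ne_zero, fun i => ?_⟩
  ext j
  fin_cases j <;> simp [Matrix.mulVec]

/-- Rescaling the coordinates. -/
theorem scaled_diagonal {d : Fin 3 → ℂ} (hd : ∀ i, d i ≠ 0) (v : Fin 6 → Fin 3 → ℂ) :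
    Scaled v fun i j => d j * v i j :=
  ⟨LinearEquiv.piCongrRight fun i => LinearEquiv.smulOfNeZero ℂ ℂ (d i) (hd i), fun _ => 1,
    fun _ => one_ne_zero, fun i => by ext j; simp⟩

theorem scaled_smul {v w : Fin 6 → Fin 3 → ℂ} {c : Fin 6 → ℂ} (hc : ∀ i, c i ≠ 0)
    (h : ∀ i, v i = c i • w i) : Scaled v w :=
  ⟨LinearEquiv.refl ℂ _, c, hc, h⟩

/-- Six points, two on each side of the coordinate triangle, for which the synthemes of `fourSet`
are concurrent, are a member of the family. -/
theorem exists_scaled_stdFour_of_triangle {x₀ y₀ x₁ y₁ y₂ z₂ y₃ z₃ x₄ z₄ x₅ z₅ : ℂ}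
    {u : Fin 6 → Fin 3 → ℂ} (hu : u = ![![x₀, y₀, 0], ![x₁, y₁, 0], ![0, y₂, z₂], ![0, y₃, z₃],
      ![x₄, 0, z₄], ![x₅, 0, z₅]]) (hg : GenPos u) (hc : fourSet ⊆ concSet u) :
    ∃ r, Scaled u (stdFour r) := by
  have hb : ∀ i j k, i ≠ j → j ≠ k → i ≠ k → bracket (u i) (u j) (u k) ≠ 0 := hg
  have h023 := hb 0 2 3 (by decide) (by decide) (by decide)
  have h123 := hb 1 2 3 (by decide) (by decide) (by decide)
  have h045 := hb 0 4 5 (by decide) (by decide) (by decide)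
  have h145 := hb 1 4 5 (by decide) (by decide) (by decide)
  have h245 := hb 2 4 5 (by decide) (by decide) (by decide)
  have h345 := hb 3 4 5 (by decide) (by decide) (by decide)
  have h201 := hb 2 0 1 (by decide) (by decide) (by decide)
  have h301 := hb 3 0 1 (by decide) (by decide) (by decide)
  have h401 := hb 4 0 1 (by decide) (by decide) (by decide)
  have h501 := hb 5 0 1 (by decide) (by decide) (by decide)
  have h423 := hb 4 2 3 (by decide) (by decide) (by decide)
  have h523 := hb 5 2 3 (by decide) (by decide) (by decide)
  have c2 := (conc_iff_chordDet u 2).1 (mem_concSet.1 (hc (by decide)))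
  have c5 := (conc_iff_chordDet u 5).1 (mem_concSet.1 (hc (by decide)))
  have c6 := (conc_iff_chordDet u 6).1 (mem_concSet.1 (hc (by decide)))
  subst hu
  simp [bracket_apply] at h023 h123 h045 h145 h245 h345 h201 h301 h401 h501 h423 h523
  simp [chordDet, edge, cross_apply, bracket_apply] at c2 c5 c6
  have hx₀ := h023.1
  have hx₄ := h423.1
  have hx₅ := h523.1
  have hy₀ := h045.1
  have hy₁ := h145.1
  have hy₂ := h245.1
  have hy₃ := h345.1
  have hz₂ := h201.1
  have hz₃ := h301.1
  have hz₄ := h401.1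
  have hz₅ := h501.1
  have r2 := c2.resolve_left h201.2
  have r5 := c5.resolve_left h201.2
  have e3 : z₃ = -(z₂ * y₃) / y₂ := by
    have h : (x₄ * z₅ * (x₅ * z₄)) * ((y₂ * z₃ - z₂ * y₃) * (y₂ * z₃ + z₂ * y₃)) = 0 := by
      linear_combination y₂ * z₅ * z₃ * x₄ * r2 + z₂ * x₄ * y₃ * z₅ * r5
    have h' : y₂ * z₃ + z₂ * y₃ = 0 := by
      simpa [hx₄, hx₅, hz₄, hz₅, h023.2] using h
    field_simp
    linear_combination h'
  have e5 : x₅ = -(x₄ * z₅) / z₄ := by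
    have h : (y₃ * z₂) * (z₄ * x₅ + x₄ * z₅) = 0 := by
      have : y₂ * z₃ = -(z₂ * y₃) := by rw [e3]; field_simp
      linear_combination -r2 + z₄ * x₅ * this
    have h' : z₄ * x₅ + x₄ * z₅ = 0 := by simpa [hy₃, hz₂] using h
    field_simp
    linear_combination h'
  have e1 : x₁ = -(x₀ * y₁) / y₀ := by
    have h : (y₃ * z₂ * (z₄ * x₅ - x₄ * z₅)) * (y₀ * x₁ + x₀ * y₁) = 0 := by
      have : y₂ * z₃ = -(z₂ * y₃) := by rw [e3]; field_simp
      linear_combination -c6 + x₀ * y₁ * (z₄ * x₅ - x₄ * z₅) * this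
    have h' : y₀ * x₁ + x₀ * y₁ = 0 := by
      simpa [hy₃, hz₂, h045.2] using h
    field_simp
    linear_combination h'
  subst e3 e5 e1
  -- the points on a side are now symmetric; scaling the coordinates normalises the first two sides
  refine ⟨y₀ * x₄ * z₂ / (x₀ * y₂ * z₄), (scaled_diagonal (d := ![y₀ / x₀, 1, y₂ / z₂]) ?_ _).trans
    (scaled_smul (c := ![y₀, y₁, y₂, -y₃, y₂ * z₄ / z₂, -(y₂ * z₅ / z₂)]) ?_ ?_)⟩
  · intro i; fin_cases i <;> simp [*]
  · intro i; fin_cases i <;> simp [*]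
  · intro i
    ext j
    fin_cases i <;> fin_cases j <;> simp [stdFour] <;> field_simp

/-- Normal form of the first type: `01|23|45` is not concurrent, so its three chords form a
triangle, which is taken as the coordinate triangle. -/
theorem exists_scaled_stdFour {v : Fin 6 → Fin 3 → ℂ} (hv : GenPos v)
    (hc : concSet v = fourSet) : ∃ r, Scaled v (stdFour r) := by
  have h14 : chordDet v 14 ≠ 0 := fun h => by
    have := mem_concSet.2 ((conc_iff_chordDet v 14).2 h)
    rw [hc] at this
    exact absurd this (by decide)
  have h : bracket (v 2 ⨯₃ v 3) (v 4 ⨯₃ v 5) (v 0 ⨯₃ v 1) ≠ 0 := by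
    rw [bracket_rotate]; exact h14
  have hs := scaled_coordinates h v
  obtain ⟨r, hr⟩ := exists_scaled_stdFour_of_triangle (u := fun i => ![(v 2 ⨯₃ v 3) ⬝ᵥ v i,
    (v 4 ⨯₃ v 5) ⬝ᵥ v i, (v 0 ⨯₃ v 1) ⬝ᵥ v i]) (by
      have z1 : ∀ a b : Fin 3 → ℂ, (a ⨯₃ b) ⬝ᵥ a = 0 := fun a b => by
        rw [dotProduct_comm, dot_self_cross]
      have z2 : ∀ a b : Fin 3 → ℂ, (a ⨯₃ b) ⬝ᵥ b = 0 := fun a b => by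
        rw [dotProduct_comm, dot_cross_self]
      funext i
      fin_cases i <;> simp only [z1, z2, Fin.mk_zero, Fin.mk_one, Fin.reduceFinMk] <;> rfl)
    (hs.genPos hv) (by rw [← hs.concSet_eq, hc])
  exact ⟨r, hs.trans hr⟩

/-! ### The isolated configuration -/

/-- Two triangles in sixfold perspective, `ω` being a primitive third root of unity. -/
def stdThree (ω : ℂ) : Fin 6 → Fin 3 → ℂ :=
  ![![1, 0, 0], ![1, 1, 1], ![0, 1, 0], ![1, ω ^ 2, ω], ![0, 0, 1], ![1, ω, ω ^ 2]]

theorem ne_of_root {ω : ℂ} (hω : ω ^ 2 + ω + 1 = 0) :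
    ω ≠ 0 ∧ ω ≠ 1 ∧ ω ^ 3 = 1 ∧ 2 * ω + 1 ≠ 0 := by
  refine ⟨?_, ?_, by linear_combination (ω - 1) * hω, fun h => ?_⟩
  · rintro rfl; norm_num at hω
  · rintro rfl; norm_num at hω
  · have : (3 : ℂ) = 0 := by linear_combination 4 * hω - (2 * ω + 1) * h
    norm_num at this

theorem genPos_stdThree {ω : ℂ} (hω : ω ^ 2 + ω + 1 = 0) : GenPos (stdThree ω) := by
  obtain ⟨h0, h1, h3, hs⟩ := ne_of_root hω
  have h2 : ω + 2 ≠ 0 := fun h => by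
    have : (3 : ℂ) = 0 := by linear_combination hω - (ω - 1) * h
    norm_num at this
  refine genPos_of_lt fun i j k hij hjk => ?_
  fin_cases i <;> fin_cases j <;> first | (exact absurd hij (by decide)) | skip
  all_goals fin_cases k <;> first | (exact absurd hjk (by decide)) | skip
  all_goals
    simp [bracket_apply, stdThree, h0]
  all_goals
    intro h
    first
    | exact h1 (by linear_combination h)
    | exact h1 (by linear_combination -h)
    | exact h2 (by linear_combination hω - h)
    | exact hs (by linear_combination h + hω)
    | exact hs (by linear_combination hω - h)
    | exact hs (by linear_combination h - (ω ^ 2 - ω - 1) * hω)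
    | exact hs (by linear_combination (h - (ω ^ 2 - ω - 1) * hω + 2 * hω) / 3)

theorem joubert_stdThree {ω : ℂ} (hω : ω ^ 2 + ω + 1 = 0) : joubert (stdThree ω) =
    ![0, 0, 0, -(2 * (2 * ω + 1)), -(2 * (2 * ω + 1)), -(2 * (2 * ω + 1))] := by
  have h2 : ω ^ 2 = -ω - 1 := by linear_combination hω
  simp only [joubert, chordDet, edge, stdThree, cross_apply, bracket_apply, h2,
    Matrix.cons_val, Matrix.cons_val_zero, Matrix.cons_val_one]
  ext i
  fin_cases i <;> simp <;> ring_nf <;> simp only [h2] <;> ring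

theorem concSet_stdThree {ω : ℂ} (hω : ω ^ 2 + ω + 1 = 0) : concSet (stdThree ω) = threeSet := by
  have hs : -(2 * (2 * ω + 1)) ≠ 0 := neg_ne_zero.2 (mul_ne_zero two_ne_zero (ne_of_root hω).2.2.2)
  ext k
  rw [mem_concSet_iff, joubert_stdThree hω]
  generalize -(2 * (2 * ω + 1)) = a at *
  fin_cases k <;> simp [totalLeft, totalRight, threeSet, hs.symm]

theorem isUnassuming_stdThree {ω : ℂ} (hω : ω ^ 2 + ω + 1 = 0) (h0 : ∀ i, stdThree ω i ≠ 0) :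
    IsUnassuming (arr (stdThree ω) h0) := by
  refine (genPos_stdThree hω).isUnassuming (by rw [concSet_stdThree hω]; rfl) ?_
  rw [onConic_arr_iff]
  rintro ⟨q, hq, hv⟩
  obtain ⟨a, b, c, d, e, f, hf⟩ := exists_coeff_quadraticForm q
  have e0 := hv 0
  have e1 := hv 1
  have e2 := hv 2
  have e3 := hv 3
  have e4 := hv 4
  have e5 := hv 5
  have h2 : ω ^ 2 = -ω - 1 := by linear_combination hω
  simp only [hf, stdThree, Matrix.cons_val, Matrix.cons_val_zero, Matrix.cons_val_one]
    at e0 e1 e2 e3 e4 e5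
  have ha : a = 0 := by linear_combination e0
  have hb : b = 0 := by linear_combination e2
  have hc : c = 0 := by linear_combination e4
  subst ha hb hc
  have t1 : d + e + f = 0 := by linear_combination e1
  have t2 : d * ω ^ 2 + e * ω ^ 3 + f * ω = 0 := by linear_combination e3
  have t3 : d * ω + e * ω ^ 3 + f * ω ^ 2 = 0 := by linear_combination e5
  rw [(ne_of_root hω).2.2.1] at t2 t3
  have hd : d = f := by
    have : (2 * ω + 1) * (d - f) = 0 := by linear_combination t3 - t2 + (d - f) * hω
    exact sub_eq_zero.1 ((mul_eq_zero.1 this).resolve_left (ne_of_root hω).2.2.2)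
  have he : e = f := by
    rw [hd] at t2
    linear_combination t2 - f * hω
  have hf0 : f = 0 := by
    rw [hd, he] at t1
    linear_combination t1 / 3
  refine hq (QuadraticMap.ext fun x => ?_)
  rw [hf, hd, he, hf0]
  simp

/-- The coordinate triangle `024` and three more points, for which the synthemes of `threeSet` are
concurrent.  With the point `1` scaled to `(1 : 1 : 1)`, the concurrencies make the other two points
`(1 : ω ^ 2 : ω)` and `(1 : ω : ω ^ 2)`. -/
theorem exists_scaled_stdThree_of_triangle {x₀ x₁ y₁ z₁ y₂ x₃ y₃ z₃ z₄ x₅ y₅ z₅ : ℂ}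
    {u : Fin 6 → Fin 3 → ℂ} (hu : u = ![![x₀, 0, 0], ![x₁, y₁, z₁], ![0, y₂, 0], ![x₃, y₃, z₃],
      ![0, 0, z₄], ![x₅, y₅, z₅]]) (hg : GenPos u) (hc : threeSet ⊆ concSet u) :
    ∃ ω : ℂ, ω ^ 2 + ω + 1 = 0 ∧ Scaled u (stdThree ω) := by
  have h1 := hg 1 2 4 (by decide) (by decide) (by decide)
  have h2 := hg 1 4 0 (by decide) (by decide) (by decide)
  have h3 := hg 1 0 2 (by decide) (by decide) (by decide)
  have h4 := hg 3 2 4 (by decide) (by decide) (by decide)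
  have h5 := hg 3 4 0 (by decide) (by decide) (by decide)
  have h6 := hg 3 0 2 (by decide) (by decide) (by decide)
  have h7 := hg 5 2 4 (by decide) (by decide) (by decide)
  have h8 := hg 5 4 0 (by decide) (by decide) (by decide)
  have h9 := hg 5 0 2 (by decide) (by decide) (by decide)
  have h10 := hg 0 1 3 (by decide) (by decide) (by decide)
  have c (k : Fin 15) (hk : k ∈ threeSet) := (conc_iff_chordDet u k).1 (mem_concSet.1 (hc hk))
  have c0 := c 0 (by decide)
  have c1 := c 1 (by decide)
  have c5 := c 5 (by decide)
  have c12 := c 12 (by decide)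
  have c13 := c 13 (by decide)
  have c14 := c 14 (by decide)
  clear c
  subst hu
  simp [bracket_apply] at h1 h2 h3 h4 h5 h6 h7 h8 h9 h10
  simp [chordDet, edge, cross_apply, bracket_apply] at c0 c1 c5 c12 c13 c14
  have hK : x₀ * y₂ * z₄ ≠ 0 := mul_ne_zero (mul_ne_zero h10.1 h1.2.1) h1.2.2
  have a0 : y₅ * x₁ * z₃ = z₅ * y₁ * x₃ := mul_left_cancel₀ hK (by linear_combination c0)
  have a1 : z₃ * x₁ * y₅ = y₃ * z₁ * x₅ := mul_left_cancel₀ hK (by linear_combination c1)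
  have a12 : z₅ * x₁ * y₃ = y₅ * z₁ * x₃ := mul_left_cancel₀ hK (by linear_combination -c12)
  have a13 : z₃ * y₁ * x₅ = y₃ * x₁ * z₅ := mul_left_cancel₀ hK (by linear_combination -c13)
  have hx₀ := h10.1
  have hx₁ := h1.1
  have hy₁ := h2.1
  have hz₁ := h3.1
  have hy₂ := h1.2.1
  have hx₃ := h4.1
  have hz₃ := h6.1
  have hz₄ := h1.2.2
  have hx₅ := h7.1
  have h10 := h10.2
  clear h1 h2 h3 h4 h5 h6 h7 h8 h9 c0 c1 c5 c12 c13 c14 hg hc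
  obtain ⟨s, rfl⟩ : ∃ s, y₃ = s * (x₃ * y₁ / x₁) := ⟨y₃ * x₁ / (x₃ * y₁), by field_simp⟩
  obtain ⟨t, rfl⟩ : ∃ t, z₃ = t * (x₃ * z₁ / x₁) := ⟨z₃ * x₁ / (x₃ * z₁), by field_simp⟩
  obtain ⟨s', rfl⟩ : ∃ s', y₅ = s' * (x₅ * y₁ / x₁) := ⟨y₅ * x₁ / (x₅ * y₁), by field_simp⟩
  obtain ⟨t', rfl⟩ : ∃ t', z₅ = t' * (x₅ * z₁ / x₁) := ⟨z₅ * x₁ / (x₅ * z₁), by field_simp⟩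
  field_simp at a0 a1 a12 a13 hz₃ h10
  have b1 : s' = t := by linear_combination -a12 - a13
  subst b1
  have b2 : s = s' ^ 2 := by linear_combination -a1
  have b3 : t' = s' ^ 2 := by linear_combination -a0
  subst b2 b3
  have hs0 : s' ≠ 0 := by rintro rfl; simp at hz₃
  have hs1 : s' - 1 ≠ 0 := fun h => h10 (by linear_combination -y₁ * x₃ * z₁ * s' * h)
  have hω : s' ^ 2 + s' + 1 = 0 := by
    have : s' * (s' - 1) * (s' ^ 2 + s' + 1) = 0 := by linear_combination a12
    exact (mul_eq_zero.1 this).resolve_left (mul_ne_zero hs0 hs1)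
  refine ⟨s', hω, (scaled_diagonal (d := ![1 / x₁, 1 / y₁, 1 / z₁]) ?_ _).trans
    (scaled_smul (c := ![x₀ / x₁, 1, y₂ / y₁, x₃ / x₁, z₄ / z₁, x₅ / x₁]) ?_ ?_)⟩
  · intro i; fin_cases i <;> simp [*]
  · intro i; fin_cases i <;> simp [*]
  · intro i
    ext j
    fin_cases i <;> fin_cases j <;> simp [stdThree] <;> field_simp

/-- Normal form of the second type, with the triangle `024` as the coordinate triangle. -/
theorem exists_scaled_stdThree {v : Fin 6 → Fin 3 → ℂ} (hv : GenPos v)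
    (hc : concSet v = threeSet) : ∃ ω : ℂ, ω ^ 2 + ω + 1 = 0 ∧ Scaled v (stdThree ω) := by
  have h : bracket (v 2 ⨯₃ v 4) (v 4 ⨯₃ v 0) (v 0 ⨯₃ v 2) ≠ 0 := by
    have h1 := hv 0 2 4 (by decide) (by decide) (by decide)
    have : bracket (v 2 ⨯₃ v 4) (v 4 ⨯₃ v 0) (v 0 ⨯₃ v 2) = bracket (v 0) (v 2) (v 4) ^ 2 := by
      rw [bracket_cross_cross_cross, bracket_self_left, bracket_rotate (v 2) (v 4) (v 0),
        bracket_rotate (v 0) (v 2) (v 4)]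
      ring
    rw [this]
    exact pow_ne_zero 2 h1
  have hs := scaled_coordinates h v
  obtain ⟨ω, hω, hr⟩ := exists_scaled_stdThree_of_triangle (u := fun i => ![(v 2 ⨯₃ v 4) ⬝ᵥ v i,
    (v 4 ⨯₃ v 0) ⬝ᵥ v i, (v 0 ⨯₃ v 2) ⬝ᵥ v i]) (by
      have z1 : ∀ a b : Fin 3 → ℂ, (a ⨯₃ b) ⬝ᵥ a = 0 := fun a b => by
        rw [dotProduct_comm, dot_self_cross]
      have z2 : ∀ a b : Fin 3 → ℂ, (a ⨯₃ b) ⬝ᵥ b = 0 := fun a b => by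
        rw [dotProduct_comm, dot_cross_self]
      funext i
      fin_cases i <;> simp only [z1, z2, Fin.mk_zero, Fin.mk_one, Fin.reduceFinMk] <;> rfl)
    (hs.genPos hv) (by rw [← hs.concSet_eq, hc])
  exact ⟨ω, hω, hs.trans hr⟩

/-- Both primitive third roots of unity give the same arrangement. -/
theorem arr_stdThree_eq {ω ω' : ℂ} (hω : ω ^ 2 + ω + 1 = 0) (hω' : ω' ^ 2 + ω' + 1 = 0)
    (h : ∀ i, stdThree ω i ≠ 0) (h' : ∀ i, stdThree ω' i ≠ 0) :
    arr (stdThree ω) h = arr (stdThree ω') h' := by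
  have h0 : (ω' - ω) * (ω' - ω ^ 2) = 0 := by
    linear_combination hω' - ω' * hω + (ω - 1) * hω
  rcases mul_eq_zero.1 h0 with h1 | h1
  · obtain rfl := sub_eq_zero.1 h1
    rfl
  · obtain rfl := sub_eq_zero.1 h1
    have h4 : (ω ^ 2) ^ 2 = ω := by linear_combination (ω ^ 2 - ω) * hω
    have hπ : Function.Injective (![0, 1, 2, 5, 4, 3] : Fin 6 → Fin 6) := by decide
    have : stdThree (ω ^ 2) = stdThree ω ∘ ![0, 1, 2, 5, 4, 3] := by
      ext i j
      fin_cases i <;> fin_cases j <;> simp [stdThree, h4]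
    revert h'
    rw [this]
    exact fun _ => (arr_comp h hπ).symm

/-! ### The invariant of the one-parameter family -/

/-- Numerator of the invariant: the splitting of the six points into two triangles transversal to
`01|23|45`. -/
def invX (v : Fin 6 → Fin 3 → ℂ) : ℂ :=
  (bracket (v 0) (v 2) (v 4) * bracket (v 1) (v 3) (v 5)) ^ 2

/-- Denominator of the invariant: a splitting into two triangles, each of which contains a pair of
`01|23|45`. -/
def invY (v : Fin 6 → Fin 3 → ℂ) : ℂ :=
  (bracket (v 0) (v 1) (v 2) * bracket (v 3) (v 4) (v 5)) ^ 2

theorem GenPos.invY_ne_zero {v : Fin 6 → Fin 3 → ℂ} (hv : GenPos v) : invY v ≠ 0 :=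
  pow_ne_zero 2 (mul_ne_zero (hv _ _ _ (by decide) (by decide) (by decide))
    (hv _ _ _ (by decide) (by decide) (by decide)))

/-- Both parts of the invariant scale by the same factor, which does not depend on the labels. -/
theorem Scaled.exists_inv {v w : Fin 6 → Fin 3 → ℂ} (h : Scaled v w) :
    ∃ K : ℂ, K ≠ 0 ∧ ∀ π : Equiv.Perm (Fin 6), invX (v ∘ π) = K * invX (w ∘ π) ∧
      invY (v ∘ π) = K * invY (w ∘ π) := by
  obtain ⟨d, c, hd, hc, h⟩ := h.exists_bracket
  refine ⟨((∏ i, c i) / d ^ 2) ^ 2, pow_ne_zero 2 (div_ne_zero (Finset.prod_ne_zero_iff.2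
    fun i _ => hc i) (pow_ne_zero 2 hd)), fun π => ?_⟩
  have hp : ∏ i, c i = c (π 0) * c (π 1) * c (π 2) * c (π 3) * c (π 4) * c (π 5) := by
    rw [← Equiv.prod_comp π, Fin.prod_univ_six]
  have hb : ∀ i j k, bracket (v i) (v j) (v k) =
      c i * c j * c k * bracket (w i) (w j) (w k) / d := fun i j k => by
    rw [← h]; field_simp
  rw [hp]
  simp only [invX, invY, Function.comp_apply, hb]
  constructor <;> field_simp

/-- The invariant of `stdFour r` takes the same value for all relabellings that preserve the pairs
of `01|23|45` (`swapMap 14` exchanges the labels of each pair). -/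
theorem bracket_stdFour_relabel (r : ℂ) : ∀ a b c : Fin 6, b ≠ a → b ≠ swapMap 14 a → c ≠ a →
    c ≠ swapMap 14 a → c ≠ b → c ≠ swapMap 14 b →
    (bracket (stdFour r a) (stdFour r b) (stdFour r c) * bracket (stdFour r (swapMap 14 a))
      (stdFour r (swapMap 14 b)) (stdFour r (swapMap 14 c))) ^ 2 = (r ^ 2 - 1) ^ 2 ∧
    (bracket (stdFour r a) (stdFour r (swapMap 14 a)) (stdFour r b) *
      bracket (stdFour r (swapMap 14 b)) (stdFour r c) (stdFour r (swapMap 14 c))) ^ 2 =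
        16 * r ^ 2 := by
  intro a b c h1 h2 h3 h4 h5 h6
  fin_cases a <;> fin_cases b <;>
    first | exact absurd rfl h1 | exact absurd rfl h2 | skip
  all_goals
    fin_cases c <;>
      first | exact absurd rfl h3 | exact absurd rfl h4 | exact absurd rfl h5 |
        exact absurd rfl h6 | skip
  all_goals
    constructor <;> simp [bracket_apply, stdFour, swapMap, edge] <;> ring

theorem invX_stdFour (r : ℂ) : invX (stdFour r) = (r ^ 2 - 1) ^ 2 :=
  (bracket_stdFour_relabel r 0 2 4 (by decide) (by decide) (by decide) (by decide) (by decide)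
    (by decide)).1

theorem invY_stdFour (r : ℂ) : invY (stdFour r) = 16 * r ^ 2 :=
  (bracket_stdFour_relabel r 0 2 4 (by decide) (by decide) (by decide) (by decide) (by decide)
    (by decide)).2

set_option synthInstance.maxHeartbeats 400000 in
set_option synthInstance.maxSize 2000 in
theorem exists_eq_swapMap_aux : ∀ a : Fin 6, a ≠ 0 → ∀ b : Fin 6, b ≠ 1 → (a = 1 ↔ b = 0) →
    ∀ c : Fin 6, c ≠ 2 → (a = 2 ↔ c = 0) → (b = 2 ↔ c = 1) →
    ∀ d : Fin 6, d ≠ 3 → (a = 3 ↔ d = 0) → (b = 3 ↔ d = 1) → (c = 3 ↔ d = 2) →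
    ∀ e : Fin 6, e ≠ 4 → (a = 4 ↔ e = 0) → (b = 4 ↔ e = 1) → (c = 4 ↔ e = 2) → (d = 4 ↔ e = 3) →
    ∀ f : Fin 6, f ≠ 5 → (a = 5 ↔ f = 0) → (b = 5 ↔ f = 1) → (c = 5 ↔ f = 2) → (d = 5 ↔ f = 3) →
      (e = 5 ↔ f = 4) → ∃ k, swapMap k = ![a, b, c, d, e, f] := by
  decide +kernel

/-- Every involution of the labels without fixed points is a syntheme. -/
theorem exists_eq_swapMap {f : Fin 6 → Fin 6} (hf : ∀ i, f (f i) = i) (hne : ∀ i, f i ≠ i) :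
    ∃ k, swapMap k = f := by
  have h : ∀ i j, f i = j ↔ f j = i := fun i j =>
    ⟨fun e => by rw [← e, hf], fun e => by rw [← e, hf]⟩
  obtain ⟨k, hk⟩ := exists_eq_swapMap_aux (f 0) (hne 0) (f 1) (hne 1) (h 0 1) (f 2) (hne 2) (h 0 2)
    (h 1 2) (f 3) (hne 3) (h 0 3) (h 1 3) (h 2 3) (f 4) (hne 4) (h 0 4) (h 1 4) (h 2 4) (h 3 4)
    (f 5) (hne 5) (h 0 5) (h 1 5) (h 2 5) (h 3 5) (h 4 5)
  refine ⟨k, hk.trans ?_⟩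
  ext i; fin_cases i <;> rfl

theorem swapMap_eq_of_fourSet : ∀ k ∈ fourSet, ∀ l ∈ fourSet, k ≠ l → ∀ i,
    swapMap k i = swapMap l i → swapMap k i = swapMap 14 i := by decide

/-- If the concurrent synthemes are those of `fourSet`, then the pairs of `01|23|45` are the only
ones that two concurrent synthemes have in common. -/
theorem perm_swapMap_eq {w : Fin 6 → Fin 3 → ℂ} (hw : concSet w = fourSet)
    (π : Equiv.Perm (Fin 6)) {k l : Fin 15} (hk : k ∈ concSet (w ∘ π)) (hl : l ∈ concSet (w ∘ π))
    (hkl : k ≠ l) {i : Fin 6} (hi : swapMap k i = swapMap l i) :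
    π (swapMap k i) = swapMap 14 (π i) := by
  have key : ∀ m ∈ concSet (w ∘ π), ∃ m' ∈ fourSet,
      swapMap m' = fun j => π (swapMap m (π.symm j)) := by
    intro m hm
    obtain ⟨m', hm'⟩ := exists_eq_swapMap (f := fun j => π (swapMap m (π.symm j)))
      (fun j => by simp [swapMap_swapMap]) (fun j h => swapMap_ne m (π.symm j) (by
        rw [Equiv.eq_symm_apply]; exact h))
    refine ⟨m', ?_, hm'⟩
    rw [← hw, mem_concSet, hm']
    have := (mem_concSet.1 hm).comp (π := π.symm) (f := fun j => π (swapMap m (π.symm j)))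
      (fun j => by simp)
    rwa [Function.comp_assoc, Equiv.self_comp_symm, Function.comp_id] at this
  obtain ⟨k', hk', ek⟩ := key k hk
  obtain ⟨l', hl', el⟩ := key l hl
  have hne : k' ≠ l' := by
    rintro rfl
    refine hkl (swapMap_injective (funext fun j => ?_))
    have := congrFun (ek.symm.trans el) (π j)
    simpa using this
  have h1 : swapMap k' (π i) = π (swapMap k i) := by rw [ek]; simp
  have h2 : swapMap l' (π i) = π (swapMap l i) := by rw [el]; simp
  rw [← h1]
  exact swapMap_eq_of_fourSet k' hk' l' hl' hne _ (by rw [h1, h2, hi])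

/-- The invariant does not depend on the labelling. -/
theorem inv_eq_of_scaled {v w : Fin 6 → Fin 3 → ℂ} (hwg : GenPos w)
    (hv : concSet v = fourSet) (hw : concSet w = fourSet) (π : Equiv.Perm (Fin 6))
    (h : Scaled v (w ∘ π)) : invX v * invY w = invX w * invY v := by
  have hc : concSet (w ∘ π) = fourSet := by rw [← h.concSet_eq, hv]
  have p1 : π 1 = swapMap 14 (π 0) := perm_swapMap_eq hw π (k := 2) (l := 5) (i := 0)
    (by rw [hc]; decide) (by rw [hc]; decide) (by decide) (by decide)
  have p3 : π 3 = swapMap 14 (π 2) := perm_swapMap_eq hw π (k := 0) (l := 9) (i := 2)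
    (by rw [hc]; decide) (by rw [hc]; decide) (by decide) (by decide)
  have p5 : π 5 = swapMap 14 (π 4) := perm_swapMap_eq hw π (k := 1) (l := 6) (i := 4)
    (by rw [hc]; decide) (by rw [hc]; decide) (by decide) (by decide)
  -- `π` preserves the pairs of `01|23|45`, so that it suffices to compare with the normal form
  obtain ⟨r, hr⟩ := exists_scaled_stdFour hwg hw
  obtain ⟨K, hK, hKπ⟩ := hr.exists_inv
  obtain ⟨L, hL, hLπ⟩ := h.exists_inv
  have hS := bracket_stdFour_relabel r (π 0) (π 2) (π 4) (π.injective.ne (by decide))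
    (by rw [← p1]; exact π.injective.ne (by decide)) (π.injective.ne (by decide))
    (by rw [← p1]; exact π.injective.ne (by decide)) (π.injective.ne (by decide))
    (by rw [← p3]; exact π.injective.ne (by decide))
  rw [← p1, ← p3, ← p5] at hS
  have x1 : invX v = L * (K * (r ^ 2 - 1) ^ 2) := by
    rw [← hS.1]; exact (hLπ 1).1.trans (congrArg _ (hKπ π).1)
  have y1 : invY v = L * (K * (16 * r ^ 2)) := by
    rw [← hS.2]; exact (hLπ 1).2.trans (congrArg _ (hKπ π).2)
  have x2 : invX w = K * (r ^ 2 - 1) ^ 2 := by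
    rw [← invX_stdFour]; exact (hKπ 1).1
  have y2 : invY w = K * (16 * r ^ 2) := by
    rw [← invY_stdFour]; exact (hKπ 1).2
  rw [x1, y1, x2, y2]
  ring

/-- The two types are not equivalent: every pair of an even and an odd label lies in two synthemes
of `threeSet`, so that the label `0` would have both `1` and `3` as its partner in `01|23|45`. -/
theorem not_scaled_of_types {v w : Fin 6 → Fin 3 → ℂ} (hv : concSet v = threeSet)
    (hw : concSet w = fourSet) (π : Equiv.Perm (Fin 6)) : ¬ Scaled v (w ∘ π) := by
  intro h
  have hc : concSet (w ∘ π) = threeSet := by rw [← h.concSet_eq, hv]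
  have p1 : π 1 = swapMap 14 (π 0) := perm_swapMap_eq hw π (k := 14) (l := 5) (i := 0)
    (by rw [hc]; decide) (by rw [hc]; decide) (by decide) (by decide)
  have p3 : π 3 = swapMap 14 (π 0) := perm_swapMap_eq hw π (k := 1) (l := 13) (i := 0)
    (by rw [hc]; decide) (by rw [hc]; decide) (by decide) (by decide)
  exact absurd (π.injective (p1.trans p3.symm)) (by decide)

theorem scaled_stdFour_neg (r : ℂ) : Scaled (stdFour r) (stdFour (-r) ∘ ![0, 1, 2, 3, 5, 4]) :=
  scaled_smul (c := ![1, 1, 1, 1, -1, -1]) (by intro i; fin_cases i <;> simp) (by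
    intro i; ext j; fin_cases i <;> fin_cases j <;> simp [stdFour])

theorem scaled_stdFour_inv {r : ℂ} (hr : r ≠ 0) :
    Scaled (stdFour r) (stdFour r⁻¹ ∘ ![2, 3, 0, 1, 4, 5]) :=
  ⟨LinearEquiv.funCongrLeft ℂ ℂ (Equiv.swap 0 2), ![1, -1, 1, -1, r, -r],
    by intro i; fin_cases i <;> simp [hr], by
    intro i; ext j
    fin_cases i <;> fin_cases j <;>
      simp [stdFour, LinearEquiv.funCongrLeft_apply, LinearMap.funLeft_apply, Equiv.swap_apply_def,
        hr]⟩

/-- Parameters with the same invariant give projectively equivalent arrangements. -/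
theorem projEquiv_stdFour {r s : ℂ} (hr : ∀ i, stdFour r i ≠ 0) (hs : ∀ i, stdFour s i ≠ 0)
    (hr0 : r ≠ 0) (h : (r ^ 2 - 1) ^ 2 * (16 * s ^ 2) = (s ^ 2 - 1) ^ 2 * (16 * r ^ 2)) :
    ProjEquiv (arr (stdFour r) hr) (arr (stdFour s) hs) := by
  have key : ∀ {v w : Fin 6 → Fin 3 → ℂ} {π : Fin 6 → Fin 6} (hv : ∀ i, v i ≠ 0)
      (hw : ∀ i, w i ≠ 0), Function.Injective π → Scaled v (w ∘ π) →
      ProjEquiv (arr v hv) (arr w hw) := by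
    intro v w π hv hw hπ h
    rw [← arr_comp hw hπ]
    exact h.projEquiv _ _
  have h1 : (r - s) * (r * s + 1) * ((r + s) * (r * s - 1)) = 0 := by
    linear_combination h / 16
  have neg_inv : ∀ t : ℂ, t * r = 1 → r⁻¹ = t := fun t ht => by
    rw [inv_eq_iff_eq_inv, eq_comm, inv_eq_iff_eq_inv]; field_simp; exact ht
  have i1 : Function.Injective (![0, 1, 2, 3, 5, 4] : Fin 6 → Fin 6) := by decide
  have i2 : Function.Injective (![2, 3, 0, 1, 4, 5] : Fin 6 → Fin 6) := by decide
  rcases mul_eq_zero.1 h1 with h1 | h1 <;> rcases mul_eq_zero.1 h1 with h1 | h1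
  · obtain rfl := sub_eq_zero.1 h1
    exact key hr hs Function.injective_id (scaled_smul (c := 1) (fun _ => one_ne_zero) (by simp))
  · have e := neg_inv (-s) (by linear_combination -h1)
    have h2 := scaled_stdFour_inv hr0
    rw [e] at h2
    have h3 := (scaled_stdFour_neg (-s)).comp ![2, 3, 0, 1, 4, 5]
    rw [neg_neg] at h3
    exact key hr hs (i1.comp i2) (h2.trans h3)
  · obtain rfl := eq_neg_of_add_eq_zero_right h1
    exact key hr hs i1 (scaled_stdFour_neg r)
  · have e := neg_inv s (by linear_combination h1)
    have h2 := scaled_stdFour_inv hr0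
    rw [e] at h2
    exact key hr hs i2 h2

/-! ### The operator `Λ_{{2},{3}}` on the two normal forms -/

/-- `Λ_{{2},{3}}` of an arrangement whose concurrent synthemes are known, together with the points
of concurrency. -/
theorem GenPos.lambdaOp_eq_arr {v w : Fin 6 → Fin 3 → ℂ} (hv : GenPos v) (hw : ∀ i, w i ≠ 0)
    (m : Fin 6 → Fin 15) (hm : concSet v = Finset.univ.image m)
    (h : ∀ j s, bracket (w j) (v (edge (m j) s).1) (v (edge (m j) s).2) = 0) :
    lambdaOp 2 3 (arr v hv.ne_zero) = arr w hw := by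
  have hsub : ∀ j, edgeSet (m j) ⊆ thru v (Projectivization.mk ℂ (w j) (hw j)) := by
    intro j e he
    rw [mem_thru_mk]
    simp only [edgeSet, Finset.mem_insert, Finset.mem_singleton] at he
    rcases he with rfl | rfl | rfl <;> exact ⟨edge_mem_edges _ _, h _ _⟩
  have heq := fun j => (hv.thru_eq_of_edgeSet_subset (hsub j)).2
  rw [hv.lambdaOp_eq]
  ext p
  constructor
  · intro hp
    have h3 : thru v p ∈ thru v '' (pointOp 3 (dualArrangement (arr v hv.ne_zero))) :=
      ⟨p, hp, rfl⟩
    rw [hv.thru_image_three, hm] at h3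
    simp only [Finset.coe_image, Set.mem_image, Finset.mem_coe] at h3
    obtain ⟨k, hk, hkp⟩ := h3
    obtain ⟨j, -, rfl⟩ := Finset.mem_image.1 (Finset.mem_coe.1 (by simpa using hk) :
      k ∈ Finset.univ.image m)
    refine ⟨j, hv.thru_injOn ?_ ?_ ((heq j).trans hkp)⟩
    · rw [Set.mem_ofPred_eq, heq, card_edgeSet]; norm_num
    · rw [Set.mem_ofPred_eq, ← hkp, card_edgeSet]; norm_num
  · rintro ⟨j, rfl⟩
    rw [hv.mem_pointOp_dual, heq, card_edgeSet]

/-- On the one-parameter family, `Λ_{{2},{3}}` acts by `r ↦ r⁻²`. -/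
theorem lambdaOp_stdFour {r : ℂ} (hr : IsGood r) (h0 : ∀ i, stdFour r i ≠ 0)
    (h1 : ∀ i, stdFour (r ^ 2)⁻¹ i ≠ 0) :
    ProjEquiv (arr (stdFour (r ^ 2)⁻¹) h1) (lambdaOp 2 3 (arr (stdFour r) h0)) := by
  have hr0 := hr.1
  have h2 : r ^ 2 ≠ 1 := fun e => hr.2.1 (by linear_combination (r ^ 2 + 1) * e)
  -- the meeting points of the synthemes `5, 2, 0, 9, 1, 6`
  set w : Fin 6 → Fin 3 → ℂ :=
    ![![r, 1, 0], ![-r, 1, 0], ![0, r, 1], ![0, r, -1], ![1, 0, 1], ![-1, 0, 1]] with hw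
  have hs : Scaled w (stdFour (r ^ 2)⁻¹) :=
    (scaled_diagonal (d := ![r⁻¹, 1, r]) (by intro i; fin_cases i <;> simp [hr0]) w).trans
      (scaled_smul (c := ![1, 1, r, -r, r, -r]) (by intro i; fin_cases i <;> simp [hr0]) (by
        intro i; ext j
        fin_cases i <;> fin_cases j <;> simp [hw, stdFour, hr0] <;> field_simp))
  have hw0 : ∀ i, w i ≠ 0 := by
    intro i h
    have h' := fun j => congrFun h j
    fin_cases i
    · simpa [hw] using h' 1
    · simpa [hw] using h' 1
    · simpa [hw] using h' 2
    · simpa [hw] using h' 2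
    · simpa [hw] using h' 0
    · simpa [hw] using h' 0
  rw [(genPos_stdFour hr0 h2).lambdaOp_eq_arr hw0 ![5, 2, 0, 9, 1, 6]]
  · exact hs.symm.projEquiv _ _
  · rw [concSet_stdFour hr]; decide
  · intro j s
    fin_cases j <;> fin_cases s <;> simp [bracket_apply, hw, stdFour, edge]

/-- `Λ_{{2},{3}}` fixes the class of the isolated configuration. -/
theorem lambdaOp_stdThree {ω : ℂ} (hω : ω ^ 2 + ω + 1 = 0) (h0 : ∀ i, stdThree ω i ≠ 0) :
    ProjEquiv (arr (stdThree ω) h0) (lambdaOp 2 3 (arr (stdThree ω) h0)) := by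
  obtain ⟨hω0, hω1, hω3, hωs⟩ := ne_of_root hω
  -- the meeting points of the synthemes `5, 14, 1, 12, 0, 13`
  set w : Fin 6 → Fin 3 → ℂ :=
    ![![ω, 1, 1], ![ω ^ 2, 1, 1], ![1, ω, 1], ![1, ω ^ 2, 1], ![1, 1, ω], ![1, 1, ω ^ 2]] with hw
  have hs : Scaled (stdThree ω) w := by
    have hω2 : ω ^ 2 - 1 ≠ 0 := fun h => hωs (by
      linear_combination ω ^ 2 * h - (ω ^ 2 - ω - 1) * hω)
    refine (scaled_coordinates (a := ![ω ^ 2, 1, 1]) (b := ![ω, ω, 1]) (c := ![ω, 1, ω]) ?_ _).trans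
      (scaled_smul (c := ![ω, 2 * ω + 1, 1, ω ^ 2 - 1, 1, ω ^ 2 - 1]) ?_ ?_)
    · have : bracket ![ω ^ 2, 1, 1] ![ω, ω, 1] ![ω, 1, ω] = 3 * (2 * ω + 1) := by
        simp [bracket_apply]
        linear_combination (ω ^ 2 - ω - 3) * hω
      rw [this]
      exact mul_ne_zero three_ne_zero hωs
    · intro i; fin_cases i <;> simp [*]
    · intro i; ext j
      fin_cases i <;> fin_cases j <;> simp [hw, stdThree, dotProduct, Fin.sum_univ_three] <;> grind
  have hw0 : ∀ i, w i ≠ 0 := by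
    intro i h
    have h' := fun j => congrFun h j
    fin_cases i
    · simpa [hw] using h' 1
    · simpa [hw] using h' 1
    · simpa [hw] using h' 2
    · simpa [hw] using h' 2
    · simpa [hw] using h' 0
    · simpa [hw] using h' 0
  rw [(genPos_stdThree hω).lambdaOp_eq_arr hw0 ![5, 14, 1, 12, 0, 13]]
  · exact hs.projEquiv _ _
  · rw [concSet_stdThree hω]; decide
  · intro j s
    fin_cases j <;> fin_cases s <;> simp [bracket_apply, hw, stdThree, edge] <;> grind

open SpaceWithFunctions

/-! ### Zariski topology and regular functions on subsets of affine space -/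

section Zariski

variable {σ τ : Type} {L : Set (σ → ℂ)} {L' : Set (τ → ℂ)}

theorem isOpen_zariski_basic (p : MvPolynomial σ ℂ) :
    IsOpen {x : ZariskiSet L | MvPolynomial.eval x.1 p ≠ 0} :=
  .basic _ ⟨p, rfl⟩

theorem isOpen_zariski_iff {O : Set (ZariskiSet L)} :
    IsOpen O ↔ ∀ x ∈ O, ∃ p : MvPolynomial σ ℂ, MvPolynomial.eval x.1 p ≠ 0 ∧
      ∀ y : ZariskiSet L, MvPolynomial.eval y.1 p ≠ 0 → y ∈ O := by
  constructor
  · intro h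
    change TopologicalSpace.GenerateOpen _ O at h
    induction h with
    | basic s hs =>
      obtain ⟨p, rfl⟩ := hs
      exact fun x hx => ⟨p, hx, fun y hy => hy⟩
    | univ => exact fun x _ => ⟨1, by simp, fun _ _ => trivial⟩
    | inter s t _ _ hs ht =>
      rintro x ⟨h1, h2⟩
      obtain ⟨p, hp, hp'⟩ := hs x h1
      obtain ⟨q, hq, hq'⟩ := ht x h2
      refine ⟨p * q, by simp [hp, hq], fun y hy => ?_⟩
      rw [map_mul] at hy
      exact ⟨hp' y (left_ne_zero_of_mul hy), hq' y (right_ne_zero_of_mul hy)⟩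
    | sUnion S _ hS =>
      rintro x ⟨s, hs, hx⟩
      obtain ⟨p, hp, hp'⟩ := hS s hs x hx
      exact ⟨p, hp, fun y hy => ⟨s, hs, hp' y hy⟩⟩
  · intro h
    rw [isOpen_iff_forall_mem_open]
    intro x hx
    obtain ⟨p, hp, hp'⟩ := h x hx
    exact ⟨_, hp', isOpen_zariski_basic p, hp⟩

/-- The map of affine spaces given by polynomials. -/
noncomputable def polyMap (P : τ → MvPolynomial σ ℂ) (x : σ → ℂ) : τ → ℂ :=
  fun i => MvPolynomial.eval x (P i)

theorem eval_bind₁ (P : τ → MvPolynomial σ ℂ) (x : σ → ℂ) (p : MvPolynomial τ ℂ) :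
    MvPolynomial.eval x (MvPolynomial.bind₁ P p) = MvPolynomial.eval (polyMap P x) p := by
  induction p using MvPolynomial.induction_on with
  | C a => simp
  | add p q hp hq => simp [hp, hq]
  | mul_X p i hp => rw [map_mul, map_mul, map_mul, hp]; simp [polyMap]

/-- Preimages of open sets under maps that are polynomial on an open set. -/
theorem isOpen_polyMap_preimage (P : τ → MvPolynomial σ ℂ) {O : Set (ZariskiSet L)} (hO : IsOpen O)
    (hP : ∀ y ∈ O, polyMap P y.1 ∈ L') {V : Set (ZariskiSet L')} (hV : IsOpen V) :
    IsOpen {y : ZariskiSet L | ∃ h : y ∈ O, (⟨polyMap P y.1, hP y h⟩ : ZariskiSet L') ∈ V} := by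
  rw [isOpen_iff_forall_mem_open]
  rintro x ⟨hx, hxV⟩
  obtain ⟨p, hp, hp'⟩ := isOpen_zariski_iff.1 hV _ hxV
  refine ⟨O ∩ {y | MvPolynomial.eval y.1 (MvPolynomial.bind₁ P p) ≠ 0}, ?_,
    hO.inter (isOpen_zariski_basic _), hx, ?_⟩
  · rintro y ⟨hy, hy'⟩
    refine ⟨hy, hp' _ ?_⟩
    rwa [Set.mem_ofPred_eq, eval_bind₁] at hy'
  · rwa [Set.mem_ofPred_eq, eval_bind₁]

/-- Regular functions pull back to regular functions under maps that are polynomial on an open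
set. -/
theorem regularOn_polyMap (P : τ → MvPolynomial σ ℂ) {O : Set (ZariskiSet L)} (hO : IsOpen O)
    (hP : ∀ y ∈ O, polyMap P y.1 ∈ L') {V : Set (ZariskiSet L')} {ψ : ZariskiSet L' → ℂ}
    (hψ : RegularOn V ψ) {W : Set (ZariskiSet L)} {χ : ZariskiSet L → ℂ}
    (hW : ∀ y (h : y ∈ O), y ∈ W → (⟨polyMap P y.1, hP y h⟩ : ZariskiSet L') ∈ V)
    (hχ : ∀ y (h : y ∈ O), y ∈ W → χ y = ψ ⟨polyMap P y.1, hP y h⟩) :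
    RegularOn (O ∩ W) χ := by
  rintro x ⟨hx, hxW⟩
  obtain ⟨U, hU, hxU, p, q, hpq⟩ := hψ _ (hW x hx hxW)
  have key : ∀ y ∈ {y : ZariskiSet L | ∃ h : y ∈ O, (⟨polyMap P y.1, hP y h⟩ : ZariskiSet L') ∈ U} ∩
      (O ∩ W), MvPolynomial.eval y.1 (MvPolynomial.bind₁ P q) ≠ 0 ∧
        χ y = MvPolynomial.eval y.1 (MvPolynomial.bind₁ P p) /
          MvPolynomial.eval y.1 (MvPolynomial.bind₁ P q) := by
    rintro y ⟨⟨hy, hyU⟩, -, hyW⟩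
    have := hpq _ ⟨hyU, hW y hy hyW⟩
    rw [eval_bind₁, eval_bind₁, hχ y hy hyW]
    exact this
  exact ⟨_, isOpen_polyMap_preimage P hO hP hU, ⟨hx, hxU⟩, _, _, key⟩

/-- The point of parameter `t` on a rational curve in affine space. -/
noncomputable def curve (γ : σ → Polynomial ℂ) (t : ℂ) : σ → ℂ := fun i => (γ i).eval t

theorem eval_curve (γ : σ → Polynomial ℂ) (t : ℂ) (p : MvPolynomial σ ℂ) :
    (MvPolynomial.aeval γ p).eval t = MvPolynomial.eval (curve γ t) p := by
  induction p using MvPolynomial.induction_on with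
  | C a => simp
  | add p q hp hq => simp [hp, hq]
  | mul_X p i hp => rw [map_mul, Polynomial.eval_mul, map_mul, hp]; simp [curve]

/-- A rational curve that meets an open set lies in it up to finitely many points. -/
theorem finite_curve_of_isOpen (γ : σ → Polynomial ℂ) {O : Set (ZariskiSet L)} (hO : IsOpen O)
    {t₀ : ℂ} (h₀ : curve γ t₀ ∈ L) (h : (⟨curve γ t₀, h₀⟩ : ZariskiSet L) ∈ O) :
    ∃ F : Set ℂ, F.Finite ∧ t₀ ∉ F ∧
      ∀ t, t ∉ F → ∀ ht : curve γ t ∈ L, (⟨curve γ t, ht⟩ : ZariskiSet L) ∈ O := by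
  obtain ⟨p, hp, hp'⟩ := isOpen_zariski_iff.1 hO _ h
  rw [← eval_curve] at hp
  have hne : MvPolynomial.aeval γ p ≠ 0 := fun h => hp (by rw [h, Polynomial.eval_zero])
  refine ⟨{t | (MvPolynomial.aeval γ p).eval t = 0}, ?_, hp, fun t ht h => hp' _ ?_⟩
  · exact Polynomial.finite_setOfPred_isRoot hne
  · rw [← eval_curve]; exact ht

end Zariski

/-! ### The projective line -/

namespace ProjLine

/-- The point `(x : y)` of the projective line. -/
noncomputable def point (x y : ℂ) (h : (![x, y] : Fin 2 → ℂ) ≠ 0) : ProjLine := proj ⟨![x, y], h⟩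

theorem vec_ne_zero {x y : ℂ} (h : y ≠ 0) : (![x, y] : Fin 2 → ℂ) ≠ 0 := fun e => h (congrFun e 1)

theorem proj_eq_proj_iff (v w : ZariskiSet {v : Fin 2 → ℂ | v ≠ 0}) :
    proj v = proj w ↔ v.1 0 * w.1 1 = v.1 1 * w.1 0 := by
  have h := Projectivization.mk_eq_mk_iff' ℂ v.1 w.1 v.2 w.2
  refine Iff.trans h ?_
  constructor
  · rintro ⟨a, ha⟩
    rw [← ha]; simp; ring
  · intro h
    by_cases h0 : w.1 0 = 0
    · have h1 : w.1 1 ≠ 0 := fun h1 => w.2 (by ext i; fin_cases i <;> assumption)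
      have h2 : v.1 0 = 0 := by
        rw [h0, mul_zero] at h
        exact (mul_eq_zero.1 h).resolve_right h1
      refine ⟨v.1 1 / w.1 1, ?_⟩
      ext i; fin_cases i
      · simp [h0, h2]
      · simp [h1]
    · refine ⟨v.1 0 / w.1 0, ?_⟩
      ext i; fin_cases i
      · simp [h0]
      · simp; field_simp; linear_combination h

theorem point_eq_point_iff {x y x' y' : ℂ} {h : (![x, y] : Fin 2 → ℂ) ≠ 0}
    {h' : (![x', y'] : Fin 2 → ℂ) ≠ 0} : point x y h = point x' y' h' ↔ x * y' = y * x' :=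
  proj_eq_proj_iff _ _

theorem proj_eq_point_iff {v : ZariskiSet {v : Fin 2 → ℂ | v ≠ 0}} {x y : ℂ}
    {h : (![x, y] : Fin 2 → ℂ) ≠ 0} : proj v = point x y h ↔ v.1 0 * y = v.1 1 * x :=
  proj_eq_proj_iff _ _

theorem exists_point (P : ProjLine) : P = point 1 0 (fun h => one_ne_zero (congrFun h 0)) ∨
    ∃ m, P = point m 1 (vec_ne_zero one_ne_zero) := by
  obtain ⟨v, rfl⟩ : ∃ v, proj v = P := by
    induction P using Projectivization.ind with | h v hv => exact ⟨⟨v, hv⟩, rfl⟩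
  by_cases h : v.1 1 = 0
  · left
    exact proj_eq_point_iff.2 (by simp [h])
  · right
    refine ⟨v.1 0 / v.1 1, ?_⟩
    exact proj_eq_point_iff.2 (by field_simp)

theorem point_injective :
    Function.Injective fun m : ℂ => point m 1 (vec_ne_zero one_ne_zero) := by
  intro m n h
  simpa using point_eq_point_iff.1 h

/-- Sets with finite complement are open in the projective line. -/
theorem isOpen_of_finite_compl {O : Set ProjLine} (h : Oᶜ.Finite) : IsOpen O := by
  have hsing : ∀ P : ProjLine, IsOpen ({P}ᶜ : Set ProjLine) := by
    intro P
    obtain ⟨w, rfl⟩ : ∃ w, proj w = P := by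
      induction P using Projectivization.ind with | h v hv => exact ⟨⟨v, hv⟩, rfl⟩
    change IsOpen (proj ⁻¹' {proj w}ᶜ)
    convert isOpen_zariski_basic (L := {v : Fin 2 → ℂ | v ≠ 0})
      (MvPolynomial.X 0 * MvPolynomial.C (w.1 1) -
        MvPolynomial.X 1 * MvPolynomial.C (w.1 0)) using 1
    ext v
    simp [proj_eq_proj_iff, sub_eq_zero]
  rw [← compl_compl O, ← Set.biUnion_of_singleton Oᶜ, Set.compl_iUnion₂]
  exact h.isOpen_biInter fun P _ => hsing P

theorem finite_compl_of_isOpen {O : Set ProjLine} (h : IsOpen O) (hne : O.Nonempty) :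
    Oᶜ.Finite := by
  have hO : IsOpen (proj ⁻¹' O) := h
  obtain ⟨P, hP⟩ := hne
  have key : ∃ m, point m 1 (vec_ne_zero one_ne_zero) ∈ O := by
    rcases exists_point P with rfl | ⟨m, rfl⟩
    · have hL : ∀ t, curve ![1, Polynomial.X] t ∈ {v : Fin 2 → ℂ | v ≠ 0} := fun t h => by
        have := congrFun h 0
        simp [curve] at this
      have hpt : proj ⟨curve ![1, Polynomial.X] 0, hL 0⟩ =
          point 1 0 (fun h => one_ne_zero (congrFun h 0)) :=
        proj_eq_point_iff.2 (by simp [curve])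
      obtain ⟨F, hF, -, h⟩ := finite_curve_of_isOpen (L := {v : Fin 2 → ℂ | v ≠ 0})
        ![1, Polynomial.X] hO (t₀ := 0) (hL 0)
        (show proj ⟨curve ![1, Polynomial.X] 0, hL 0⟩ ∈ O from hpt ▸ hP)
      obtain ⟨t, ht⟩ := (hF.union (Set.finite_singleton (0 : ℂ))).infinite_compl.nonempty
      simp only [Set.mem_compl_iff, Set.mem_union, Set.mem_singleton_iff, not_or] at ht
      have hpt' : proj ⟨curve ![1, Polynomial.X] t, hL t⟩ =
          point (1 / t) 1 (vec_ne_zero one_ne_zero) :=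
        proj_eq_point_iff.2 (by simp [curve, ht.2])
      exact ⟨1 / t, hpt' ▸ h t ht.1 (hL t)⟩
    · exact ⟨m, hP⟩
  obtain ⟨m, hm⟩ := key
  have hL : ∀ t, curve ![Polynomial.X, 1] t ∈ {v : Fin 2 → ℂ | v ≠ 0} := fun t h => by
    have := congrFun h 1
    simp [curve] at this
  have hpt : ∀ t, proj ⟨curve ![Polynomial.X, 1] t, hL t⟩ =
      point t 1 (vec_ne_zero one_ne_zero) := fun t => proj_eq_point_iff.2 (by simp [curve])
  obtain ⟨F, hF, -, h⟩ := finite_curve_of_isOpen (L := {v : Fin 2 → ℂ | v ≠ 0})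
    ![Polynomial.X, 1] hO (t₀ := m) (hL m)
    (show proj ⟨curve ![Polynomial.X, 1] m, hL m⟩ ∈ O from hpt m ▸ hm)
  refine ((Set.finite_singleton (point 1 0 (fun h => one_ne_zero (congrFun h 0)))).union
    (hF.image fun m => point m 1 (vec_ne_zero one_ne_zero))).subset fun Q hQ => ?_
  rcases exists_point Q with rfl | ⟨t, rfl⟩
  · exact Or.inl rfl
  · refine Or.inr ⟨t, ?_, rfl⟩
    by_contra htF
    refine hQ ?_
    rw [← hpt]
    exact h t htF (hL t)

instance : Infinite ProjLine := Infinite.of_injective _ point_injective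

theorem isPreirreducible_univ : IsPreirreducible (Set.univ : Set ProjLine) := by
  rintro U V hU hV ⟨x, -, hx⟩ ⟨y, -, hy⟩
  have := (finite_compl_of_isOpen hU ⟨x, hx⟩).union (finite_compl_of_isOpen hV ⟨y, hy⟩)
  obtain ⟨z, hz⟩ := this.infinite_compl.nonempty
  simp only [Set.mem_compl_iff, Set.mem_union, not_or, not_not] at hz
  exact ⟨z, trivial, hz⟩

theorem eval_div_eq (P : Polynomial ℂ) : ∃ (p : MvPolynomial (Fin 2) ℂ) (N : ℕ),
    ∀ v : Fin 2 → ℂ, v 1 ≠ 0 → P.eval (v 0 / v 1) = MvPolynomial.eval v p / v 1 ^ N := by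
  induction P using Polynomial.induction_on' with
  | add P Q hP hQ =>
    obtain ⟨p, N, hp⟩ := hP
    obtain ⟨q, M, hq⟩ := hQ
    refine ⟨p * MvPolynomial.X 1 ^ M + MvPolynomial.X 1 ^ N * q, N + M, fun v hv => ?_⟩
    rw [Polynomial.eval_add, hp v hv, hq v hv]
    simp
    field_simp
    ring
  | monomial n a =>
    refine ⟨MvPolynomial.C a * MvPolynomial.X 0 ^ n, n, fun v hv => ?_⟩
    simp [div_pow, mul_div_assoc]

/-- A function that is a quotient of polynomials in the affine coordinate is regular. -/
theorem regularOn_of_eval {V : Set ProjLine} {φ : ProjLine → ℂ} {P Q : Polynomial ℂ}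
    (hV : point 1 0 (fun h => one_ne_zero (congrFun h 0)) ∉ V)
    (h : ∀ m, point m 1 (vec_ne_zero one_ne_zero) ∈ V → Q.eval m ≠ 0 ∧
      φ (point m 1 (vec_ne_zero one_ne_zero)) = P.eval m / Q.eval m) : RegularOn V φ := by
  obtain ⟨p, N, hp⟩ := eval_div_eq P
  obtain ⟨q, M, hq⟩ := eval_div_eq Q
  intro v hv
  refine ⟨Set.univ, isOpen_univ, trivial, p * MvPolynomial.X 1 ^ M, MvPolynomial.X 1 ^ N * q, ?_⟩
  rintro w ⟨-, hw⟩
  have hw1 : w.1 1 ≠ 0 := by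
    intro h0
    refine hV ?_
    have : point 1 0 (fun h => one_ne_zero (congrFun h 0)) = proj w :=
      (proj_eq_point_iff.2 (by simp [h0])).symm
    rw [this]; exact hw
  have he : point (w.1 0 / w.1 1) 1 (vec_ne_zero one_ne_zero) = proj w :=
    (proj_eq_point_iff.2 (by field_simp)).symm
  have := h (w.1 0 / w.1 1) (by rw [he]; exact hw)
  rw [he, hp _ hw1, hq _ hw1] at this
  obtain ⟨h1, h2⟩ := this
  have h3 : MvPolynomial.eval w.1 q ≠ 0 := fun h => h1 (by rw [h, zero_div])
  refine ⟨by simp [hw1, h3], ?_⟩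
  rw [Function.comp_apply, h2]
  simp
  field_simp

end ProjLine

/-! ### Rational functions of one variable -/

/-- A function that is locally, up to finite sets, a quotient of polynomials is globally the
quotient of two coprime polynomials. -/
theorem exists_global_quotient {W : Set ℂ} (hW : Wᶜ.Finite) {ψ : ℂ → ℂ}
    (h : ∀ t ∈ W, ∃ F : Set ℂ, F.Finite ∧ t ∉ F ∧ ∃ P Q : Polynomial ℂ, ∀ s ∈ W, s ∉ F →
      Q.eval s ≠ 0 ∧ ψ s = P.eval s / Q.eval s) :
    ∃ P Q : Polynomial ℂ, ∀ s ∈ W, Q.eval s ≠ 0 ∧ ψ s = P.eval s / Q.eval s := by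
  obtain ⟨t₀, ht₀⟩ := hW.infinite_compl.nonempty
  rw [compl_compl] at ht₀
  obtain ⟨F₀, hF₀, htF₀, P₀, Q₀, h₀⟩ := h t₀ ht₀
  have hQ₀ : Q₀ ≠ 0 := fun h => (h₀ t₀ ht₀ htF₀).1 (by rw [h, Polynomial.eval_zero])
  obtain ⟨G, P, Q, hPQ, rfl, rfl⟩ : ∃ G P Q : Polynomial ℂ, IsCoprime P Q ∧
      P₀ = G * P ∧ Q₀ = G * Q := by
    obtain ⟨P, hP⟩ := EuclideanDomain.gcd_dvd_left P₀ Q₀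
    obtain ⟨Q, hQ⟩ := EuclideanDomain.gcd_dvd_right P₀ Q₀
    refine ⟨_, P, Q, ?_, hP, hQ⟩
    have hg : EuclideanDomain.gcd P₀ Q₀ ≠ 0 := fun h => hQ₀ (EuclideanDomain.gcd_eq_zero_iff.1 h).2
    refine ⟨EuclideanDomain.gcdA P₀ Q₀, EuclideanDomain.gcdB P₀ Q₀, mul_left_cancel₀ hg ?_⟩
    have := EuclideanDomain.gcd_eq_gcd_ab P₀ Q₀
    calc _ = (EuclideanDomain.gcd P₀ Q₀ * P) * EuclideanDomain.gcdA P₀ Q₀ +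
          (EuclideanDomain.gcd P₀ Q₀ * Q) * EuclideanDomain.gcdB P₀ Q₀ := by ring
      _ = _ := by rw [← hP, ← hQ, ← this, mul_one]
  have hval : ∀ s ∈ W, s ∉ F₀ → Q.eval s ≠ 0 ∧ ψ s = P.eval s / Q.eval s := by
    intro s hs hsF
    obtain ⟨h1, h2⟩ := h₀ s hs hsF
    rw [Polynomial.eval_mul] at h1
    rw [Polynomial.eval_mul, Polynomial.eval_mul,
      mul_div_mul_left _ _ (left_ne_zero_of_mul h1)] at h2
    exact ⟨right_ne_zero_of_mul h1, h2⟩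
  refine ⟨P, Q, fun t ht => ?_⟩
  obtain ⟨F₁, hF₁, htF₁, P₁, Q₁, h₁⟩ := h t ht
  have heq : P * Q₁ = P₁ * Q := by
    refine Polynomial.eq_of_infinite_eval_eq _ _ ?_
    refine ((hW.union (hF₀.union hF₁)).infinite_compl).mono fun s hs => ?_
    simp only [Set.mem_compl_iff, Set.mem_union, not_or, not_not] at hs
    obtain ⟨h1, h2⟩ := hval s hs.1 hs.2.1
    obtain ⟨h3, h4⟩ := h₁ s hs.1 hs.2.2
    rw [h2, div_eq_div_iff h1 h3] at h4
    rw [Set.mem_ofPred_eq, Polynomial.eval_mul, Polynomial.eval_mul, h4]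
  obtain ⟨h3, h4⟩ := h₁ t ht htF₁
  have het := congrArg (Polynomial.eval t) heq
  rw [Polynomial.eval_mul, Polynomial.eval_mul] at het
  have hQt : Q.eval t ≠ 0 := by
    intro h0
    rw [h0, mul_zero] at het
    have hP0 := (mul_eq_zero.1 het).resolve_right h3
    obtain ⟨a, b, hab⟩ := hPQ
    have := congrArg (Polynomial.eval t) hab
    simp [hP0, h0] at this
  exact ⟨hQt, by rw [h4, div_eq_div_iff h3 hQt, het]⟩

/-- Polynomials in `x` are linear in `x` over the polynomials in `y` when `x` satisfies a monic
quadratic equation over these. -/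
theorem eval_eq_linear (s n P : Polynomial ℂ) : ∃ A B : Polynomial ℂ, ∀ x y : ℂ,
    x ^ 2 = s.eval y * x - n.eval y → P.eval x = A.eval y + x * B.eval y := by
  induction P using Polynomial.induction_on with
  | C a => exact ⟨Polynomial.C a, 0, fun x y _ => by simp⟩
  | add P Q hP hQ =>
    obtain ⟨A, B, h⟩ := hP
    obtain ⟨A', B', h'⟩ := hQ
    refine ⟨A + A', B + B', fun x y e => ?_⟩
    simp only [Polynomial.eval_add, h x y e, h' x y e]
    ring
  | monomial k a hk =>
    obtain ⟨A, B, h⟩ := hk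
    refine ⟨-(n * B), A + s * B, fun x y e => ?_⟩
    have : Polynomial.eval x (Polynomial.C a * Polynomial.X ^ (k + 1)) =
        Polynomial.eval x (Polynomial.C a * Polynomial.X ^ k) * x := by simp; ring
    rw [this, h x y e]
    simp
    linear_combination B.eval y * e

/-- A function of `y` that is a quotient of polynomials in the roots of a monic quadratic equation
over the polynomials in `y` is a quotient of polynomials in `y`: take the trace of the numerator
times the conjugate denominator. -/
theorem exists_quotient_of_quadratic (s n P Q : Polynomial ℂ) {Y : Set ℂ} {ψ : ℂ → ℂ}
    (h : ∀ y ∈ Y, ∀ x, x ^ 2 = s.eval y * x - n.eval y →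
      Q.eval x ≠ 0 ∧ ψ y = P.eval x / Q.eval x) :
    ∃ P' Q' : Polynomial ℂ, ∀ y ∈ Y, Q'.eval y ≠ 0 ∧ ψ y = P'.eval y / Q'.eval y := by
  obtain ⟨A, B, hP⟩ := eval_eq_linear s n P
  obtain ⟨C, D, hQ⟩ := eval_eq_linear s n Q
  refine ⟨2 * A * C + s * (A * D + B * C) + 2 * n * B * D,
    2 * (C ^ 2 + s * C * D + n * D ^ 2), fun y hy => ?_⟩
  obtain ⟨d, hd⟩ := IsAlgClosed.exists_pow_nat_eq (s.eval y ^ 2 - 4 * n.eval y) two_pos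
  set x := (s.eval y + d) / 2 with hx
  have hx1 : x ^ 2 = s.eval y * x - n.eval y := by rw [hx]; linear_combination hd / 4
  have hx2 : (s.eval y - x) ^ 2 = s.eval y * (s.eval y - x) - n.eval y := by
    linear_combination hx1
  clear_value x
  obtain ⟨q1, e1⟩ := h y hy x hx1
  obtain ⟨q2, e2⟩ := h y hy _ hx2
  rw [hP x y hx1, hQ x y hx1] at e1
  rw [hP _ y hx2, hQ _ y hx2] at e2
  rw [hQ x y hx1] at q1
  rw [hQ _ y hx2] at q2
  have hden : Polynomial.eval y (2 * (C ^ 2 + s * C * D + n * D ^ 2)) =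
      2 * ((C.eval y + x * D.eval y) * (C.eval y + (s.eval y - x) * D.eval y)) := by
    simp
    linear_combination D.eval y ^ 2 * hx1
  have hnum : Polynomial.eval y (2 * A * C + s * (A * D + B * C) + 2 * n * B * D) =
      (A.eval y + x * B.eval y) * (C.eval y + (s.eval y - x) * D.eval y) +
        (A.eval y + (s.eval y - x) * B.eval y) * (C.eval y + x * D.eval y) := by
    simp
    linear_combination 2 * B.eval y * D.eval y * hx1
  rw [hden, hnum]
  refine ⟨mul_ne_zero two_ne_zero (mul_ne_zero q1 q2), ?_⟩
  rw [eq_div_iff q1] at e1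
  rw [eq_div_iff q2] at e2
  rw [eq_div_iff (mul_ne_zero two_ne_zero (mul_ne_zero q1 q2)), ← e1, ← e2]
  ring

/-! ### The period map of the moduli space -/

/-- The configuration `v` labels the normals of an arrangement of class `q`. -/
def Labels (v : Fin 6 → Fin 3 → ℂ) (q : Moduli) : Prop :=
  ∃ (h : ∀ i, v i ≠ 0) (hu : IsUnassuming (arr v h)), q = Moduli.mk (arr v h) hu

theorem moduli_mk_eq_iff {A B : Set Line} {hA : IsUnassuming A} {hB : IsUnassuming B} :
    Moduli.mk A hA = Moduli.mk B hB ↔ ProjEquiv A B :=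
  Quotient.eq (r := unassumingSetoid)

theorem moduli_mk_congr {A B : Set Line} (h : A = B) (hA : IsUnassuming A) (hB : IsUnassuming B) :
    Moduli.mk A hA = Moduli.mk B hB := by
  subst h; rfl

theorem Labels.genPos {v : Fin 6 → Fin 3 → ℂ} {q : Moduli} (h : Labels v q) : GenPos v := by
  obtain ⟨h, hu, -⟩ := h
  exact hu.genPos

theorem Labels.card_concSet {v : Fin 6 → Fin 3 → ℂ} {q : Moduli} (h : Labels v q) :
    (concSet v).card = 6 := by
  obtain ⟨h, hu, -⟩ := h
  exact hu.card_concSet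

theorem Labels.eq {v : Fin 6 → Fin 3 → ℂ} {q q' : Moduli} (h : Labels v q) (h' : Labels v q') :
    q = q' := by
  obtain ⟨h, hu, rfl⟩ := h
  obtain ⟨h', hu', rfl⟩ := h'
  rfl

theorem Labels.comp {v : Fin 6 → Fin 3 → ℂ} {q : Moduli} (h : Labels v q)
    (π : Equiv.Perm (Fin 6)) : Labels (v ∘ π) q := by
  obtain ⟨h, hu, rfl⟩ := h
  have e := arr_comp h π.injective
  exact ⟨fun i => h (π i), e ▸ hu, moduli_mk_congr e.symm _ _⟩

theorem Labels.scaled {v w : Fin 6 → Fin 3 → ℂ} {q : Moduli} (hv : Labels v q)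
    (hw : Labels w q) : ∃ π : Equiv.Perm (Fin 6), Scaled v (w ∘ π) := by
  have hg := hv.genPos
  obtain ⟨h, hu, rfl⟩ := hv
  obtain ⟨h', hu', e⟩ := hw
  obtain ⟨π, hπ, hs⟩ := exists_scaled_of_projEquiv hg h' (moduli_mk_eq_iff.1 e)
  exact ⟨Equiv.ofBijective π (Finite.injective_iff_bijective.1 hπ), hs⟩

theorem labels_proj (M : ZariskiSet normalMatrices) :
    Labels (fun i j => M.1 (j, i)) (Moduli.proj M) :=
  ⟨M.2.choose, M.2.choose_spec, rfl⟩

theorem Labels.exists_mem_normalMatrices {v : Fin 6 → Fin 3 → ℂ} {q : Moduli} (h : Labels v q) :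
    ∃ hM : (fun p => v p.2 p.1) ∈ normalMatrices, Moduli.proj ⟨fun p => v p.2 p.1, hM⟩ = q := by
  obtain ⟨h', hu, e⟩ := id h
  have hM : (fun p => v p.2 p.1) ∈ normalMatrices := ⟨h', hu⟩
  exact ⟨hM, (labels_proj ⟨_, hM⟩).eq h⟩

theorem exists_labels_stdFour {r : ℂ} (h : IsGood r) : ∃ q, Labels (stdFour r) q :=
  have h0 := (genPos_stdFour h.1 fun e => h.2.1 (by linear_combination (r ^ 2 + 1) * e)).ne_zero
  ⟨_, h0, isUnassuming_stdFour h h0, rfl⟩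

theorem exists_labels_stdThree {ω : ℂ} (h : ω ^ 2 + ω + 1 = 0) : ∃ q, Labels (stdThree ω) q :=
  ⟨_, (genPos_stdThree h).ne_zero, isUnassuming_stdThree h _, rfl⟩

/-- Every unassuming arrangement is projectively equivalent to one of the normal forms. -/
theorem exists_labels (q : Moduli) : (∃ r, IsGood r ∧ Labels (stdFour r) q) ∨
    ∃ ω : ℂ, ω ^ 2 + ω + 1 = 0 ∧ Labels (stdThree ω) q := by
  obtain ⟨⟨A, hA⟩, rfl⟩ := Quotient.exists_rep q
  obtain ⟨v, h, rfl, hc⟩ := hA.exists_concSet_eq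
  have key : ∀ {w : Fin 6 → Fin 3 → ℂ}, Scaled v w →
      Labels w (Quotient.mk unassumingSetoid ⟨arr v h, hA⟩) := fun {w} hs => by
    have hw := (hs.genPos hA.genPos).ne_zero
    have he := hs.projEquiv h hw
    exact ⟨hw, hA.of_projEquiv he, moduli_mk_eq_iff.2 he⟩
  rcases hc with hc | hc
  · obtain ⟨r, hr⟩ := exists_scaled_stdFour hA.genPos hc
    have hl := key hr
    refine Or.inl ⟨r, ?_, hl⟩
    obtain ⟨h0, hu, -⟩ := hl
    exact isGood_of_isUnassuming hu (by rw [← hr.concSet_eq, hc])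
  · obtain ⟨ω, hω, hr⟩ := exists_scaled_stdThree hA.genPos hc
    exact Or.inr ⟨ω, hω, key hr⟩

theorem Labels.exists_comp {v : Fin 6 → Fin 3 → ℂ} {q : Moduli} (h : Labels v q) :
    ∃ π : Equiv.Perm (Fin 6), concSet (v ∘ π) = fourSet ∨ concSet (v ∘ π) = threeSet := by
  rcases exists_labels q with ⟨r, hr, hl⟩ | ⟨ω, hω, hl⟩
  · obtain ⟨π, hs⟩ := hl.scaled h
    exact ⟨π, Or.inl (by rw [← hs.concSet_eq, concSet_stdFour hr])⟩
  · obtain ⟨π, hs⟩ := hl.scaled h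
    exact ⟨π, Or.inr (by rw [← hs.concSet_eq, concSet_stdThree hω])⟩

theorem GenPos.inv_ne_zero {v : Fin 6 → Fin 3 → ℂ} (hv : GenPos v) :
    (![invX v, invY v] : Fin 2 → ℂ) ≠ 0 :=
  ProjLine.vec_ne_zero hv.invY_ne_zero

open Classical in
/-- The map from the moduli space to the disjoint union of the projective line and a point: the
invariant of the arrangements of the one-parameter family; the others, which are all equivalent,
go to the point. -/
noncomputable def period (q : Moduli) : ProjLine ⊕ Unit :=
  if h : ∃ v, Labels v q ∧ concSet v = fourSet then
    Sum.inl (ProjLine.point (invX h.choose) (invY h.choose) h.choose_spec.1.genPos.inv_ne_zero)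
  else Sum.inr ()

theorem Labels.period_eq_inl {v : Fin 6 → Fin 3 → ℂ} {q : Moduli} (hv : Labels v q)
    (hc : concSet v = fourSet) :
    period q = Sum.inl (ProjLine.point (invX v) (invY v) hv.genPos.inv_ne_zero) := by
  have h : ∃ v, Labels v q ∧ concSet v = fourSet := ⟨v, hv, hc⟩
  rw [period, dif_pos h]
  refine congrArg _ (ProjLine.point_eq_point_iff.2 ?_)
  obtain ⟨π, hs⟩ := h.choose_spec.1.scaled hv
  rw [inv_eq_of_scaled hv.genPos h.choose_spec.2 hc π hs, mul_comm]

theorem Labels.period_eq_inr {v : Fin 6 → Fin 3 → ℂ} {q : Moduli} (hv : Labels v q)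
    (hc : concSet v = threeSet) : period q = Sum.inr () := by
  rw [period, dif_neg]
  rintro ⟨w, hw, hw4⟩
  obtain ⟨π, hs⟩ := hv.scaled hw
  exact not_scaled_of_types hc hw4 π hs

/-- The invariant of the family in its affine coordinate. -/
noncomputable def invRat (r : ℂ) : ℂ := (r ^ 2 - 1) ^ 2 / (16 * r ^ 2)

theorem Labels.period_stdFour {r : ℂ} {q : Moduli} (h : Labels (stdFour r) q) (hr : IsGood r) :
    period q = Sum.inl (ProjLine.point (invRat r) 1 (ProjLine.vec_ne_zero one_ne_zero)) := by
  rw [h.period_eq_inl (concSet_stdFour hr)]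
  refine congrArg _ (ProjLine.point_eq_point_iff.2 ?_)
  have := hr.1
  rw [invX_stdFour, invY_stdFour, invRat]
  field_simp

theorem Labels.period_stdThree {ω : ℂ} {q : Moduli} (h : Labels (stdThree ω) q)
    (hω : ω ^ 2 + ω + 1 = 0) : period q = Sum.inr () :=
  h.period_eq_inr (concSet_stdThree hω)

theorem period_injective : Function.Injective period := by
  intro q q' e
  rcases exists_labels q with ⟨r, hr, hl⟩ | ⟨ω, hω, hl⟩ <;>
    rcases exists_labels q' with ⟨s, hs, hl'⟩ | ⟨ω', hω', hl'⟩
  · rw [hl.period_stdFour hr, hl'.period_stdFour hs] at e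
    have e' : invRat r = invRat s := ProjLine.point_injective (Sum.inl_injective e)
    rw [invRat, invRat, div_eq_div_iff (by simpa using hr.1) (by simpa using hs.1)] at e'
    obtain ⟨h, hu, rfl⟩ := hl
    obtain ⟨h', hu', rfl⟩ := hl'
    exact moduli_mk_eq_iff.2 (projEquiv_stdFour h h' hr.1 e')
  · rw [hl.period_stdFour hr, hl'.period_stdThree hω'] at e
    cases e
  · rw [hl.period_stdThree hω, hl'.period_stdFour hs] at e
    cases e
  · obtain ⟨h, hu, rfl⟩ := hl
    obtain ⟨h', hu', rfl⟩ := hl'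
    exact moduli_mk_congr (arr_stdThree_eq hω hω' h h') _ _

/-- Every value of the invariant is taken: solve `r ^ 2 = 4 * k * r + 1` with `k ^ 2 = m`. -/
theorem exists_invRat (m : ℂ) : ∃ r, r ≠ 0 ∧ invRat r = m := by
  obtain ⟨k, hk⟩ := IsAlgClosed.exists_pow_nat_eq m two_pos
  obtain ⟨d, hd⟩ := IsAlgClosed.exists_pow_nat_eq (4 * k ^ 2 + 1) two_pos
  have h : (2 * k + d) ^ 2 = 4 * k * (2 * k + d) + 1 := by linear_combination hd
  have h0 : 2 * k + d ≠ 0 := fun h0 => by rw [h0] at h; norm_num at h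
  refine ⟨_, h0, ?_⟩
  have h1 : (2 * k + d) ^ 2 - 1 = 4 * k * (2 * k + d) := by rw [h]; ring
  rw [invRat, div_eq_iff (by simpa using h0), ← hk, h1]
  ring

/-- Whether a parameter is admissible depends on its invariant only. -/
theorem isGood_iff {r : ℂ} (hr : r ≠ 0) :
    IsGood r ↔ invRat r ≠ 0 ∧ 4 * invRat r + 1 ≠ 0 ∧ invRat r ≠ 1 := by
  have h1 : 4 * invRat r + 1 = (r ^ 2 + 1) ^ 2 / (4 * r ^ 2) := by
    rw [invRat]; field_simp; ring
  have h2 : r ^ 4 - 1 = (r ^ 2 - 1) * (r ^ 2 + 1) := by ring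
  rw [h1, invRat, IsGood, ← sub_ne_zero (a := r ^ 4), h2]
  simp [hr, div_eq_one_iff_eq, and_assoc]

theorem finite_not_isGood : {r | ¬ IsGood r}.Finite := by
  have hne : (Polynomial.X * (Polynomial.X ^ 4 - 1) *
      ((Polynomial.X ^ 2 - 1) ^ 2 - 16 * Polynomial.X ^ 2) : Polynomial ℂ) ≠ 0 := fun h => by
    have := congrArg (Polynomial.eval 2) h
    norm_num at this
  refine (Polynomial.finite_setOfPred_isRoot hne).subset fun r hr => ?_
  simp only [Set.mem_ofPred_eq, IsGood, not_and_or, not_not] at hr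
  rw [Set.mem_ofPred_eq, Polynomial.IsRoot]
  rcases hr with h | h | h <;> simp [h]

/-! ### The period map in coordinates -/

/-- Polynomial functions on affine space. -/
def IsPoly {σ : Type} (f : (σ → ℂ) → ℂ) : Prop :=
  ∃ p : MvPolynomial σ ℂ, ∀ x, MvPolynomial.eval x p = f x

section IsPoly

variable {σ : Type} {f g : (σ → ℂ) → ℂ}

theorem isPoly_const (c : ℂ) : IsPoly fun _ : σ → ℂ => c :=
  ⟨MvPolynomial.C c, fun _ => MvPolynomial.eval_C _⟩

theorem isPoly_coord (i : σ) : IsPoly fun x : σ → ℂ => x i :=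
  ⟨MvPolynomial.X i, fun _ => MvPolynomial.eval_X _⟩

theorem IsPoly.add (hf : IsPoly f) (hg : IsPoly g) : IsPoly fun x => f x + g x := by
  obtain ⟨p, hp⟩ := hf
  obtain ⟨q, hq⟩ := hg
  exact ⟨p + q, fun x => by rw [map_add, hp, hq]⟩

theorem IsPoly.sub (hf : IsPoly f) (hg : IsPoly g) : IsPoly fun x => f x - g x := by
  obtain ⟨p, hp⟩ := hf
  obtain ⟨q, hq⟩ := hg
  exact ⟨p - q, fun x => by rw [map_sub, hp, hq]⟩

theorem IsPoly.mul (hf : IsPoly f) (hg : IsPoly g) : IsPoly fun x => f x * g x := by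
  obtain ⟨p, hp⟩ := hf
  obtain ⟨q, hq⟩ := hg
  exact ⟨p * q, fun x => by rw [map_mul, hp, hq]⟩

theorem IsPoly.neg (hf : IsPoly f) : IsPoly fun x => -f x := by
  obtain ⟨p, hp⟩ := hf
  exact ⟨-p, fun x => by rw [map_neg, hp]⟩

theorem IsPoly.pow (hf : IsPoly f) (n : ℕ) : IsPoly fun x => f x ^ n := by
  obtain ⟨p, hp⟩ := hf
  exact ⟨p ^ n, fun x => by rw [map_pow, hp]⟩

theorem isPoly_bracket {a b c : (σ → ℂ) → Fin 3 → ℂ} (ha : ∀ j, IsPoly fun x => a x j)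
    (hb : ∀ j, IsPoly fun x => b x j) (hc : ∀ j, IsPoly fun x => c x j) :
    IsPoly fun x => bracket (a x) (b x) (c x) := by
  have h : ∀ i j k, IsPoly fun x => a x i * (b x j * c x k - b x k * c x j) := fun i j k =>
    (ha i).mul (((hb j).mul (hc k)).sub ((hb k).mul (hc j)))
  simp only [bracket_apply]
  exact ((h 0 1 2).add (h 1 2 0)).add (h 2 0 1)

theorem isPoly_cross {a b : (σ → ℂ) → Fin 3 → ℂ} (ha : ∀ j, IsPoly fun x => a x j)
    (hb : ∀ j, IsPoly fun x => b x j) (j : Fin 3) : IsPoly fun x => (a x ⨯₃ b x) j := by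
  have h : ∀ j k, IsPoly fun x => a x j * b x k - a x k * b x j := fun j k =>
    ((ha j).mul (hb k)).sub ((ha k).mul (hb j))
  simp only [cross_apply]
  fin_cases j
  exacts [h 1 2, h 2 0, h 0 1]

theorem isPoly_joubert {v : (σ → ℂ) → Fin 6 → Fin 3 → ℂ} (hv : ∀ i j, IsPoly fun x => v x i j)
    (i : Fin 6) : IsPoly fun x => joubert (v x) i := by
  have h : ∀ k, IsPoly fun x => chordDet (v x) k := fun k =>
    isPoly_bracket (isPoly_cross (hv _) (hv _)) (isPoly_cross (hv _) (hv _))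
      (isPoly_cross (hv _) (hv _))
  fin_cases i
  exacts [isPoly_const 0, (h 0).neg, (h 1).neg, (h 2).neg, h 3, (h 4).neg]

theorem isPoly_inv {v : (σ → ℂ) → Fin 6 → Fin 3 → ℂ} (hv : ∀ i j, IsPoly fun x => v x i j) :
    (IsPoly fun x => invX (v x)) ∧ IsPoly fun x => invY (v x) :=
  ⟨((isPoly_bracket (hv _) (hv _) (hv _)).mul (isPoly_bracket (hv _) (hv _) (hv _))).pow 2,
    ((isPoly_bracket (hv _) (hv _) (hv _)).mul (isPoly_bracket (hv _) (hv _) (hv _))).pow 2⟩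

end IsPoly

/-- The configuration of the columns of a matrix, in the order given by `π`. -/
def columns (π : Equiv.Perm (Fin 6)) (M : Fin 3 × Fin 6 → ℂ) : Fin 6 → Fin 3 → ℂ :=
  fun i j => M (j, π i)

theorem labels_columns (π : Equiv.Perm (Fin 6)) (M : ZariskiSet normalMatrices) :
    Labels (columns π M.1) (Moduli.proj M) :=
  (labels_proj M).comp π

theorem isPoly_columns (π : Equiv.Perm (Fin 6)) (i : Fin 6) (j : Fin 3) :
    IsPoly fun M => columns π M i j :=
  isPoly_coord _

/-- Near a given matrix of normals no further synthemes become concurrent, hence, their number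
being constant, the set of the concurrent ones is locally constant. -/
theorem exists_isOpen_concSet (π : Equiv.Perm (Fin 6)) (M₀ : ZariskiSet normalMatrices) :
    ∃ O : Set (ZariskiSet normalMatrices), IsOpen O ∧ M₀ ∈ O ∧
      ∀ M ∈ O, concSet (columns π M.1) = concSet (columns π M₀.1) := by
  refine ⟨⋂ k : Fin 15, {M | k ∈ concSet (columns π M.1) → k ∈ concSet (columns π M₀.1)}, ?_,
    by simp, fun M hM => ?_⟩
  · refine isOpen_iInter_of_finite fun k => ?_
    by_cases hk : k ∈ concSet (columns π M₀.1)
    · simp [hk]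
    · obtain ⟨p, hp⟩ := (isPoly_joubert (isPoly_columns π) (totalLeft k)).sub
        (isPoly_joubert (isPoly_columns π) (totalRight k))
      convert isOpen_zariski_basic (L := normalMatrices) p using 1
      ext M
      rw [Set.mem_ofPred_eq, Set.mem_ofPred_eq, hp, sub_ne_zero, mem_concSet_iff]
      simp [hk]
  · rw [Set.mem_iInter] at hM
    refine Finset.eq_of_subset_of_card_le (fun k hk => hM k hk) ?_
    rw [(labels_columns π M).card_concSet, (labels_columns π M₀).card_concSet]

/-- The period map is locally constant or given by homogeneous coordinates that are polynomials in
the matrix of normals. -/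
theorem exists_local_period (M₀ : ZariskiSet normalMatrices) :
    ∃ O : Set (ZariskiSet normalMatrices), IsOpen O ∧ M₀ ∈ O ∧
      ((∀ M ∈ O, period (Moduli.proj M) = Sum.inr ()) ∨
        ∃ (P : Fin 2 → MvPolynomial (Fin 3 × Fin 6) ℂ)
          (hP : ∀ M ∈ O, polyMap P M.1 ∈ {v : Fin 2 → ℂ | v ≠ 0}),
          ∀ M (h : M ∈ O), period (Moduli.proj M) =
            Sum.inl (ProjLine.proj ⟨polyMap P M.1, hP M h⟩)) := by
  obtain ⟨π, hπ⟩ := (labels_proj M₀).exists_comp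
  obtain ⟨O, hO, hM₀, h⟩ := exists_isOpen_concSet π M₀
  refine ⟨O, hO, hM₀, ?_⟩
  rcases hπ with hπ | hπ
  · right
    obtain ⟨⟨p, hp⟩, ⟨q, hq⟩⟩ := isPoly_inv (isPoly_columns π)
    have hpq : ∀ M : ZariskiSet normalMatrices, polyMap ![p, q] M.1 =
        ![invX (columns π M.1), invY (columns π M.1)] := fun M => by
      ext i; fin_cases i
      exacts [hp M.1, hq M.1]
    refine ⟨![p, q], fun M _ => ?_, fun M hM => ?_⟩
    · rw [hpq M]; exact (labels_columns π M).genPos.inv_ne_zero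
    · rw [(labels_columns π M).period_eq_inl ((h M hM).trans hπ)]
      refine congrArg Sum.inl (ProjLine.proj_eq_point_iff.2 ?_).symm
      simp only [hpq]
      simp [mul_comm]
  · exact Or.inl fun M hM => (labels_columns π M).period_eq_inr ((h M hM).trans hπ)

theorem continuous_period : Continuous period := by
  refine continuous_def.2 fun V hV => ?_
  change IsOpen (Moduli.proj ⁻¹' (period ⁻¹' V))
  rw [isOpen_iff_forall_mem_open]
  intro M₀ h₀
  obtain ⟨O, hO, hM₀, h | ⟨P, hP, h⟩⟩ := exists_local_period M₀
  · refine ⟨O, fun M hM => ?_, hO, hM₀⟩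
    have h₀' : period (Moduli.proj M₀) ∈ V := h₀
    change period (Moduli.proj M) ∈ V
    rw [h M hM]
    rwa [h M₀ hM₀] at h₀'
  · have hV' : IsOpen (ProjLine.proj ⁻¹' (Sum.inl ⁻¹' V)) := (isOpen_sum_iff.1 hV).1
    refine ⟨_, ?_, isOpen_polyMap_preimage P hO hP hV', hM₀, ?_⟩
    · rintro M ⟨hM, hMV⟩
      change period (Moduli.proj M) ∈ V
      rw [h M hM]
      exact hMV
    · have h₀' : period (Moduli.proj M₀) ∈ V := h₀
      rw [h M₀ hM₀] at h₀'
      exact h₀'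

theorem regularOn_comp_period {V : Set (ProjLine ⊕ Unit)} {φ : ProjLine ⊕ Unit → ℂ}
    (h : RegularOn V φ) : RegularOn (period ⁻¹' V) (φ ∘ period) := by
  have h1 : RegularOn (ProjLine.proj ⁻¹' (Sum.inl ⁻¹' V)) ((φ ∘ Sum.inl) ∘ ProjLine.proj) := h.1
  change RegularOn (Moduli.proj ⁻¹' (period ⁻¹' V)) ((φ ∘ period) ∘ Moduli.proj)
  refine glue fun M₀ h₀ => ?_
  obtain ⟨O, hO, hM₀, h | ⟨P, hP, h⟩⟩ := exists_local_period M₀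
  · refine ⟨O, hO, hM₀, SpaceWithFunctions.congr ?_ (SpaceWithFunctions.const _ (φ (Sum.inr ())))⟩
    intro M hM
    change φ (Sum.inr ()) = φ (period (Moduli.proj M))
    rw [h M hM.1]
  · refine ⟨O, hO, hM₀, regularOn_polyMap P hO hP h1 (fun M hM hMV => ?_) fun M hM _ => ?_⟩
    · have hMV' : period (Moduli.proj M) ∈ V := hMV
      rw [h M hM] at hMV'
      exact hMV'
    · change φ (period (Moduli.proj M)) = φ (Sum.inl _)
      rw [h M hM]

/-! ### The one-parameter family as a section of the period map -/

/-- The family `stdFour` as a rational curve in the space of matrices of normals. -/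
noncomputable def familyCurve : Fin 3 × Fin 6 → Polynomial ℂ := fun p =>
  (![![1, 1, 0], ![-1, 1, 0], ![0, 1, 1], ![0, -1, 1], ![Polynomial.X, 0, 1],
    ![Polynomial.X, 0, -1]] : Fin 6 → Fin 3 → Polynomial ℂ) p.2 p.1

theorem curve_familyCurve (r : ℂ) : curve familyCurve r = fun p => stdFour r p.2 p.1 := by
  ext ⟨j, i⟩
  fin_cases i <;> fin_cases j <;> simp [curve, familyCurve, stdFour]

theorem curve_mem_normalMatrices {r : ℂ} (hr : IsGood r) :
    curve familyCurve r ∈ normalMatrices := by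
  obtain ⟨q, hq⟩ := exists_labels_stdFour hr
  rw [curve_familyCurve]
  exact hq.exists_mem_normalMatrices.1

/-- The class of the member of parameter `r` of the family. -/
noncomputable def familyClass (r : ℂ) (hr : IsGood r) : Moduli :=
  Moduli.proj ⟨curve familyCurve r, curve_mem_normalMatrices hr⟩

theorem labels_familyClass (r : ℂ) (hr : IsGood r) : Labels (stdFour r) (familyClass r hr) := by
  have h := labels_proj ⟨curve familyCurve r, curve_mem_normalMatrices hr⟩
  have e : (fun i j => curve familyCurve r (j, i)) = stdFour r := by rw [curve_familyCurve]
  exact e ▸ h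

theorem period_familyClass (r : ℂ) (hr : IsGood r) : period (familyClass r hr) =
    Sum.inl (ProjLine.point (invRat r) 1 (ProjLine.vec_ne_zero one_ne_zero)) :=
  (labels_familyClass r hr).period_stdFour hr

theorem exists_eq_familyClass {q : Moduli} {P : ProjLine} (h : period q = Sum.inl P) :
    ∃ r hr, q = familyClass r hr := by
  rcases exists_labels q with ⟨r, hr, hl⟩ | ⟨ω, hω, hl⟩
  · exact ⟨r, hr, hl.eq (labels_familyClass r hr)⟩
  · rw [hl.period_stdThree hω] at h
    cases h

/-- An open set of the moduli space that meets the family contains all but finitely many of its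
members. -/
theorem finite_familyClass {S : Set Moduli} (hS : IsOpen S) {r₀ : ℂ} {hr₀ : IsGood r₀}
    (h₀ : familyClass r₀ hr₀ ∈ S) : {r | ¬ ∃ hr : IsGood r, familyClass r hr ∈ S}.Finite := by
  have hS' : IsOpen (Moduli.proj ⁻¹' S) := hS
  obtain ⟨F, hF, -, h⟩ := finite_curve_of_isOpen familyCurve hS' (curve_mem_normalMatrices hr₀) h₀
  refine (hF.union finite_not_isGood).subset fun r hr => ?_
  by_contra hrF
  simp only [Set.mem_union, not_or, Set.mem_ofPred_eq, not_not] at hrF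
  exact hr ⟨hrF.2, h r hrF.1 (curve_mem_normalMatrices hrF.2)⟩

/-- An open set of the moduli space that meets the family has cofinite image in the projective
line. -/
theorem finite_compl_period_image {S : Set Moduli} (hS : IsOpen S) {q : Moduli} (hq : q ∈ S)
    {P : ProjLine} (hP : period q = Sum.inl P) :
    (Sum.inl ⁻¹' (period '' S) : Set ProjLine)ᶜ.Finite := by
  obtain ⟨r₀, hr₀, rfl⟩ := exists_eq_familyClass hP
  refine ((Set.finite_singleton (ProjLine.point 1 0 fun h => one_ne_zero (congrFun h 0))).union
    ((finite_familyClass hS hq).image fun r =>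
      ProjLine.point (invRat r) 1 (ProjLine.vec_ne_zero one_ne_zero))).subset fun Q hQ => ?_
  rcases ProjLine.exists_point Q with rfl | ⟨m, rfl⟩
  · exact Or.inl rfl
  · obtain ⟨r, -, rfl⟩ := exists_invRat m
    refine Or.inr ⟨r, ?_, rfl⟩
    rintro ⟨hr, h⟩
    exact hQ ⟨_, h, period_familyClass r hr⟩

theorem isOpenEmbedding_period : Topology.IsOpenEmbedding period := by
  refine .of_continuous_injective_isOpenMap continuous_period period_injective fun S hS => ?_
  refine isOpen_sum_iff.2 ⟨?_, isOpen_discrete _⟩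
  by_cases h : ∃ q ∈ S, ∃ P, period q = Sum.inl P
  · obtain ⟨q, hq, P, hP⟩ := h
    exact ProjLine.isOpen_of_finite_compl (finite_compl_period_image hS hq hP)
  · convert isOpen_empty
    refine Set.eq_empty_of_forall_notMem ?_
    rintro P ⟨q, hq, hP⟩
    exact h ⟨q, hq, P, hP⟩

/-- A function is regular if its pull-back along the period map is: along the family it is a
rational function of the parameter, which descends to the affine coordinate of the projective line.
-/
theorem regularOn_of_comp_period {V : Set (ProjLine ⊕ Unit)} (hV : V ⊆ Set.range period)
    (hVo : IsOpen V) {φ : ProjLine ⊕ Unit → ℂ} (h : RegularOn (period ⁻¹' V) (φ ∘ period)) :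
    RegularOn V φ := by
  have h' : RegularOn (Moduli.proj ⁻¹' (period ⁻¹' V)) ((φ ∘ period) ∘ Moduli.proj) := h
  refine ⟨?_, trivial⟩
  -- whether `r` is an admissible parameter depends on its invariant only
  have haff : ∀ r, r ≠ 0 →
      Sum.inl (ProjLine.point (invRat r) 1 (ProjLine.vec_ne_zero one_ne_zero)) ∈ V → IsGood r := by
    intro r hr hrV
    obtain ⟨q, hq⟩ := hV hrV
    obtain ⟨s, hs, rfl⟩ := exists_eq_familyClass hq
    rw [period_familyClass] at hq
    have e : invRat s = invRat r := ProjLine.point_injective (Sum.inl_injective hq)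
    rw [isGood_iff hr, ← e, ← isGood_iff hs.1]
    exact hs
  have hinf : ProjLine.point 1 0 (fun h => one_ne_zero (congrFun h 0)) ∉
      (Sum.inl ⁻¹' V : Set ProjLine) := by
    intro hm
    obtain ⟨q, hq⟩ := hV hm
    obtain ⟨s, hs, rfl⟩ := exists_eq_familyClass hq
    rw [period_familyClass] at hq
    simpa using ProjLine.point_eq_point_iff.1 (Sum.inl_injective hq)
  rcases (Sum.inl ⁻¹' V : Set ProjLine).eq_empty_or_nonempty with he | ⟨Q, hQ⟩
  · rw [he]
    exact glue fun x hx => hx.elim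
  obtain ⟨q, hq⟩ := hV hQ
  obtain ⟨r₀, hr₀, rfl⟩ := exists_eq_familyClass hq
  have hmem₀ : period (familyClass r₀ hr₀) ∈ V := by rw [hq]; exact hQ
  set A : ℂ → ProjLine := fun m => ProjLine.point m 1 (ProjLine.vec_ne_zero one_ne_zero) with hA
  obtain ⟨P, Q, hPQ⟩ : ∃ P Q : Polynomial ℂ, ∀ r ∈ {r | IsGood r ∧ Sum.inl (A (invRat r)) ∈ V},
      Q.eval r ≠ 0 ∧ φ (Sum.inl (A (invRat r))) = P.eval r / Q.eval r := by
    refine exists_global_quotient ?_ (ψ := fun r => φ (Sum.inl (A (invRat r)))) fun t ht => ?_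
    · refine (finite_familyClass (hVo.preimage continuous_period) hmem₀).subset fun r hr => ?_
      rintro ⟨hg, hgV⟩
      refine hr ⟨hg, ?_⟩
      rw [Set.mem_preimage, period_familyClass] at hgV
      exact hgV
    · have htm : (⟨curve familyCurve t, curve_mem_normalMatrices ht.1⟩ :
          ZariskiSet normalMatrices) ∈
          Moduli.proj ⁻¹' (period ⁻¹' V) := by
        change period (familyClass t ht.1) ∈ V
        rw [period_familyClass]
        exact ht.2
      obtain ⟨N, hN, htN, p, q, hpq⟩ := h' _ htm
      obtain ⟨F, hF, htF, hFN⟩ :=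
        finite_curve_of_isOpen familyCurve hN (curve_mem_normalMatrices ht.1) htN
      refine ⟨F, hF, htF, MvPolynomial.aeval familyCurve p, MvPolynomial.aeval familyCurve q,
        fun s hs hsF => ?_⟩
      have hsm : (⟨curve familyCurve s, curve_mem_normalMatrices hs.1⟩ :
          ZariskiSet normalMatrices) ∈
          Moduli.proj ⁻¹' (period ⁻¹' V) := by
        change period (familyClass s hs.1) ∈ V
        rw [period_familyClass]
        exact hs.2
      have := hpq _ ⟨hFN s hsF (curve_mem_normalMatrices hs.1), hsm⟩
      rw [eval_curve, eval_curve, ← period_familyClass s hs.1]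
      exact this
  -- `r` is a root of `r ^ 2 = 4 * k * r + 1`, where `k ^ 2` is the affine coordinate
  obtain ⟨P₁, Q₁, hPQ₁⟩ := exists_quotient_of_quadratic (4 * Polynomial.X) (-1) P Q
    (Y := {k | Sum.inl (A (k ^ 2)) ∈ V}) (ψ := fun k => φ (Sum.inl (A (k ^ 2)))) (by
      intro k hk r hr
      simp only [Polynomial.eval_mul, Polynomial.eval_ofNat, Polynomial.eval_X,
        Polynomial.eval_neg, Polynomial.eval_one, sub_neg_eq_add] at hr
      have hr0 : r ≠ 0 := fun h => by rw [h] at hr; norm_num at hr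
      have e : invRat r = k ^ 2 := by
        rw [invRat, div_eq_iff (by simpa using hr0), hr]
        linear_combination (16 * k ^ 2) * hr
      have := hPQ r ⟨haff r hr0 (by rw [e]; exact hk), by rw [e]; exact hk⟩
      rwa [e] at this)
  obtain ⟨P₂, Q₂, hPQ₂⟩ := exists_quotient_of_quadratic 0 (-Polynomial.X) P₁ Q₁
    (Y := {m | Sum.inl (A m) ∈ V}) (ψ := fun m => φ (Sum.inl (A m))) (by
      intro m hm k hk
      have hk : k ^ 2 = m := by simpa using hk
      subst hk
      exact hPQ₁ k hm)
  exact ProjLine.regularOn_of_eval hinf hPQ₂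

theorem isOpenImmersion_period : IsOpenImmersion period :=
  ⟨isOpenEmbedding_period, fun _ hVo hV _ =>
    ⟨regularOn_comp_period, regularOn_of_comp_period hV hVo⟩⟩

/-! ### Irreducible components -/

theorem irreducibleComponents_eq_pair {X : Type*} [TopologicalSpace X] {Z₁ Z₂ : Set X}
    (h₁ : IsIrreducible Z₁) (h₂ : IsIrreducible Z₂) (hc₁ : IsClosed Z₁) (hc₂ : IsClosed Z₂)
    (hu : Z₁ ∪ Z₂ = Set.univ) (h₁₂ : ¬ Z₁ ⊆ Z₂) (h₂₁ : ¬ Z₂ ⊆ Z₁) :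
    irreducibleComponents X = {Z₁, Z₂} := by
  have key : ∀ s : Set X, IsIrreducible s → s ⊆ Z₁ ∨ s ⊆ Z₂ := fun s hs =>
    isPreirreducible_iff_isClosed_union_isClosed.1 hs.2 _ _ hc₁ hc₂ (hu ▸ Set.subset_univ s)
  ext s
  constructor
  · intro hs
    rcases key s hs.1 with h | h
    · exact Or.inl (h.antisymm (hs.2 h₁ h))
    · exact Or.inr (h.antisymm (hs.2 h₂ h))
  · rintro (rfl | rfl)
    · refine ⟨h₁, fun t ht hst => (key t ht).resolve_right fun h => h₁₂ (hst.trans h)⟩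
    · refine ⟨h₂, fun t ht hst => (key t ht).resolve_left fun h => h₂₁ (hst.trans h)⟩

theorem isIrreducible_range_inl :
    IsIrreducible (Set.range Sum.inl : Set (ProjLine ⊕ Unit)) := by
  rw [← Set.image_univ]
  exact ⟨⟨_, ProjLine.point 0 1 (ProjLine.vec_ne_zero one_ne_zero), trivial, rfl⟩,
    ProjLine.isPreirreducible_univ.image _ continuous_inl.continuousOn⟩

theorem isIrreducible_range_inr :
    IsIrreducible (Set.range Sum.inr : Set (ProjLine ⊕ Unit)) := by
  rw [Set.range_unique]
  exact isIrreducible_singleton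

theorem exists_period_eq_inl : ∃ q P, period q = Sum.inl P :=
  ⟨_, _, period_familyClass 2 (by norm_num [IsGood])⟩

theorem exists_period_eq_inr : ∃ q, period q = Sum.inr () := by
  obtain ⟨d, hd⟩ := IsAlgClosed.exists_pow_nat_eq (-3 : ℂ) two_pos
  have hω : ((d - 1) / 2) ^ 2 + (d - 1) / 2 + 1 = 0 := by linear_combination hd / 4
  obtain ⟨q, hq⟩ := exists_labels_stdThree hω
  exact ⟨q, hq.period_stdThree hω⟩

theorem irreducibleComponents_projLine_sum_unit : irreducibleComponents (ProjLine ⊕ Unit) =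
    {Set.range Sum.inl, Set.range Sum.inr} := by
  refine irreducibleComponents_eq_pair isIrreducible_range_inl isIrreducible_range_inr
    isClosed_range_inl isClosed_range_inr Set.range_inl_union_range_inr (fun h => ?_) fun h => ?_
  · obtain ⟨x, hx⟩ := h ⟨ProjLine.point 0 1 (ProjLine.vec_ne_zero one_ne_zero), rfl⟩
    cases hx
  · obtain ⟨x, hx⟩ := h ⟨(), rfl⟩
    cases hx

theorem irreducibleComponents_moduli : irreducibleComponents Moduli =
    {period ⁻¹' Set.range Sum.inl, period ⁻¹' Set.range Sum.inr} := by
  obtain ⟨q₁, P, hq₁⟩ := exists_period_eq_inl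
  obtain ⟨q₂, hq₂⟩ := exists_period_eq_inr
  refine irreducibleComponents_eq_pair
    (isIrreducible_range_inl.preimage isOpenEmbedding_period ⟨_, ⟨P, hq₁.symm⟩, _, rfl⟩)
    (isIrreducible_range_inr.preimage isOpenEmbedding_period ⟨_, ⟨(), hq₂.symm⟩, _, rfl⟩)
    (isClosed_range_inl.preimage continuous_period)
    (isClosed_range_inr.preimage continuous_period) ?_ (fun h => ?_) fun h => ?_
  · rw [← Set.preimage_union, Set.range_inl_union_range_inr, Set.preimage_univ]
  · obtain ⟨x, hx⟩ := h (show q₁ ∈ _ from ⟨P, hq₁.symm⟩)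
    rw [hq₁] at hx
    cases hx
  · obtain ⟨x, hx⟩ := h (show q₂ ∈ _ from ⟨(), hq₂.symm⟩)
    rw [hq₂] at hx
    cases hx

theorem ProjLine.dense_of_finite_compl {S : Set ProjLine} (h : Sᶜ.Finite) : Dense S := by
  rw [dense_iff_inter_open]
  intro U hU hne
  obtain ⟨z, hz⟩ := (h.union (finite_compl_of_isOpen hU hne)).infinite_compl.nonempty
  simp only [Set.mem_compl_iff, Set.mem_union, not_or, not_not] at hz
  exact ⟨z, hz.2, hz.1⟩

theorem closure_image_preimage_inl :
    closure (period '' (period ⁻¹' Set.range Sum.inl)) = Set.range Sum.inl := by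
  obtain ⟨q, P, hq⟩ := exists_period_eq_inl
  have h := ProjLine.dense_of_finite_compl (finite_compl_period_image isOpen_univ trivial hq)
  rw [Set.image_univ] at h
  rw [Set.image_preimage_eq_inter_range, Set.inter_comm, ← Set.image_preimage_eq_inter_range,
    (Topology.IsClosedEmbedding.inl).closure_image_eq, h.closure_eq, Set.image_univ]

theorem closure_image_preimage_inr :
    closure (period '' (period ⁻¹' Set.range Sum.inr)) = Set.range Sum.inr := by
  obtain ⟨q, hq⟩ := exists_period_eq_inr
  rw [Set.image_preimage_eq_of_subset, isClosed_range_inr.closure_eq]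
  rintro _ ⟨⟨⟩, rfl⟩
  exact ⟨q, hq⟩

theorem denseRange_period : DenseRange period := by
  intro x
  have h : ∀ Z : Set Moduli, closure (period '' Z) ⊆ closure (Set.range period) := fun Z =>
    closure_mono (Set.image_subset_range _ _)
  rcases x with P | ⟨⟩
  · exact h _ (closure_image_preimage_inl ▸ Set.mem_range_self P)
  · exact h _ (closure_image_preimage_inr ▸ Set.mem_range_self ())

/-! ### Generic arrangements -/

/-- The classes for which the parameter `(r ^ 2)⁻¹` of the image under the operator is again that of
an unassuming arrangement; the arrangements outside the family impose no condition. -/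
def genericClasses : Set Moduli :=
  {q | ∀ r, IsGood r → Labels (stdFour r) q → IsGood (r ^ 2)⁻¹}

theorem finite_compl_genericClasses : genericClassesᶜ.Finite := by
  have hne : ((Polynomial.X ^ 8 - 1) * ((Polynomial.X ^ 4 - 1) ^ 2 - 16 * Polynomial.X ^ 4) :
      Polynomial ℂ) ≠ 0 := fun h => by
    have := congrArg (Polynomial.eval 2) h
    norm_num at this
  refine Set.Finite.of_finite_image (f := period) ?_ period_injective.injOn
  refine ((Polynomial.finite_setOfPred_isRoot hne).image fun r => Sum.inl
    (ProjLine.point (invRat r) 1 (ProjLine.vec_ne_zero one_ne_zero))).subset ?_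
  rintro _ ⟨q, hq, rfl⟩
  simp only [genericClasses, Set.mem_compl_iff, Set.mem_ofPred_eq, not_forall] at hq
  obtain ⟨r, hr, hl, hbad⟩ := hq
  refine ⟨r, ?_, (hl.period_stdFour hr).symm⟩
  by_contra hroot
  refine hbad ?_
  have hr0 := hr.1
  simp only [Set.mem_ofPred_eq, Polynomial.IsRoot, Polynomial.eval_mul, Polynomial.eval_sub,
    Polynomial.eval_pow, Polynomial.eval_X, Polynomial.eval_one, Polynomial.eval_ofNat,
    mul_eq_zero, not_or] at hroot
  refine ⟨inv_ne_zero (pow_ne_zero 2 hr0), fun h => hroot.1 ?_, fun h => hroot.2 ?_⟩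
  · field_simp at h
    linear_combination -h
  · field_simp at h
    linear_combination h

theorem isOpen_genericClasses : IsOpen genericClasses := by
  rw [← isClosed_compl_iff, ← Set.biUnion_of_singleton genericClassesᶜ]
  refine finite_compl_genericClasses.isClosed_biUnion fun q _ => ?_
  have hq : ({q} : Set Moduli) = period ⁻¹' {period q} := by
    ext q'
    exact period_injective.eq_iff.symm
  rw [hq]
  refine IsClosed.preimage continuous_period ?_
  rcases period q with P | ⟨⟩
  · rw [← Set.image_singleton]
    refine Topology.IsClosedEmbedding.inl.isClosedMap _ (isOpen_compl_iff.1 ?_)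
    exact ProjLine.isOpen_of_finite_compl (by rw [compl_compl]; exact Set.finite_singleton P)
  · rw [← Set.range_unique (f := Sum.inr)]
    exact isClosed_range_inr

theorem dense_genericClasses : Dense genericClasses := by
  rw [dense_iff_inter_open]
  rintro S hS ⟨q, hq⟩
  rcases exists_labels q with ⟨r, hr, hl⟩ | ⟨ω, hω, hl⟩
  · by_contra hne
    have hsub : S ⊆ genericClassesᶜ := fun x hx hx' => hne ⟨x, hx, hx'⟩
    have h1 : (Sum.inl ⁻¹' (period '' S) : Set ProjLine).Finite :=
      ((finite_compl_genericClasses.subset hsub).image period).preimage Sum.inl_injective.injOn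
    have h2 := finite_compl_period_image hS hq (hl.period_stdFour hr)
    refine Set.infinite_univ (α := ProjLine) ?_
    rw [← Set.union_compl_self (Sum.inl ⁻¹' (period '' S) : Set ProjLine)]
    exact h1.union h2
  · refine ⟨q, hq, fun r hr hl' => ?_⟩
    have h := hl'.period_stdFour hr
    rw [hl.period_stdThree hω] at h
    cases h

theorem isUnassuming_lambdaOp {C : Set Line} (hC : IsUnassuming C)
    (h : Moduli.mk C hC ∈ genericClasses) : IsUnassuming (lambdaOp 2 3 C) := by
  have key : ∀ {v : Fin 6 → Fin 3 → ℂ}, Labels v (Moduli.mk C hC) → ∃ hv : ∀ i, v i ≠ 0,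
      ProjEquiv (lambdaOp 2 3 (arr v hv)) (lambdaOp 2 3 C) := by
    rintro v ⟨hv, hu, e⟩
    exact ⟨hv, (moduli_mk_eq_iff.1 e.symm).lambdaOp 2 3⟩
  rcases exists_labels (Moduli.mk C hC) with ⟨r, hr, hl⟩ | ⟨ω, hω, hl⟩
  · obtain ⟨hv, he⟩ := key hl
    have hr' := h r hr hl
    obtain ⟨q, h1, hu, -⟩ := exists_labels_stdFour hr'
    exact (hu.of_projEquiv (lambdaOp_stdFour hr hv h1)).of_projEquiv he
  · obtain ⟨hv, he⟩ := key hl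
    exact ((isUnassuming_stdThree hω hv).of_projEquiv (lambdaOp_stdThree hω hv)).of_projEquiv he

end SixLines

theorem theorem1 :
    (∃ U : Set SixLines.Moduli, IsOpen U ∧ Dense U ∧ Uᶜ.Finite ∧
      ∀ (C : Set SixLines.Line) (hC : SixLines.IsUnassuming C),
        SixLines.Moduli.mk C hC ∈ U → SixLines.IsUnassuming (SixLines.lambdaOp 2 3 C)) ∧
    (∃ Z₁ Z₂ : Set SixLines.Moduli, Z₁ ≠ Z₂ ∧ irreducibleComponents SixLines.Moduli = {Z₁, Z₂} ∧
      ∃ f : SixLines.Moduli → SixLines.ProjLine ⊕ Unit,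
        SixLines.IsOpenImmersion f ∧ DenseRange f ∧
        irreducibleComponents (SixLines.ProjLine ⊕ Unit) =
          {closure (f '' Z₁), closure (f '' Z₂)} ∧
        closure (f '' Z₁) = Set.range Sum.inl ∧ closure (f '' Z₂) = Set.range Sum.inr) := by
  refine ⟨⟨SixLines.genericClasses, SixLines.isOpen_genericClasses, SixLines.dense_genericClasses,
    SixLines.finite_compl_genericClasses, fun C hC h => SixLines.isUnassuming_lambdaOp hC h⟩,
    _, _, ?_, SixLines.irreducibleComponents_moduli, SixLines.period,
    SixLines.isOpenImmersion_period, SixLines.denseRange_period, ?_,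
    SixLines.closure_image_preimage_inl, SixLines.closure_image_preimage_inr⟩
  · intro h
    obtain ⟨q, P, hq⟩ := SixLines.exists_period_eq_inl
    obtain ⟨x, hx⟩ := h.subset (show q ∈ _ from ⟨P, hq.symm⟩)
    rw [hq] at hx
    cases hx
  · rw [SixLines.closure_image_preimage_inl, SixLines.closure_image_preimage_inr]
    exact SixLines.irreducibleComponents_projLine_sum_unit
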